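/- Let $n\ge 2$ be an integer, $\gamma>1$, $1\le\beta<\frac{n+1}{2}$ and $\beta+\frac{n-1}{2}<\alpha<n$, and put $$s=1-\frac12\Big(\frac{\alpha}{\beta}+2-\gamma\Big).$$ For a non-negative locally integrable function $v$ on $\mathbb{R}^n$ let $$\|v\|_{\mathcal{KS}_\alpha}:=\sup_Q\Big(\int_Q v(x)\,dx\Big)^{-1}\int_Q\int_Q\frac{v(x)v(y)}{|x-y|^{n-\alpha}}\,dx\,dy\in[0,\infty],$$ where the supremum is over all dyadic cubes $Q\subset\mathbb{R}^n$ (cubes on which $v=0$ almost everywhere contribute $0$). For $f\in L^2(\mathbb{R}^n)$ and $t\in\mathbb{R}$ let $$|\nabla|^s e^{-it(-\Delta)^{\gamma/2}}f(x)=(2\pi)^{-n}\int_{\mathbb{R}^n}e^{ix\cdot\xi}\,|\xi|^s e^{-it|\xi|^\gamma}\,\widehat f(\xi)\,d\xi,\qquad \widehat f(\xi)=\int_{\mathbb{R}^n} e^{-ix\cdot\xi}f(x)\,dx,$$ in the sense of tempered distributions in $x$, that is, the inverse Fourier transform of the tempered distribution $|\xi|^s e^{-it|\xi|^\gamma}\widehat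 f(\xi)$. Then there is a constant $C=C(n,\gamma,\alpha,\beta)<\infty$ such that for every $f\in L^2(\mathbb{R}^n)$ this distribution is, for almost every $t$, a locally integrable function of $x$, jointly measurable in $(x,t)$, and for every measurable weight $w\ge 0$ on $\mathbb{R}^n$ with $w^\beta$ locally integrable $$\Big(\int_{\mathbb{R}}\int_{\mathbb{R}^n}\big||\nabla|^s e^{-it(-\Delta)^{\gamma/2}}f(x)\big|^2\,w(x)\,dx\,dt\Big)^{1/2}\le C\,\|w^\beta\|_{\mathcal{KS}_\alpha}^{\frac1{2\beta}}\,\|f\|_{L^2(\mathbb{R}^n)}$$ (the right-hand side being $0$ if $f=0$). -/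

import Mathlib

open MeasureTheory FourierTransform
open scoped ENNReal NNReal ContDiff

noncomputable section

/-- The half-open dyadic cube of side length `2 ^ k` with lower corner `2 ^ k * m`. -/
def dyadicCube {n : ℕ} (k : ℤ) (m : Fin n → ℤ) : Set (EuclideanSpace ℝ (Fin n)) :=
  {x | ∀ i, (2 : ℝ) ^ k * (m i : ℝ) ≤ x i ∧ x i < (2 : ℝ) ^ k * ((m i : ℝ) + 1)}

/-- The Kerman-Sawyer quantity `‖v‖_{KS_α}` of a (locally integrable) weight `v`, with values in
`[0, ∞]`; the supremum is over all dyadic cubes. A cube on which `v` vanishes almost everywhere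
contributes `0`. -/
def ksNorm {n : ℕ} (α : ℝ) (v : EuclideanSpace ℝ (Fin n) → ℝ≥0∞) : ℝ≥0∞ :=
  ⨆ (k : ℤ) (m : Fin n → ℤ),
    (∫⁻ x in dyadicCube k m, v x)⁻¹ *
      ∫⁻ x in dyadicCube k m, ∫⁻ y in dyadicCube k m,
        v x * v y / edist x y ^ ((n : ℝ) - α)

/-- The Fourier symbol `|ξ|^s * exp (-i t |ξ|^γ)` of `|∇|^s e^{-it(-Δ)^{γ/2}}`, written for
the normalization `∫ e^{-2πi x·η} f(x) dx` of the Fourier transform, that is, with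
`ξ = 2 π η`. -/
def fracSymbol {n : ℕ} (γ s t : ℝ) (η : EuclideanSpace ℝ (Fin n)) : ℂ :=
  (((2 * Real.pi * ‖η‖) ^ s : ℝ) : ℂ) *
    Complex.exp (-(Complex.I * (t : ℂ) * (((2 * Real.pi * ‖η‖) ^ γ : ℝ) : ℂ)))

/-- `u t x` is the function `|∇|^s e^{-it(-Δ)^{γ/2}} f (x)` on space-time, for `f` in `L²`.
The operator is the Fourier multiplier with symbol `fracSymbol γ s t`, applied to the Plancherel
Fourier transform of `f`. As `|ξ|^s` times that transform need be neither in `L¹` nor in `L²`,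
the result is a distribution in `x`, and `u t` is required to be this distribution: for almost
every `t`, the function `u t` is locally integrable and its pairing with each test function `φ` is
the (absolutely convergent) pairing of the symbol times the Fourier transform of `f` with the
inverse Fourier transform of `φ`. This determines `u` almost everywhere. -/
structure IsFracPropagation {n : ℕ} (γ s : ℝ)
    (f : Lp ℂ 2 (volume : Measure (EuclideanSpace ℝ (Fin n))))
    (u : ℝ → EuclideanSpace ℝ (Fin n) → ℂ) : Prop where
  aestronglyMeasurable :
    AEStronglyMeasurable (Function.uncurry u)
      ((volume : Measure ℝ).prod (volume : Measure (EuclideanSpace ℝ (Fin n))))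
  locallyIntegrable : ∀ᵐ t : ℝ, LocallyIntegrable (u t) volume
  integrable_pairing : ∀ (t : ℝ) (φ : EuclideanSpace ℝ (Fin n) → ℂ),
    ContDiff ℝ ∞ φ → HasCompactSupport φ →
      Integrable (fun η => fracSymbol γ s t η * (𝓕 f) η * (𝓕⁻ φ) η) volume
  pairing_eq : ∀ᵐ t : ℝ, ∀ φ : EuclideanSpace ℝ (Fin n) → ℂ,
    ContDiff ℝ ∞ φ → HasCompactSupport φ →
      ∫ x, u t x * φ x = ∫ η, fracSymbol γ s t η * (𝓕 f) η * (𝓕⁻ φ) η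

/-- The norm of `u` in `L²_{x,t}(w(x))`, with values in `[0, ∞]`. -/
def weightedNorm {n : ℕ} (w : EuclideanSpace ℝ (Fin n) → ℝ≥0∞)
    (u : ℝ → EuclideanSpace ℝ (Fin n) → ℂ) : ℝ≥0∞ :=
  (∫⁻ t : ℝ, ∫⁻ x, ‖u t x‖ₑ ^ (2 : ℕ) * w x) ^ (1 / 2 : ℝ)

end

/-!
The inequality is reduced, frequency by frequency, to a weighted estimate for the Fourier extension
operator of the unit sphere, in which the weight enters only through a Morrey condition.

*From the weight to a Morrey condition.* On a cube `Q` of diameter `D` the kernel `|x - y|^(α - n)`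
is at least `D^(α - n)`, so the Kerman-Sawyer norm of `v = w ^ β` bounds the mass `∫_Q v` by a
multiple of `‖v‖ D^(n - α)`, and a ball is covered by `2 ^ n` dyadic cubes of comparable size
(`exists_lintegral_ball_le_ksNorm`). From here on only `∫_{B(x, ρ)} w ^ β ≤ M ρ ^ δ`, with
`δ = n - α`, is used.

*The extension estimate.* Let `E g` be the inverse Fourier transform of `g` times the surface
measure `σ`. By the `TT*` argument (`lintegral_sphereExt_sq_le`) the bound of `E` from `L²(σ)` to
`L²(ν)` follows from that of the quadratic form on `L²(ν)` with kernel `σ^(x - y)`. The kernel decays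
like `|x| ^ (-(n - 1) / 2)`: as a function of `|x|` it solves Bessel's equation, for which there is
an almost conserved energy (`bessel_decay`, `exists_norm_sphereKernel_le`). If the measure `ν` itself
satisfies the Morrey condition with exponent `δ < (n - 1) / 2`, Schur's test suffices
(`exists_sphereExt_le_of_morrey`). If in addition `ν` has a density bounded by `Λ`, the part of the
kernel at distance at most `R` contributes only `O(R Λ)`, since `σ` convolved with a bump at scale
`1 / R` is `O(R)` (`exists_quadBound_cutoff`), while Schur's test bounds the far part by
`O(R ^ (δ - (n - 1) / 2))`. Under the Morrey condition for `w ^ β`, the weight is split into its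
dyadic level sets. On the set where `w ≈ 2 ^ (-k)` the Morrey constant is `O(2 ^ (k (β - 1)))`, and
with `R` a suitable power of `2 ^ k` both contributions decay geometrically in `k`, exactly because
`β - 1 < (n - 1) / 2 - δ`, that is, `β + (n - 1) / 2 < α` (`exists_weighted_sphereExt_le`). Scaling
gives the estimate for all radii.

*From the sphere to the flow.* If the Fourier transform of `f` is bounded and supported in an
annulus, polar coordinates write the propagation as a one-dimensional oscillatory integral in the
radius `r` with phase `t r ^ γ`. After the substitution `r ↦ r ^ γ`, Plancherel's theorem in `t`
(`lintegral_time_sq_le`) turns the left-hand side into an integral over `r` of weighted extension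
norms. The value of `s` makes the powers of `r` cancel, and what is left is the norm of `f`
(`exists_weighted_freqEvol_le`).

*General data.* The estimate for one fixed positive integrable weight shows that the propagations
of frequency-localized approximations of `f` converge, almost everywhere and, for almost every `t`,
locally in `L²` of space. The limit has the required distributional pairing, because `2 s > -n`
makes `|ξ| ^ s φ^` square integrable for a test function `φ` (`exists_isFracPropagation`). Fatou's
lemma carries the weighted estimate over to the limit, for all weights at once.
-/

noncomputable section

open Set Metric Filter Topology
open scoped Pointwise ComplexConjugate

section PolarCoordinates

variable {E : Type*} [NormedAddCommGroup E] [InnerProductSpace ℝ E] [FiniteDimensional ℝ E]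
  [MeasurableSpace E] [BorelSpace E]

/-! ### Plancherel's theorem for integrable functions -/

/-- The Plancherel transform of an integrable function in `L²` is given by the Fourier integral. -/
theorem coeFn_fourier_toLp {h : E → ℂ} (h1 : Integrable h) (h2 : MemLp h 2) :
    (𝓕 (h2.toLp h) : Lp ℂ 2 (volume : Measure E)) =ᵐ[volume] 𝓕 h := by
  have hcont : Continuous (𝓕 h) :=
    VectorFourier.fourierIntegral_continuous Real.continuous_fourierChar
      (by exact continuous_inner) h1
  refine ae_eq_of_integral_contDiff_smul_eq
    ((Lp.memLp (𝓕 (h2.toLp h))).locallyIntegrable (by norm_num)) hcont.locallyIntegrable ?_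
  intro g hg hgc
  have hgc' : HasCompactSupport (fun x => (g x : ℂ)) := hgc.comp_left (g := fun x : ℝ => (x : ℂ)) rfl
  have hg' : ContDiff ℝ ∞ (fun x => (g x : ℂ)) := Complex.ofRealCLM.contDiff.comp hg
  have key := congrArg (fun T => T (hgc'.toSchwartzMap hg'))
    (Lp.fourier_toTemperedDistribution_eq (h2.toLp h))
  simp only [TemperedDistribution.fourier_apply, Lp.toTemperedDistribution_apply] at key
  have e1 : ∫ x, (𝓕 (hgc'.toSchwartzMap hg')) x • (h2.toLp h) x
      = ∫ x, 𝓕 (fun x => (g x : ℂ)) x • h x := by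
    refine integral_congr_ae ?_
    filter_upwards [h2.coeFn_toLp] with x hx
    rw [hx, SchwartzMap.fourier_coe]
    rfl
  have e2 : ∫ x, 𝓕 (fun x => (g x : ℂ)) x • h x = ∫ x, (g x : ℂ) • 𝓕 h x := by
    have hgi : Integrable (fun x => (g x : ℂ)) :=
      hg'.continuous.integrable_of_hasCompactSupport hgc'
    have := VectorFourier.integral_fourierIntegral_smul_eq_flip (L := innerₗ E)
      (μ := (volume : Measure E)) (ν := (volume : Measure E))
      Real.continuous_fourierChar continuous_inner hgi h1
    rw [flip_innerₗ] at this
    exact this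
  rw [e1, e2] at key
  have hr : ∀ (x : E) (z : ℂ), g x • z = (g x : ℂ) • z := fun x z => by simp
  simp only [hr]
  exact key.symm

theorem lintegral_enorm_fourier_sq {h : E → ℂ} (h1 : Integrable h) (h2 : MemLp h 2) :
    ∫⁻ ξ, ‖𝓕 h ξ‖ₑ ^ 2 = ∫⁻ x, ‖h x‖ₑ ^ 2 := by
  have hp : ∀ u : E → ℂ, ∫⁻ x, ‖u x‖ₑ ^ 2 = (eLpNorm u 2 volume) ^ 2 := fun u => by
    have := eLpNorm_nnreal_pow_eq_lintegral (f := u) (μ := (volume : Measure E))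
      (p := 2) (by norm_num)
    simpa using this.symm
  rw [hp, hp, ← eLpNorm_congr_ae (coeFn_fourier_toLp h1 h2)]
  congr 1
  have hn := Lp.norm_fourier_eq (h2.toLp h)
  rw [Lp.norm_def, Lp.norm_def, ENNReal.toReal_eq_toReal_iff' (Lp.eLpNorm_ne_top _)
    (Lp.eLpNorm_ne_top _)] at hn
  rw [hn]
  exact eLpNorm_congr_ae h2.coeFn_toLp

/-! ### Polar coordinates and the surface measure of the sphere -/

/-- The integral in polar coordinates, for non-negative functions. -/
theorem lintegral_polar [Nontrivial E] {f : E → ℝ≥0∞} (hf : Measurable f) :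
    ∫⁻ x, f x = ∫⁻ r in Ioi (0 : ℝ), ENNReal.ofReal (r ^ (Module.finrank ℝ E - 1)) *
      ∫⁻ θ, f (r • (θ : E)) ∂(volume : Measure E).toSphere := by
  have hmp := Measure.measurePreserving_homeomorphUnitSphereProd (volume : Measure E)
  have hm : Measurable fun p : sphere (0 : E) 1 × Ioi (0 : ℝ) => f ((p.2 : ℝ) • (p.1 : E)) := by
    fun_prop
  calc ∫⁻ x, f x = ∫⁻ x in {(0 : E)}ᶜ, f x := by
        rw [restrict_compl_singleton]
    _ = ∫⁻ x : ({0}ᶜ : Set E), f x ∂(Measure.comap Subtype.val volume) := by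
        rw [lintegral_subtype_comap (measurableSet_singleton (0 : E)).compl]
    _ = ∫⁻ p, f ((p.2 : ℝ) • (p.1 : E)) ∂((volume : Measure E).toSphere.prod
          (Measure.volumeIoiPow (Module.finrank ℝ E - 1))) := by
        rw [← hmp.lintegral_comp hm]
        refine lintegral_congr fun x => ?_
        congr 1
        have hx : ‖(x : E)‖ ≠ 0 := norm_ne_zero_iff.2 x.2
        simp [smul_smul, hx]
    _ = _ := by
        rw [lintegral_prod_symm _ hm.aemeasurable, Measure.volumeIoiPow,
          lintegral_withDensity_eq_lintegral_mul _ (by fun_prop)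
            (Measurable.lintegral_prod_left' hm),
          ← lintegral_subtype_comap measurableSet_Ioi (μ := (volume : Measure ℝ))
            (fun r => ENNReal.ofReal (r ^ (Module.finrank ℝ E - 1)) *
              ∫⁻ θ, f (r • (θ : E)) ∂(volume : Measure E).toSphere)]
        rfl

/-- The integral in polar coordinates. -/
theorem integral_polar [Nontrivial E] {f : E → ℂ} (hfi : Integrable f) :
    ∫ x, f x = ∫ r in Ioi (0 : ℝ), ((r ^ (Module.finrank ℝ E - 1) : ℝ) : ℂ) *
      ∫ θ, f (r • (θ : E)) ∂(volume : Measure E).toSphere := by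
  have hmp := Measure.measurePreserving_homeomorphUnitSphereProd (volume : Measure E)
  have hme := (homeomorphUnitSphereProd E).measurableEmbedding
  have hfx : ∀ x : ({0}ᶜ : Set E), f x =
      (fun p : sphere (0 : E) 1 × Ioi (0 : ℝ) => f ((p.2 : ℝ) • (p.1 : E)))
        (homeomorphUnitSphereProd E x) := by
    intro x
    have hx : ‖(x : E)‖ ≠ 0 := norm_ne_zero_iff.2 x.2
    simp [smul_smul, hx]
  have hint : Integrable (fun p : sphere (0 : E) 1 × Ioi (0 : ℝ) => f ((p.2 : ℝ) • (p.1 : E)))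
      ((volume : Measure E).toSphere.prod
          (Measure.volumeIoiPow (Module.finrank ℝ E - 1))) := by
    rw [← hmp.integrable_comp_emb hme]
    have : Integrable (fun x : ({0}ᶜ : Set E) => f x) (Measure.comap Subtype.val volume) := by
      have := (MeasurableEmbedding.subtype_coe
        (measurableSet_singleton (0 : E)).compl).integrableOn_range_iff_comap
          (μ := (volume : Measure E)) (f := f)
      exact this.1 hfi.integrableOn
    refine this.congr (Eventually.of_forall fun x => ?_)
    exact hfx x
  calc ∫ x, f x = ∫ x in {(0 : E)}ᶜ, f x := by
        rw [restrict_compl_singleton]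
    _ = ∫ x : ({0}ᶜ : Set E), f x ∂(Measure.comap Subtype.val volume) := by
        rw [integral_subtype_comap (measurableSet_singleton (0 : E)).compl]
    _ = ∫ p, f ((p.2 : ℝ) • (p.1 : E)) ∂((volume : Measure E).toSphere.prod
          (Measure.volumeIoiPow (Module.finrank ℝ E - 1))) := by
        rw [← hmp.integral_comp hme]
        exact integral_congr_ae (Eventually.of_forall hfx)
    _ = _ := by
        rw [integral_prod_symm _ hint, Measure.volumeIoiPow,
          integral_withDensity_eq_integral_toReal_smul (by fun_prop)
            (Eventually.of_forall fun _ => ENNReal.ofReal_lt_top),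
          ← integral_subtype_comap measurableSet_Ioi (μ := (volume : Measure ℝ))
            (fun r => ((r ^ (Module.finrank ℝ E - 1) : ℝ) : ℂ) *
              ∫ θ, f (r • (θ : E)) ∂(volume : Measure E).toSphere)]
        refine integral_congr_ae (Eventually.of_forall fun r => ?_)
        have hr : 0 ≤ (r : ℝ) ^ (Module.finrank ℝ E - 1) := pow_nonneg (le_of_lt r.2) _
        simp only [ENNReal.toReal_ofReal hr, Complex.real_smul]

/-- The action of a linear isometry on the unit sphere. -/
def sphereMap {E : Type*} [NormedAddCommGroup E] [InnerProductSpace ℝ E] (T : E ≃ₗᵢ[ℝ] E)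
    (θ : sphere (0 : E) 1) : sphere (0 : E) 1 :=
  ⟨T θ, by simp⟩

theorem measurable_sphereMap {E : Type*} [NormedAddCommGroup E] [InnerProductSpace ℝ E]
    [MeasurableSpace E] [BorelSpace E] (T : E ≃ₗᵢ[ℝ] E) : Measurable (sphereMap T) :=
  (T.continuous.measurable.comp measurable_subtype_coe).subtype_mk

/-- The surface measure is invariant under linear isometries. -/
theorem measurePreserving_sphereMap (T : E ≃ₗᵢ[ℝ] E) :
    MeasurePreserving (sphereMap T) (volume : Measure E).toSphere
      (volume : Measure E).toSphere := by
  refine ⟨measurable_sphereMap T, ?_⟩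
  ext s hs
  rw [Measure.map_apply (measurable_sphereMap T) hs,
    Measure.toSphere_apply' _ (measurable_sphereMap T hs), Measure.toSphere_apply' _ hs]
  congr 1
  have : Ioo (0 : ℝ) 1 • ((↑) '' (sphereMap T ⁻¹' s) : Set E) =
      T ⁻¹' (Ioo (0 : ℝ) 1 • ((↑) '' s : Set E)) := by
    ext x
    constructor
    · rintro ⟨r, hr, _, ⟨θ, hθ, rfl⟩, rfl⟩
      exact ⟨r, hr, _, ⟨_, hθ, rfl⟩, by simp [sphereMap]⟩
    · rintro ⟨r, hr, _, ⟨θ, hθ, rfl⟩, h⟩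
      refine ⟨r, hr, _, ⟨sphereMap T.symm θ, ?_, rfl⟩, ?_⟩
      · have : sphereMap T (sphereMap T.symm θ) = θ := Subtype.ext (by simp [sphereMap])
        rwa [mem_preimage, this]
      · apply T.injective
        rw [← h]
        simp [sphereMap]
  rw [this]
  exact (LinearIsometryEquiv.measurePreserving T).measure_preimage_emb
    T.toHomeomorph.measurableEmbedding _

/-- The surface measure of a spherical cap of radius `ρ` is `O(ρ ^ (dim E - 1))`: the cone over a
cap with centre `θ` is covered by `O(1 / ρ)` balls of radius `O(ρ)` with centres on the segment
from `0` to `θ`. -/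
theorem exists_toSphere_ball_le [Nontrivial E] :
    ∃ C : ℝ, 0 ≤ C ∧ ∀ (ζ : E) (ρ : ℝ), 0 < ρ →
      (volume : Measure E).toSphere {θ | dist ζ θ < ρ} ≤
        ENNReal.ofReal (C * ρ ^ (Module.finrank ℝ E - 1)) := by
  set d := Module.finrank ℝ E with hd
  have hd1 : 1 ≤ d := Module.finrank_pos
  set σ := (volume : Measure E).toSphere with hσ
  set b := (volume : Measure E).real (ball 0 1) with hb
  have hb0 : 0 ≤ b := measureReal_nonneg
  refine ⟨σ.real univ + d * (2 * 3 ^ d * b), by positivity, fun ζ ρ hρ => ?_⟩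
  rcases le_or_gt 1 ρ with h1 | h1
  · calc σ {θ | dist ζ θ < ρ} ≤ σ univ := measure_mono (subset_univ _)
      _ = ENNReal.ofReal (σ.real univ) := by
          rw [ofReal_measureReal]
      _ ≤ _ := by
          apply ENNReal.ofReal_le_ofReal
          have h2 : 1 ≤ ρ ^ (d - 1) := one_le_pow₀ h1
          have : 0 ≤ σ.real univ := measureReal_nonneg
          have h3 : 0 ≤ d * (2 * 3 ^ d * b) := by positivity
          nlinarith
  rcases eq_empty_or_nonempty {θ : sphere (0 : E) 1 | dist ζ θ < ρ} with he | ⟨θ₀, hθ₀⟩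
  · rw [he]; simp
  have hmeas : MeasurableSet {θ : sphere (0 : E) 1 | dist ζ θ < ρ} := by
    apply measurableSet_lt <;> fun_prop
  rw [hσ, Measure.toSphere_apply' _ hmeas]
  set N := ⌈1 / ρ⌉₊ with hN
  have hN1 : 1 / ρ ≤ N := Nat.le_ceil _
  have hN2 : (N : ℝ) < 1 / ρ + 1 := Nat.ceil_lt_add_one (by positivity)
  have hNpos : (0 : ℝ) < N := lt_of_lt_of_le (by positivity) hN1
  have hsub : Ioo (0 : ℝ) 1 • ((↑) '' {θ : sphere (0 : E) 1 | dist ζ θ < ρ} : Set E) ⊆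
      ⋃ j ∈ Finset.range N, ball (((j : ℝ) / N) • (θ₀ : E)) (3 * ρ) := by
    rintro _ ⟨r, hr, _, ⟨θ, hθ, rfl⟩, rfl⟩
    have hjle : (⌊r * N⌋₊ : ℝ) ≤ r * N := Nat.floor_le (by have := hr.1; positivity)
    have hjlt : r * N < ⌊r * N⌋₊ + 1 := Nat.lt_floor_add_one _
    refine mem_biUnion (x := ⌊r * N⌋₊) ?_ ?_
    · simp only [Finset.coe_range, mem_Iio]
      have : (⌊r * N⌋₊ : ℝ) < N := lt_of_le_of_lt hjle (by nlinarith [hr.2])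
      exact_mod_cast this
    · rw [mem_ball, dist_eq_norm]
      simp only [mem_ofPred_eq] at hθ hθ₀
      have hww : ‖(θ : E) - θ₀‖ < 2 * ρ := by
        rw [← dist_eq_norm]
        have := dist_triangle_left (θ : E) θ₀ ζ
        linarith
      have hdec : r • (θ : E) - ((⌊r * N⌋₊ : ℝ) / N) • (θ₀ : E) =
          r • ((θ : E) - θ₀) + (r - (⌊r * N⌋₊ : ℝ) / N) • (θ₀ : E) := by
        rw [smul_sub, sub_smul]; abel
      have hn0 : ‖(θ₀ : E)‖ = 1 := by simp
      have h5 : |r - (⌊r * N⌋₊ : ℝ) / N| ≤ ρ := by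
        have e : r - (⌊r * N⌋₊ : ℝ) / N = (r * N - ⌊r * N⌋₊) / N := by field_simp
        rw [e, abs_of_nonneg (div_nonneg (by linarith) hNpos.le), div_le_iff₀ hNpos]
        have : 1 ≤ ρ * N := by
          rw [div_le_iff₀ hρ] at hN1; linarith
        linarith
      calc _ ≤ ‖r • ((θ : E) - θ₀)‖ + ‖(r - (⌊r * N⌋₊ : ℝ) / N) • (θ₀ : E)‖ := by
            rw [hdec]; exact norm_add_le _ _
        _ = r * ‖(θ : E) - θ₀‖ + |r - (⌊r * N⌋₊ : ℝ) / N| := by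
            rw [norm_smul, norm_smul, hn0, mul_one, Real.norm_eq_abs, Real.norm_eq_abs,
              abs_of_pos hr.1]
        _ < 3 * ρ := by
            have := norm_nonneg ((θ : E) - θ₀)
            nlinarith [hr.1, hr.2]
  have hball : ∀ x : E, volume (ball x (3 * ρ)) = ENNReal.ofReal ((3 * ρ) ^ d * b) := by
    intro x
    rw [Measure.addHaar_ball _ x (by positivity), hb, ENNReal.ofReal_mul (by positivity),
      ofReal_measureReal]
  calc (d : ℝ≥0∞) * volume _ ≤ d * ∑ j ∈ Finset.range N,
        volume (ball (((j : ℝ) / N) • (θ₀ : E)) (3 * ρ)) := by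
        gcongr
        exact (measure_mono hsub).trans (measure_biUnion_finset_le _ _)
    _ = ENNReal.ofReal (d * (N * ((3 * ρ) ^ d * b))) := by
        simp only [hball, Finset.sum_const, Finset.card_range, nsmul_eq_mul]
        rw [ENNReal.ofReal_mul (p := (d : ℝ)) (by positivity),
          ENNReal.ofReal_mul (p := (N : ℝ)) (by positivity), ENNReal.ofReal_natCast, ENNReal.ofReal_natCast]
    _ ≤ _ := by
        apply ENNReal.ofReal_le_ofReal
        have hNr : N * ρ ≤ 2 := by
          have := mul_lt_mul_of_pos_right hN2 hρ
          have e : (1 / ρ + 1) * ρ = 1 + ρ := by field_simp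
          linarith
        have hpow : ρ ^ d = ρ ^ (d - 1) * ρ := by
          rw [← pow_succ, Nat.sub_add_cancel hd1]
        have e : d * (N * ((3 * ρ) ^ d * b)) = (d * 3 ^ d * b * ρ ^ (d - 1)) * (N * ρ) := by
          rw [mul_pow, hpow]; ring
        rw [e]
        have h0 : 0 ≤ d * 3 ^ d * b * ρ ^ (d - 1) := by positivity
        have h1 : 0 ≤ σ.real univ * ρ ^ (d - 1) := by positivity
        nlinarith

end PolarCoordinates

section SurfaceMeasure

/-! ### Decay of the Fourier transform of the surface measure -/

/-- Differentiation under the integral sign when the integrand is continuous and its derivative is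
bounded and the measure is finite. -/
theorem hasDerivAt_integral_of_bounded {X : Type*} [TopologicalSpace X] [CompactSpace X]
    [MeasurableSpace X] [BorelSpace X] (μ : Measure X) [IsFiniteMeasure μ] {φ φ' : ℝ → X → ℝ}
    {B : ℝ} (hφ : ∀ r, Continuous (φ r)) (hφ' : ∀ r, Continuous (φ' r))
    (hB : ∀ r x, |φ' r x| ≤ B) (hd : ∀ r x, HasDerivAt (fun r => φ r x) (φ' r x) r) (r : ℝ) :
    HasDerivAt (fun r => ∫ x, φ r x ∂μ) (∫ x, φ' r x ∂μ) r :=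
  (hasDerivAt_integral_of_dominated_loc_of_deriv_le (s := univ) (bound := fun _ => B)
    Filter.univ_mem (Eventually.of_forall fun r => (hφ r).aestronglyMeasurable)
    ((hφ r).integrable_of_hasCompactSupport (HasCompactSupport.of_compactSpace _))
    (hφ' r).aestronglyMeasurable (Eventually.of_forall fun x r _ => hB r x)
    (integrable_const B) (Eventually.of_forall fun x r _ => hd r x)).2

/-- A real solution of Bessel's equation `q'' + (2κ / r) q' + q = 0` on the half line decays like
`r ^ (-κ)`, with a bound depending only on the data at `r = 1`. The energy
`r ^ (2κ) * (q² + (q' + κ q / r)²)` has logarithmic derivative `O(1 / r²)`. -/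
theorem bessel_decay {m : ℕ} {q q' : ℝ → ℝ} {A : ℝ} (hq : ∀ r, HasDerivAt q (q' r) r)
    (hq' : ∀ r, 0 < r → HasDerivAt q' (-(m / r * q' r) - q r) r)
    (hA : |q 1| ≤ A) (hA' : |q' 1| ≤ A) {r : ℝ} (hr : 1 ≤ r) :
    q r ^ 2 * r ^ m ≤ A ^ 2 * (1 + (1 + m) ^ 2) * Real.exp ((m + 1) ^ 2) := by
  set κ : ℝ := m / 2 with hκ
  set c : ℝ := (m + 1) ^ 2 with hc
  set p : ℝ → ℝ := fun r => q' r + κ * q r / r with hp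
  set En : ℝ → ℝ := fun r => r ^ m * (q r ^ 2 + p r ^ 2) with hEn
  have hm0 : (0 : ℝ) ≤ m := Nat.cast_nonneg m
  have hp' : ∀ r, 0 < r → HasDerivAt p (-q r - κ / r * p r + (κ ^ 2 - κ) * q r / r ^ 2) r := by
    intro r hr
    have h := (hq' r hr).add (((hq r).const_mul κ).div (hasDerivAt_id r) hr.ne')
    refine h.congr_deriv ?_
    simp only [hp, hκ, id]
    field_simp
    ring
  have hE' : ∀ r, 0 < r → HasDerivAt En (r ^ m * (2 * (κ ^ 2 - κ) * q r * p r / r ^ 2)) r := by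
    intro r hr
    have h := (hasDerivAt_pow m r).mul (((hq r).pow 2).add ((hp' r hr).pow 2))
    refine h.congr_deriv ?_
    have hq2 : q' r = p r - κ * q r / r := by simp [hp]
    have hmr : (m : ℝ) * r ^ (m - 1) = r ^ m * (2 * κ / r) := by
      rcases Nat.eq_zero_or_pos m with h0 | h0
      · simp [hκ, h0]
      · rw [← Nat.sub_add_cancel h0, pow_succ, hκ]
        push_cast [Nat.sub_add_cancel h0]
        field_simp
    simp only [Pi.add_apply, Pi.pow_apply]
    rw [hmr, hq2]
    field_simp
    ring
  have hG' : ∀ r, 0 < r → HasDerivAt (fun r => En r * Real.exp (c * r⁻¹))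
      (r ^ m * (2 * (κ ^ 2 - κ) * q r * p r / r ^ 2) * Real.exp (c * r⁻¹) +
        En r * (Real.exp (c * r⁻¹) * (c * (-(r ^ 2)⁻¹)))) r := by
    intro r hr
    exact (hE' r hr).mul (((hasDerivAt_inv hr.ne').const_mul c).exp)
  have hanti : AntitoneOn (fun r => En r * Real.exp (c * r⁻¹)) (Ici 1) := by
    refine antitoneOn_of_deriv_nonpos (convex_Ici 1) (fun r hr => ?_) (fun r hr => ?_)
      (fun r hr => ?_)
    · exact (hG' r (lt_of_lt_of_le one_pos hr)).continuousAt.continuousWithinAt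
    · rw [interior_Ici] at hr
      exact (hG' r (one_pos.trans hr)).differentiableAt.differentiableWithinAt
    · rw [interior_Ici] at hr
      have hr0 : 0 < r := one_pos.trans hr
      rw [(hG' r hr0).deriv]
      have hfac : r ^ m * (2 * (κ ^ 2 - κ) * q r * p r / r ^ 2) * Real.exp (c * r⁻¹) +
        En r * (Real.exp (c * r⁻¹) * (c * (-(r ^ 2)⁻¹))) =
        -(r ^ m / r ^ 2 * Real.exp (c * r⁻¹) *
          (c * (q r ^ 2 + p r ^ 2) - (κ ^ 2 - κ) * (2 * q r * p r))) := by
        simp only [hEn]; field_simp; ring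
      rw [hfac, neg_nonpos]
      refine mul_nonneg (by positivity) ?_
      have h1 : |κ ^ 2 - κ| ≤ c := by
        rw [abs_le, hκ, hc]; constructor <;> nlinarith
      have h2 : |2 * q r * p r| ≤ q r ^ 2 + p r ^ 2 := by
        rw [abs_le]; constructor <;> nlinarith [sq_nonneg (q r + p r), sq_nonneg (q r - p r)]
      have h3 : (κ ^ 2 - κ) * (2 * q r * p r) ≤ c * (q r ^ 2 + p r ^ 2) :=
        (le_abs_self _).trans (by rw [abs_mul]; exact mul_le_mul h1 h2 (abs_nonneg _) (by positivity))
      linarith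
  have hle := hanti (mem_Ici.2 le_rfl) (mem_Ici.2 hr) hr
  simp only [inv_one, mul_one] at hle
  have hr0 : 0 < r := one_pos.trans_le hr
  have hA0 : 0 ≤ A := (abs_nonneg _).trans hA
  have hq1 : q 1 ^ 2 ≤ A ^ 2 := sq_le_sq' (abs_le.1 hA).1 (abs_le.1 hA).2
  have hp1 : p 1 ^ 2 ≤ (A * (1 + m)) ^ 2 := by
    refine sq_le_sq' ?_ ?_ <;> simp only [hp, hκ, div_one] <;>
      nlinarith [(abs_le.1 hA).1, (abs_le.1 hA).2, (abs_le.1 hA').1, (abs_le.1 hA').2]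
  calc q r ^ 2 * r ^ m ≤ En r := by
        simp only [hEn]; nlinarith [mul_nonneg (pow_nonneg hr0.le m) (sq_nonneg (p r))]
    _ ≤ En r * Real.exp (c * r⁻¹) := by
        have hEn0 : 0 ≤ En r := by positivity
        exact le_mul_of_one_le_right hEn0 (Real.one_le_exp (by positivity))
    _ ≤ En 1 * Real.exp c := hle
    _ ≤ _ := by
        gcongr
        simp only [hEn, one_pow, one_mul]
        linarith

variable {E : Type*} [NormedAddCommGroup E] [InnerProductSpace ℝ E] [FiniteDimensional ℝ E]
  [MeasurableSpace E] [BorelSpace E]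

/-- The Fourier transform `∫ exp (2πi ⟪x, θ⟫) dσ(θ)` of the surface measure `σ` of the unit
sphere. -/
def sphereKernel (x : E) : ℂ :=
  ∫ θ : sphere (0 : E) 1, (𝐞 (inner ℝ x (θ : E)) : ℂ) ∂(volume : Measure E).toSphere

theorem integral_sphereMap (T : E ≃ₗᵢ[ℝ] E) (F : E → ℝ) :
    ∫ θ : sphere (0 : E) 1, F (T θ) ∂(volume : Measure E).toSphere =
      ∫ θ : sphere (0 : E) 1, F θ ∂(volume : Measure E).toSphere :=
  (measurePreserving_sphereMap T).integral_comp'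
    (f := (⟨⟨sphereMap T, sphereMap T.symm, fun θ => Subtype.ext (by simp [sphereMap]),
      fun θ => Subtype.ext (by simp [sphereMap])⟩, measurable_sphereMap T,
      measurable_sphereMap T.symm⟩ : sphere (0 : E) 1 ≃ᵐ sphere (0 : E) 1)) (fun θ => F θ)

theorem abs_inner_sphere_le {E : Type*} [NormedAddCommGroup E] [InnerProductSpace ℝ E]
    {e : E} (he : ‖e‖ = 1) (θ : sphere (0 : E) 1) :
    |inner ℝ e (θ : E)| ≤ 1 := by
  simpa [he] using abs_real_inner_le_norm e (θ : E)

/-- The infinitesimal form of the invariance of the surface measure under rotations in the plane of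
`e` and `f`; the rotations are written as products of two reflections. -/
theorem integral_inner_mul_sin {e f : E} (he : ‖e‖ = 1) (hf : ‖f‖ = 1) (hef : inner ℝ e f = 0)
    (r : ℝ) :
    ∫ θ : sphere (0 : E) 1, inner ℝ e (θ : E) * Real.sin (r * inner ℝ e (θ : E))
        ∂(volume : Measure E).toSphere =
      r * ∫ θ : sphere (0 : E) 1, inner ℝ f (θ : E) ^ 2 * Real.cos (r * inner ℝ e (θ : E))
        ∂(volume : Measure E).toSphere := by
  set σ := (volume : Measure E).toSphere
  have hee : inner ℝ e e = (1 : ℝ) := by rw [real_inner_self_eq_norm_sq, he, one_pow]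
  have hff : inner ℝ f f = (1 : ℝ) := by rw [real_inner_self_eq_norm_sq, hf, one_pow]
  have hfe : inner ℝ f e = (0 : ℝ) := by rw [real_inner_comm, hef]
  set X : ℝ → E → ℝ := fun τ y => -(Real.cos τ * inner ℝ e y + Real.sin τ * inner ℝ f y) with hX
  set Y : ℝ → E → ℝ := fun τ y => Real.cos τ * inner ℝ f y - Real.sin τ * inner ℝ e y with hY
  set J : ℝ → sphere (0 : E) 1 → ℝ := fun τ θ => Y τ θ * Real.sin (r * X τ θ) with hJ
  have hconst : ∀ τ, ∫ θ, J τ θ ∂σ = ∫ θ : sphere (0 : E) 1,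
      inner ℝ f (θ : E) * Real.sin (r * inner ℝ e (θ : E)) ∂σ := by
    intro τ
    set v : E := Real.cos (τ / 2) • e + Real.sin (τ / 2) • f with hv
    have hvv : inner ℝ v v = (1 : ℝ) := by
      simp only [hv, inner_add_left, inner_add_right, inner_smul_left, inner_smul_right, hee, hff,
        hef, hfe]
      simp only [conj_trivial, mul_one, mul_zero, add_zero, zero_add]
      nlinarith [Real.sin_sq_add_cos_sq (τ / 2)]
    have hvn : ‖v‖ ^ 2 = 1 := by rw [← real_inner_self_eq_norm_sq, hvv]
    have hrefl : ∀ y : E, (ℝ ∙ v)ᗮ.reflection y = y - (2 * inner ℝ v y) • v := by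
      intro y
      rw [Submodule.reflection_orthogonal_apply, Submodule.reflection_apply,
        Submodule.starProjection_singleton, hvn]
      simp only [RCLike.ofReal_real_eq_id, id, div_one]
      rw [mul_smul, neg_sub, ← Nat.cast_smul_eq_nsmul ℝ]
      simp
    have hcos : Real.cos τ = 2 * Real.cos (τ / 2) ^ 2 - 1 := by
      rw [← Real.cos_two_mul]; ring_nf
    have hsin : Real.sin τ = 2 * Real.sin (τ / 2) * Real.cos (τ / 2) := by
      rw [← Real.sin_two_mul]; ring_nf
    have hs2 : Real.sin (τ / 2) ^ 2 = 1 - Real.cos (τ / 2) ^ 2 := Real.sin_sq _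
    rw [← integral_sphereMap ((ℝ ∙ v)ᗮ.reflection)
      (fun y => inner ℝ f y * Real.sin (r * inner ℝ e y))]
    refine integral_congr_ae (Eventually.of_forall fun θ => ?_)
    have h1 : inner ℝ f ((ℝ ∙ v)ᗮ.reflection (θ : E)) = Y τ θ := by
      rw [hrefl, inner_sub_right, inner_smul_right]
      simp only [hv, inner_add_left, inner_add_right, inner_smul_left, inner_smul_right, hff, hfe,
        conj_trivial, hY, hcos, hsin]
      linear_combination (-2 * inner ℝ f (θ : E)) * hs2
    have h2 : inner ℝ e ((ℝ ∙ v)ᗮ.reflection (θ : E)) = X τ θ := by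
      rw [hrefl, inner_sub_right, inner_smul_right]
      simp only [hv, inner_add_left, inner_add_right, inner_smul_left, inner_smul_right, hee, hef,
        conj_trivial, hX, hcos, hsin]
      ring
    simp only [hJ, h1, h2]
  set J' : ℝ → sphere (0 : E) 1 → ℝ := fun τ θ => X τ θ * Real.sin (r * X τ θ) +
    Y τ θ * (Real.cos (r * X τ θ) * (r * -Y τ θ)) with hJ'
  have hXd : ∀ τ y, HasDerivAt (fun τ => X τ y) (-Y τ y) τ := by
    intro τ y
    refine ((((Real.hasDerivAt_cos τ).mul_const (inner ℝ e y)).add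
      ((Real.hasDerivAt_sin τ).mul_const (inner ℝ f y))).neg).congr_deriv ?_
    simp only [hY]; ring
  have hYd : ∀ τ y, HasDerivAt (fun τ => Y τ y) (X τ y) τ := by
    intro τ y
    refine (((Real.hasDerivAt_cos τ).mul_const (inner ℝ f y)).sub
      ((Real.hasDerivAt_sin τ).mul_const (inner ℝ e y))).congr_deriv ?_
    simp only [hX]; ring
  have hXb : ∀ τ (θ : sphere (0 : E) 1), |X τ θ| ≤ 2 := by
    intro τ θ
    have h1 := abs_inner_sphere_le he θ
    have h2 := abs_inner_sphere_le hf θ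
    simp only [hX, abs_neg]
    refine (abs_add_le _ _).trans ?_
    rw [abs_mul, abs_mul]
    nlinarith [Real.abs_cos_le_one τ, Real.abs_sin_le_one τ, abs_nonneg (Real.cos τ),
      abs_nonneg (Real.sin τ), abs_nonneg (inner ℝ e (θ : E)), abs_nonneg (inner ℝ f (θ : E))]
  have hYb : ∀ τ (θ : sphere (0 : E) 1), |Y τ θ| ≤ 2 := by
    intro τ θ
    have h1 := abs_inner_sphere_le he θ
    have h2 := abs_inner_sphere_le hf θ
    simp only [hY]
    refine (abs_sub _ _).trans ?_
    rw [abs_mul, abs_mul]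
    nlinarith [Real.abs_cos_le_one τ, Real.abs_sin_le_one τ, abs_nonneg (Real.cos τ),
      abs_nonneg (Real.sin τ), abs_nonneg (inner ℝ e (θ : E)), abs_nonneg (inner ℝ f (θ : E))]
  have hder : HasDerivAt (fun τ => ∫ θ, J τ θ ∂σ) (∫ θ, J' 0 θ ∂σ) 0 := by
    refine hasDerivAt_integral_of_bounded σ (B := 2 + 2 * (|r| * 2)) (fun τ => ?_) (fun τ => ?_)
      (fun τ θ => ?_) (fun τ θ => ?_) 0
    · simp only [hJ, hX, hY]; fun_prop
    · simp only [hJ', hX, hY]; fun_prop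
    · simp only [hJ']
      refine (abs_add_le _ _).trans ?_
      simp only [abs_mul, abs_neg]
      have h1 := hXb τ θ
      have h2 := hYb τ θ
      have h3 := Real.abs_sin_le_one (r * X τ θ)
      have h4 := Real.abs_cos_le_one (r * X τ θ)
      have h5 : |X τ θ| * |Real.sin (r * X τ θ)| ≤ 2 * 1 :=
        mul_le_mul h1 h3 (abs_nonneg _) (by norm_num)
      have h6 : |Real.cos (r * X τ θ)| * (|r| * |Y τ θ|) ≤ 1 * (|r| * 2) := by gcongr
      have h7 : |Y τ θ| * (|Real.cos (r * X τ θ)| * (|r| * |Y τ θ|)) ≤ 2 * (1 * (|r| * 2)) :=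
        mul_le_mul h2 h6 (by positivity) (by norm_num)
      linarith
    · exact (hYd τ θ).mul (((hXd τ θ).const_mul r).sin)
  have hzero : ∫ θ, J' 0 θ ∂σ = 0 := by
    have : (fun τ => ∫ θ, J τ θ ∂σ) = fun _ => ∫ θ : sphere (0 : E) 1,
      inner ℝ f (θ : E) * Real.sin (r * inner ℝ e (θ : E)) ∂σ := funext hconst
    rw [this] at hder
    exact hder.unique (hasDerivAt_const _ _)
  have hJ0 : ∀ θ : sphere (0 : E) 1, J' 0 θ = inner ℝ e (θ : E) * Real.sin (r * inner ℝ e (θ : E))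
      - r * (inner ℝ f (θ : E) ^ 2 * Real.cos (r * inner ℝ e (θ : E))) := by
    intro θ
    simp only [hJ', hX, hY, Real.cos_zero, Real.sin_zero, one_mul, zero_mul, add_zero, sub_zero,
      mul_neg, Real.sin_neg, Real.cos_neg]
    ring
  simp only [hJ0] at hzero
  rw [integral_sub, integral_const_mul] at hzero
  · linarith
  · exact Continuous.integrable_of_hasCompactSupport (by fun_prop)
      (HasCompactSupport.of_compactSpace _)
  · exact Continuous.integrable_of_hasCompactSupport (by fun_prop)
      (HasCompactSupport.of_compactSpace _)

/-- Bessel's equation for the Fourier transform of the surface measure, in integrated form. -/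
theorem integral_inner_mul_sin_eq {e : E} (he : ‖e‖ = 1) (r : ℝ) :
    ((Module.finrank ℝ E - 1 : ℕ) : ℝ) *
        ∫ θ : sphere (0 : E) 1, inner ℝ e (θ : E) * Real.sin (r * inner ℝ e (θ : E))
          ∂(volume : Measure E).toSphere =
      r * ∫ θ : sphere (0 : E) 1, (1 - inner ℝ e (θ : E) ^ 2) * Real.cos (r * inner ℝ e (θ : E))
        ∂(volume : Measure E).toSphere := by
  have hE : Nontrivial E := ⟨e, 0, by rintro rfl; simp at he⟩
  set d := Module.finrank ℝ E with hd
  have hd1 : 0 < d := Module.finrank_pos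
  have : NeZero d := ⟨hd1.ne'⟩
  obtain ⟨b, hb⟩ := Orthonormal.exists_orthonormalBasis_extension_of_card_eq (𝕜 := ℝ) (E := E)
    (ι := Fin d) (v := fun _ => e) (s := {0}) (by simp [hd])
    ⟨fun i => he, fun i j hij => absurd (Subsingleton.elim i j) hij⟩
  have hb0 : b 0 = e := hb 0 rfl
  have hsum : ∀ θ : sphere (0 : E) 1, (1 - inner ℝ e (θ : E) ^ 2) =
      ∑ i ∈ Finset.univ.erase (0 : Fin d), inner ℝ (b i) (θ : E) ^ 2 := by
    intro θ
    have h1 := b.sum_sq_inner_right (θ : E)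
    rw [← Finset.add_sum_erase _ _ (Finset.mem_univ (0 : Fin d))] at h1
    have h2 : ‖(θ : E)‖ = 1 := by simp
    simp only [hb0, h2] at h1
    linarith
  have hterm : ∀ i ∈ Finset.univ.erase (0 : Fin d),
      r * ∫ θ : sphere (0 : E) 1, inner ℝ (b i) (θ : E) ^ 2 * Real.cos (r * inner ℝ e (θ : E))
        ∂(volume : Measure E).toSphere =
      ∫ θ : sphere (0 : E) 1, inner ℝ e (θ : E) * Real.sin (r * inner ℝ e (θ : E))
          ∂(volume : Measure E).toSphere := by
    intro i hi
    refine (integral_inner_mul_sin he (b.orthonormal.1 i) ?_ r).symm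
    rw [← hb0]
    exact b.orthonormal.2 (Finset.ne_of_mem_erase hi).symm
  simp only [hsum, Finset.sum_mul]
  rw [integral_finsetSum, Finset.mul_sum, Finset.sum_congr rfl hterm, Finset.sum_const,
    Finset.card_erase_of_mem (Finset.mem_univ _), Finset.card_univ, Fintype.card_fin, nsmul_eq_mul]
  intro i _
  exact Continuous.integrable_of_hasCompactSupport (by fun_prop)
    (HasCompactSupport.of_compactSpace _)

theorem sphereKernel_eq_integral_cos (x : E) :
    sphereKernel x = ((∫ θ : sphere (0 : E) 1, Real.cos (2 * Real.pi * inner ℝ x (θ : E))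
      ∂(volume : Measure E).toSphere : ℝ) : ℂ) := by
  have hodd : ∫ θ : sphere (0 : E) 1, Real.sin (2 * Real.pi * inner ℝ x (θ : E))
      ∂(volume : Measure E).toSphere = 0 := by
    have h := integral_sphereMap (LinearIsometryEquiv.neg ℝ)
      (fun y : E => Real.sin (2 * Real.pi * inner ℝ x y))
    simp only [LinearIsometryEquiv.coe_neg, inner_neg_right, mul_neg, Real.sin_neg,
      integral_neg] at h
    linarith
  have hc : Integrable (fun θ : sphere (0 : E) 1 =>
      ((Real.cos (2 * Real.pi * inner ℝ x (θ : E)) : ℝ) : ℂ)) (volume : Measure E).toSphere :=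
    Continuous.integrable_of_hasCompactSupport (by fun_prop) (HasCompactSupport.of_compactSpace _)
  have hs : Integrable (fun θ : sphere (0 : E) 1 =>
      ((Real.sin (2 * Real.pi * inner ℝ x (θ : E)) : ℝ) : ℂ) * Complex.I)
      (volume : Measure E).toSphere :=
    Continuous.integrable_of_hasCompactSupport (by fun_prop) (HasCompactSupport.of_compactSpace _)
  have : ∀ θ : sphere (0 : E) 1, (𝐞 (inner ℝ x (θ : E)) : ℂ) =
      ((Real.cos (2 * Real.pi * inner ℝ x (θ : E)) : ℝ) : ℂ) +
        ((Real.sin (2 * Real.pi * inner ℝ x (θ : E)) : ℝ) : ℂ) * Complex.I := by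
    intro θ
    rw [Real.fourierChar_apply, Complex.exp_mul_I, ← Complex.ofReal_cos, ← Complex.ofReal_sin]
  rw [sphereKernel]
  simp only [this]
  rw [integral_add hc hs, integral_mul_const, integral_complex_ofReal, integral_complex_ofReal, hodd]
  simp

theorem norm_sphereKernel_le (x : E) :
    ‖sphereKernel x‖ ≤ (volume : Measure E).toSphere.real univ := by
  have := norm_integral_le_of_norm_le_const (μ := (volume : Measure E).toSphere) (C := 1)
    (f := fun θ : sphere (0 : E) 1 => (𝐞 (inner ℝ x (θ : E)) : ℂ))
    (Eventually.of_forall fun θ => (Circle.norm_coe _).le)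
  rwa [one_mul] at this

/-- The stationary phase bound for the Fourier transform of the surface measure. -/
theorem exists_norm_sphereKernel_le (E : Type*) [NormedAddCommGroup E] [InnerProductSpace ℝ E]
    [FiniteDimensional ℝ E] [MeasurableSpace E] [BorelSpace E] :
    ∃ C : ℝ, 0 ≤ C ∧ ∀ x : E, 1 ≤ ‖x‖ →
      ‖sphereKernel x‖ ≤ C * ‖x‖ ^ (-(((Module.finrank ℝ E - 1 : ℕ) : ℝ) / 2)) := by
  set m := Module.finrank ℝ E - 1 with hm
  set σ := (volume : Measure E).toSphere
  set A := σ.real univ with hA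
  have hA0 : 0 ≤ A := measureReal_nonneg
  set B := A ^ 2 * (1 + (1 + m) ^ 2) * Real.exp ((m + 1) ^ 2) with hB
  have hB0 : 0 ≤ B := by positivity
  refine ⟨Real.sqrt B, Real.sqrt_nonneg _, fun x hx => ?_⟩
  have hx0 : 0 < ‖x‖ := one_pos.trans_le hx
  set e : E := ‖x‖⁻¹ • x with he
  have hen : ‖e‖ = 1 := by rw [he, norm_smul, norm_inv, norm_norm, inv_mul_cancel₀ hx0.ne']
  set q : ℝ → ℝ := fun r => ∫ θ : sphere (0 : E) 1, Real.cos (r * inner ℝ e (θ : E)) ∂σ with hq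
  set q' : ℝ → ℝ := fun r =>
    ∫ θ : sphere (0 : E) 1, -Real.sin (r * inner ℝ e (θ : E)) * inner ℝ e (θ : E) ∂σ with hq'
  have hlin : ∀ (θ : sphere (0 : E) 1) (r : ℝ),
      HasDerivAt (fun r => r * inner ℝ e (θ : E)) (inner ℝ e (θ : E)) r := fun θ r => by
    simpa using (hasDerivAt_id r).mul_const (inner ℝ e (θ : E))
  have hqd : ∀ r, HasDerivAt q (q' r) r := by
    refine hasDerivAt_integral_of_bounded σ (B := 1) (fun r => by fun_prop) (fun r => by fun_prop)
      (fun r θ => ?_) (fun r θ => (hlin θ r).cos)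
    rw [abs_mul, abs_neg]
    exact mul_le_one₀ (Real.abs_sin_le_one _) (abs_nonneg _) (abs_inner_sphere_le hen θ)
  have hqd' : ∀ r, 0 < r → HasDerivAt q' (-(m / r * q' r) - q r) r := by
    intro r hr
    have h1 : HasDerivAt q' (∫ θ : sphere (0 : E) 1,
        -(Real.cos (r * inner ℝ e (θ : E)) * inner ℝ e (θ : E)) * inner ℝ e (θ : E) ∂σ) r := by
      refine hasDerivAt_integral_of_bounded σ (B := 1) (fun r => by fun_prop)
        (fun r => by fun_prop) (fun r θ => ?_) (fun r θ => ((hlin θ r).sin.neg).mul_const _) r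
      rw [abs_mul, abs_neg, abs_mul]
      have h1 := abs_inner_sphere_le hen θ
      exact mul_le_one₀ (mul_le_one₀ (Real.abs_cos_le_one _) (abs_nonneg _) h1) (abs_nonneg _) h1
    refine h1.congr_deriv ?_
    have h2 := integral_inner_mul_sin_eq hen r
    have h3 : q' r = -∫ θ : sphere (0 : E) 1,
        inner ℝ e (θ : E) * Real.sin (r * inner ℝ e (θ : E)) ∂σ := by
      rw [← integral_neg]
      exact integral_congr_ae (Eventually.of_forall fun θ => by ring)
    have h4 : ∫ θ : sphere (0 : E) 1,
        -(Real.cos (r * inner ℝ e (θ : E)) * inner ℝ e (θ : E)) * inner ℝ e (θ : E) ∂σ =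
        (∫ θ : sphere (0 : E) 1,
          (1 - inner ℝ e (θ : E) ^ 2) * Real.cos (r * inner ℝ e (θ : E)) ∂σ) - q r := by
      rw [← integral_sub]
      · exact integral_congr_ae (Eventually.of_forall fun θ => by ring)
      · exact Continuous.integrable_of_hasCompactSupport (by fun_prop)
          (HasCompactSupport.of_compactSpace _)
      · exact Continuous.integrable_of_hasCompactSupport (by fun_prop)
          (HasCompactSupport.of_compactSpace _)
    rw [h4, h3]
    have h5 : ∫ θ : sphere (0 : E) 1,
          (1 - inner ℝ e (θ : E) ^ 2) * Real.cos (r * inner ℝ e (θ : E)) ∂σ =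
        m / r * ∫ θ : sphere (0 : E) 1,
          inner ℝ e (θ : E) * Real.sin (r * inner ℝ e (θ : E)) ∂σ := by
      rw [div_mul_eq_mul_div, eq_div_iff hr.ne', mul_comm]
      exact h2.symm
    rw [h5]; ring
  have hint1 : ∀ F : sphere (0 : E) 1 → ℝ, (∀ θ, |F θ| ≤ 1) → |∫ θ, F θ ∂σ| ≤ A := by
    intro F hF
    have := norm_integral_le_of_norm_le_const (μ := σ) (f := F) (C := 1) (Eventually.of_forall hF)
    rwa [one_mul] at this
  have hdec := bessel_decay hqd hqd' (hint1 _ fun θ => Real.abs_cos_le_one _)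
    (hint1 _ fun θ => by
      rw [abs_mul, abs_neg]
      exact mul_le_one₀ (Real.abs_sin_le_one _) (abs_nonneg _) (abs_inner_sphere_le hen θ))
    (r := 2 * Real.pi * ‖x‖) (by nlinarith [Real.pi_gt_three])
  have hK : sphereKernel x = (q (2 * Real.pi * ‖x‖) : ℂ) := by
    rw [sphereKernel_eq_integral_cos]
    congr 1
    refine integral_congr_ae (Eventually.of_forall fun θ => ?_)
    simp only [he, inner_smul_left, conj_trivial]
    congr 1
    field_simp
  rw [hK, Complex.norm_real, Real.norm_eq_abs]
  refine abs_le_of_sq_le_sq ?_ (by positivity)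
  rw [mul_pow, Real.sq_sqrt hB0, ← Real.rpow_natCast (_ ^ (_ : ℝ)), ← Real.rpow_mul hx0.le]
  have e1 : -((m : ℝ) / 2) * ((2 : ℕ) : ℝ) = -(m : ℝ) := by push_cast; ring
  rw [e1, Real.rpow_neg hx0.le, Real.rpow_natCast, ← div_eq_mul_inv, le_div_iff₀ (by positivity)]
  refine le_trans ?_ hdec
  gcongr
  nlinarith [Real.pi_gt_three]

end SurfaceMeasure

section QuadraticForms

variable {E : Type*} [NormedAddCommGroup E] [InnerProductSpace ℝ E] [FiniteDimensional ℝ E]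
  [MeasurableSpace E] [BorelSpace E]

/-! ### Quadratic forms of convolution kernels and the `TT*` argument -/

/-- The quadratic form `∬ H(x) conj (H(y)) k(x - y) dν(x) dν(y)` is bounded by `N` times the square
of the norm of `H` in `L²(ν)`; it suffices to test bounded functions `H`. -/
def QuadBound (ν : Measure E) (k : E → ℂ) (N : ℝ≥0∞) : Prop :=
  ∀ H : E → ℂ, Measurable H → (∃ B, ∀ x, ‖H x‖ ≤ B) →
    ‖∫ z, H z.1 * conj (H z.2) * k (z.1 - z.2) ∂(ν.prod ν)‖ₑ ≤ N * ∫⁻ x, ‖H x‖ₑ ^ 2 ∂ν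

/-- The Fourier extension operator of the unit sphere. -/
def sphereExt (g : sphere (0 : E) 1 → ℂ) (x : E) : ℂ :=
  ∫ θ : sphere (0 : E) 1, g θ * (𝐞 (inner ℝ x (θ : E)) : ℂ) ∂(volume : Measure E).toSphere

/-- The (inverse) Fourier transform of the measure with density `H` with respect to `ν`. -/
def measTransform (ν : Measure E) (H : E → ℂ) (ζ : E) : ℂ :=
  ∫ x, H x * (𝐞 (inner ℝ x ζ) : ℂ) ∂ν

theorem integrable_of_bounded {X : Type*} [MeasurableSpace X] {μ : Measure X} [IsFiniteMeasure μ]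
    {F : X → ℂ} (hF : Measurable F) {B : ℝ} (hB : ∀ x, ‖F x‖ ≤ B) : Integrable F μ :=
  Integrable.of_bound hF.aestronglyMeasurable B (Eventually.of_forall hB)

theorem lintegral_enorm_sq_eq {X : Type*} [MeasurableSpace X] {μ : Measure X} {F : X → ℂ}
    (hF : Integrable (fun x => F x * conj (F x)) μ) :
    ∫⁻ x, ‖F x‖ₑ ^ 2 ∂μ = ‖∫ x, F x * conj (F x) ∂μ‖ₑ := by
  have h1 : ∀ x, F x * conj (F x) = ((‖F x‖ ^ 2 : ℝ) : ℂ) := fun x => by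
    rw [Complex.mul_conj, Complex.normSq_eq_norm_sq]
  simp only [h1] at hF ⊢
  have hF' : Integrable (fun x => ‖F x‖ ^ 2) μ := by
    exact hF.re.congr (Eventually.of_forall fun x => Complex.ofReal_re _)
  rw [integral_complex_ofReal]
  have h2 : ‖((∫ x, ‖F x‖ ^ 2 ∂μ : ℝ) : ℂ)‖ₑ = ENNReal.ofReal (∫ x, ‖F x‖ ^ 2 ∂μ) := by
    rw [← ofReal_norm, Complex.norm_real, Real.norm_of_nonneg (integral_nonneg fun x => by positivity)]
  rw [h2, ofReal_integral_eq_lintegral_ofReal hF' (Eventually.of_forall fun x => by positivity)]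
  refine lintegral_congr fun x => ?_
  rw [ENNReal.ofReal_pow (norm_nonneg _), ofReal_norm]

theorem continuous_fourierChar_coe : Continuous fun t : ℝ => (𝐞 t : ℂ) :=
  continuous_subtype_val.comp Real.continuous_fourierChar

theorem measurable_fourierChar_comp {X : Type*} [MeasurableSpace X] {f : X → ℝ}
    (hf : Measurable f) : Measurable fun x => (𝐞 (f x) : ℂ) :=
  continuous_fourierChar_coe.measurable.comp hf

theorem fourierChar_neg_coe (t : ℝ) : (𝐞 (-t) : ℂ) = conj (𝐞 t : ℂ) := by
  rw [AddChar.map_neg_eq_inv, Circle.coe_inv_eq_conj]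

theorem fourierChar_add_coe (s t : ℝ) : (𝐞 (s + t) : ℂ) = (𝐞 s : ℂ) * (𝐞 t : ℂ) := by
  rw [AddChar.map_add_eq_mul, Circle.coe_mul]

/-- The quadratic form of a kernel that is a superposition of characters. -/
theorem integral_quad_eq {P : Type*} [MeasurableSpace P] {τ : Measure P} [SFinite τ] {a : P → ℂ}
    (ha : Integrable a τ) {Φ : P → E} (hΦ : Measurable Φ) {ν : Measure E} [IsFiniteMeasure ν]
    {H : E → ℂ} (hH : Measurable H) {B : ℝ} (hB : ∀ x, ‖H x‖ ≤ B) :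
    ∫ z, H z.1 * conj (H z.2) * (∫ p, a p * (𝐞 (inner ℝ (z.1 - z.2) (Φ p)) : ℂ) ∂τ) ∂(ν.prod ν) =
      ∫ p, a p * (measTransform ν H (Φ p) * conj (measTransform ν H (Φ p))) ∂τ := by
  have hconj : Measurable fun z : ℂ => conj z := Complex.continuous_conj.measurable
  have hHH : Integrable (fun z : E × E => H z.1 * conj (H z.2)) (ν.prod ν) := by
    refine integrable_of_bounded (B := B * B) ?_ fun z => ?_
    · exact (hH.comp measurable_fst).mul (hconj.comp (hH.comp measurable_snd))
    · rw [norm_mul, RCLike.norm_conj]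
      have := (norm_nonneg _).trans (hB z.1)
      exact mul_le_mul (hB _) (hB _) (norm_nonneg _) this
  have hint : Integrable (fun q : (E × E) × P => H q.1.1 * conj (H q.1.2) *
      (a q.2 * (𝐞 (inner ℝ (q.1.1 - q.1.2) (Φ q.2)) : ℂ))) ((ν.prod ν).prod τ) := by
    have h1 := (hHH.mul_prod ha).mul_bdd (c := 1)
      (g := fun q : (E × E) × P => (𝐞 (inner ℝ (q.1.1 - q.1.2) (Φ q.2)) : ℂ))
      (measurable_fourierChar_comp (by fun_prop)).aestronglyMeasurable
      (Eventually.of_forall fun q => (Circle.norm_coe _).le)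
    refine h1.congr (Eventually.of_forall fun q => ?_)
    simp only [mul_assoc]
  have hswap := integral_integral_swap (f := fun (z : E × E) p => H z.1 * conj (H z.2) *
      (a p * (𝐞 (inner ℝ (z.1 - z.2) (Φ p)) : ℂ))) hint
  simp only [integral_const_mul] at hswap
  rw [hswap]
  refine integral_congr_ae (Eventually.of_forall fun p => ?_)
  have h2 : ∀ z : E × E, H z.1 * conj (H z.2) * (a p * (𝐞 (inner ℝ (z.1 - z.2) (Φ p)) : ℂ)) =
      a p * ((H z.1 * (𝐞 (inner ℝ z.1 (Φ p)) : ℂ)) * conj (H z.2 * (𝐞 (inner ℝ z.2 (Φ p)) : ℂ))) := by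
    intro z
    rw [inner_sub_left, sub_eq_add_neg, fourierChar_add_coe, fourierChar_neg_coe, map_mul]
    ring
  simp only [h2]
  rw [integral_const_mul, integral_prod_mul (fun x => H x * (𝐞 (inner ℝ x (Φ p)) : ℂ))
    (fun y => conj (H y * (𝐞 (inner ℝ y (Φ p)) : ℂ))), integral_conj]
  rfl

theorem norm_sphereExt_le {g : sphere (0 : E) 1 → ℂ} {B : ℝ} (hB : ∀ θ, ‖g θ‖ ≤ B) (x : E) :
    ‖sphereExt g x‖ ≤ B * (volume : Measure E).toSphere.real univ :=
  norm_integral_le_of_norm_le_const (Eventually.of_forall fun θ => by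
    rw [norm_mul, Circle.norm_coe, mul_one]; exact hB θ)

theorem norm_measTransform_le {ν : Measure E} [IsFiniteMeasure ν] {H : E → ℂ} {B : ℝ}
    (hB : ∀ x, ‖H x‖ ≤ B) (ζ : E) :
    ‖measTransform ν H ζ‖ ≤ B * ν.real univ :=
  norm_integral_le_of_norm_le_const (Eventually.of_forall fun θ => by
    rw [norm_mul, Circle.norm_coe, mul_one]; exact hB θ)

theorem measurable_measTransform {ν : Measure E} [SFinite ν] {H : E → ℂ} (hH : Measurable H) :
    Measurable (measTransform ν H) := by
  have : StronglyMeasurable fun q : E × E => H q.2 * (𝐞 (inner ℝ q.2 q.1) : ℂ) :=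
    ((hH.comp measurable_snd).mul (measurable_fourierChar_comp (by fun_prop))).stronglyMeasurable
  exact (this.integral_prod_right (ν := ν)).measurable

theorem measurable_sphereExt_uncurry {X : Type*} [MeasurableSpace X]
    {g : X → sphere (0 : E) 1 → ℂ} (hg : Measurable (Function.uncurry g)) :
    Measurable fun q : X × E => sphereExt (g q.1) q.2 := by
  have : StronglyMeasurable fun q : (X × E) × sphere (0 : E) 1 =>
      g q.1.1 q.2 * (𝐞 (inner ℝ q.1.2 (q.2 : E)) : ℂ) := by
    refine Measurable.stronglyMeasurable (Measurable.mul ?_ (measurable_fourierChar_comp ?_))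
    · exact hg.comp (by fun_prop : Measurable fun q : (X × E) × sphere (0 : E) 1 => (q.1.1, q.2))
    · fun_prop
  exact (this.integral_prod_right (ν := (volume : Measure E).toSphere)).measurable

theorem measurable_sphereExt {g : sphere (0 : E) 1 → ℂ} (hg : Measurable g) :
    Measurable (sphereExt g) := by
  have : StronglyMeasurable fun q : E × sphere (0 : E) 1 =>
      g q.2 * (𝐞 (inner ℝ q.1 (q.2 : E)) : ℂ) :=
    ((hg.comp measurable_snd).mul (measurable_fourierChar_comp (by fun_prop))).stronglyMeasurable
  exact (this.integral_prod_right (ν := (volume : Measure E).toSphere)).measurable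

/-- The `TT*` argument: a bound for the quadratic form of the Fourier transform of the surface
measure is a bound for the extension operator. -/
theorem lintegral_sphereExt_sq_le {ν : Measure E} [IsFiniteMeasure ν] {N : ℝ≥0∞}
    (hN : QuadBound ν sphereKernel N) {g : sphere (0 : E) 1 → ℂ} (hg : Measurable g) {B : ℝ}
    (hB : ∀ θ, ‖g θ‖ ≤ B) :
    ∫⁻ x, ‖sphereExt g x‖ₑ ^ 2 ∂ν ≤ N * ∫⁻ θ, ‖g θ‖ₑ ^ 2 ∂(volume : Measure E).toSphere := by
  set σ := (volume : Measure E).toSphere with hσ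
  have hconj : Measurable fun z : ℂ => conj z := Complex.continuous_conj.measurable
  set H : E → ℂ := fun x => conj (sphereExt g x) with hH
  have hHm : Measurable H := hconj.comp (measurable_sphereExt hg)
  have hHb : ∀ x, ‖H x‖ ≤ B * σ.real univ := fun x => by
    rw [hH, RCLike.norm_conj]; exact norm_sphereExt_le hB x
  set Pf : sphere (0 : E) 1 → ℂ := fun θ => measTransform ν H θ with hPf
  have hPm : Measurable Pf := (measurable_measTransform hHm).comp measurable_subtype_coe
  have hPb : ∀ θ, ‖Pf θ‖ ≤ B * σ.real univ * ν.real univ := fun θ => norm_measTransform_le hHb _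
  have hsq : ∀ {X : Type _} [MeasurableSpace X] (μ : Measure X) [IsFiniteMeasure μ] {F : X → ℂ}
      (_ : Measurable F) {b : ℝ} (_ : ∀ x, ‖F x‖ ≤ b),
      ∫⁻ x, ‖F x‖ₑ ^ 2 ∂μ = ‖∫ x, F x * conj (F x) ∂μ‖ₑ := by
    intro X _ μ _ F hF b hb
    refine lintegral_enorm_sq_eq (integrable_of_bounded (B := b * b) (hF.mul (hconj.comp hF))
      fun x => ?_)
    rw [norm_mul, RCLike.norm_conj]
    exact mul_le_mul (hb x) (hb x) (norm_nonneg _) ((norm_nonneg _).trans (hb x))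
  set I := ∫⁻ x, ‖sphereExt g x‖ₑ ^ 2 ∂ν with hI
  set G := ∫⁻ θ, ‖g θ‖ₑ ^ 2 ∂σ with hG
  have hIH : I = ∫⁻ x, ‖H x‖ₑ ^ 2 ∂ν := lintegral_congr fun x => by
    rw [hH, ← ofReal_norm, ← ofReal_norm, RCLike.norm_conj]
  have hIfin : I ≠ ⊤ := by
    rw [hI]
    refine ne_of_lt (lt_of_le_of_lt (lintegral_mono (g := fun _ =>
      ENNReal.ofReal (B * σ.real univ) ^ 2) fun x => ?_) ?_)
    · rw [← ofReal_norm]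
      exact pow_le_pow_left' (ENNReal.ofReal_le_ofReal (norm_sphereExt_le hB x)) 2
    · rw [lintegral_const]
      exact ENNReal.mul_lt_top (ENNReal.pow_lt_top ENNReal.ofReal_lt_top) (measure_lt_top _ _)
  -- the square of the norm of the adjoint is the quadratic form
  have hPsq : ∫⁻ θ, ‖Pf θ‖ₑ ^ 2 ∂σ ≤ N * I := by
    rw [hsq σ hPm hPb, hIH]
    have h1 := integral_quad_eq (τ := σ) (a := fun _ => 1) (integrable_const 1)
      (Φ := fun θ : sphere (0 : E) 1 => (θ : E)) measurable_subtype_coe (ν := ν) hHm hHb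
    simp only [one_mul] at h1
    rw [← h1]
    exact hN H hHm ⟨_, hHb⟩
  have hdual : I ≤ ∫⁻ θ, ‖g θ‖ₑ * ‖Pf θ‖ₑ ∂σ := by
    rw [hI, hsq ν (measurable_sphereExt hg) (norm_sphereExt_le hB)]
    have hint : Integrable (fun q : E × sphere (0 : E) 1 =>
        H q.1 * (g q.2 * (𝐞 (inner ℝ q.1 (q.2 : E)) : ℂ))) (ν.prod σ) := by
      refine integrable_of_bounded (B := B * σ.real univ * B) ?_ fun q => ?_
      · exact (hHm.comp measurable_fst).mul ((hg.comp measurable_snd).mul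
          (measurable_fourierChar_comp (by fun_prop)))
      · rw [norm_mul, norm_mul, Circle.norm_coe, mul_one]
        exact mul_le_mul (hHb _) (hB _) (norm_nonneg _) ((norm_nonneg _).trans (hHb q.1))
    have h1 : ∫ x, sphereExt g x * conj (sphereExt g x) ∂ν = ∫ θ, g θ * Pf θ ∂σ := by
      calc _ = ∫ x, ∫ θ : sphere (0 : E) 1,
            H x * (g θ * (𝐞 (inner ℝ x (θ : E)) : ℂ)) ∂σ ∂ν := by
            refine integral_congr_ae (Eventually.of_forall fun x => ?_)
            simp only [integral_const_mul, hH]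
            rw [mul_comm]; rfl
        _ = ∫ θ : sphere (0 : E) 1, ∫ x, H x * (g θ * (𝐞 (inner ℝ x (θ : E)) : ℂ)) ∂ν ∂σ :=
            integral_integral_swap hint
        _ = _ := by
            refine integral_congr_ae (Eventually.of_forall fun θ => ?_)
            simp only [hPf, measTransform, ← integral_const_mul]
            refine integral_congr_ae (Eventually.of_forall fun x => ?_)
            ring
    rw [h1]
    refine (enorm_integral_le_lintegral_enorm _).trans (le_of_eq ?_)
    simp only [enorm_mul]
  have hCS : I ^ 2 ≤ G * (N * I) := by
    have h2 := ENNReal.lintegral_mul_le_Lp_mul_Lq σ Real.HolderConjugate.two_two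
      (f := fun θ => ‖g θ‖ₑ) (g := fun θ => ‖Pf θ‖ₑ) hg.enorm.aemeasurable hPm.enorm.aemeasurable
    simp only [ENNReal.rpow_two] at h2
    have h3 : I ≤ G ^ (1 / 2 : ℝ) * (N * I) ^ (1 / 2 : ℝ) := by
      refine (hdual.trans h2).trans ?_
      gcongr
    calc I ^ 2 ≤ (G ^ (1 / 2 : ℝ) * (N * I) ^ (1 / 2 : ℝ)) ^ 2 := by gcongr
      _ = G * (N * I) := by
        rw [mul_pow, ← ENNReal.rpow_natCast, ← ENNReal.rpow_natCast, ← ENNReal.rpow_mul,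
          ← ENNReal.rpow_mul]
        norm_num
  rcases eq_or_ne I 0 with h0 | h0
  · rw [h0]; exact zero_le
  · have h4 : I * I ≤ (N * G) * I := by
      rw [← sq]; refine hCS.trans (le_of_eq (by ring))
    exact (ENNReal.mul_le_mul_iff_left h0 hIfin).1 h4

theorem QuadBound.add {ν : Measure E} [IsFiniteMeasure ν] {k₁ k₂ : E → ℂ} {N₁ N₂ : ℝ≥0∞}
    (h₁ : QuadBound ν k₁ N₁) (h₂ : QuadBound ν k₂ N₂) (hk₁ : Measurable k₁) (hk₂ : Measurable k₂)
    {B : ℝ} (hB₁ : ∀ x, ‖k₁ x‖ ≤ B) (hB₂ : ∀ x, ‖k₂ x‖ ≤ B) :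
    QuadBound ν (fun x => k₁ x + k₂ x) (N₁ + N₂) := by
  rintro H hH ⟨b, hb⟩
  have hconj : Measurable fun z : ℂ => conj z := Complex.continuous_conj.measurable
  have hint : ∀ k : E → ℂ, Measurable k → (∀ x, ‖k x‖ ≤ B) → Integrable
      (fun z : E × E => H z.1 * conj (H z.2) * k (z.1 - z.2)) (ν.prod ν) := by
    intro k hk hkB
    refine integrable_of_bounded (B := b * b * B) ?_ fun z => ?_
    · exact ((hH.comp measurable_fst).mul (hconj.comp (hH.comp measurable_snd))).mul
        (hk.comp (by fun_prop))
    · rw [norm_mul, norm_mul, RCLike.norm_conj]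
      have := (norm_nonneg _).trans (hb z.1)
      exact mul_le_mul (mul_le_mul (hb _) (hb _) (norm_nonneg _) this) (hkB _) (norm_nonneg _)
        (by positivity)
  simp only [mul_add]
  rw [integral_add (hint k₁ hk₁ hB₁) (hint k₂ hk₂ hB₂), add_mul]
  exact (enorm_add_le _ _).trans (add_le_add (h₁ H hH ⟨b, hb⟩) (h₂ H hH ⟨b, hb⟩))

/-- Schur's test. -/
theorem quadBound_of_schur {ν : Measure E} [IsFiniteMeasure ν] {k : E → ℂ} {κ : E → ℝ≥0∞}
    (hκ : Measurable κ) (hsymm : ∀ x, κ (-x) = κ x) (hk : ∀ x, ‖k x‖ₑ ≤ κ x) {N : ℝ≥0∞}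
    (hN : ∀ x, ∫⁻ y, κ (x - y) ∂ν ≤ N) : QuadBound ν k N := by
  rintro H hH -
  set Q := ‖∫ z, H z.1 * conj (H z.2) * k (z.1 - z.2) ∂(ν.prod ν)‖ₑ
  have hm1 : Measurable fun z : E × E => ‖H z.1‖ₑ ^ 2 * κ (z.1 - z.2) := by fun_prop
  have hm2 : Measurable fun z : E × E => ‖H z.2‖ₑ ^ 2 * κ (z.1 - z.2) := by fun_prop
  have h1 : 2 * Q ≤ ∫⁻ z, (‖H z.1‖ₑ ^ 2 * κ (z.1 - z.2) + ‖H z.2‖ₑ ^ 2 * κ (z.1 - z.2))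
      ∂(ν.prod ν) := by
    calc 2 * Q ≤ 2 * ∫⁻ z, ‖H z.1 * conj (H z.2) * k (z.1 - z.2)‖ₑ ∂(ν.prod ν) := by
          gcongr; exact enorm_integral_le_lintegral_enorm _
      _ ≤ ∫⁻ z, 2 * ‖H z.1 * conj (H z.2) * k (z.1 - z.2)‖ₑ ∂(ν.prod ν) :=
          lintegral_const_mul_le _ _
      _ ≤ _ := by
          refine lintegral_mono fun z => ?_
          have hab : 2 * ‖H z.1‖ₑ * ‖H z.2‖ₑ ≤ ‖H z.1‖ₑ ^ 2 + ‖H z.2‖ₑ ^ 2 := by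
            rw [enorm_eq_nnnorm, enorm_eq_nnnorm]
            exact_mod_cast two_mul_le_add_sq ‖H z.1‖₊ ‖H z.2‖₊
          have hc : ‖conj (H z.2)‖ₑ = ‖H z.2‖ₑ := by
            rw [← ofReal_norm, ← ofReal_norm, RCLike.norm_conj]
          rw [enorm_mul, enorm_mul, hc, ← add_mul, ← mul_assoc, ← mul_assoc]
          exact mul_le_mul' hab (hk _)
  rw [lintegral_add_left hm1, lintegral_prod _ hm1.aemeasurable,
    lintegral_prod_symm _ hm2.aemeasurable] at h1
  have h2 : ∫⁻ x, ∫⁻ y, ‖H x‖ₑ ^ 2 * κ (x - y) ∂ν ∂ν ≤ N * ∫⁻ x, ‖H x‖ₑ ^ 2 ∂ν := by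
    rw [← lintegral_const_mul _ (by fun_prop)]
    refine lintegral_mono fun x => ?_
    dsimp only
    rw [lintegral_const_mul _ (by fun_prop), mul_comm]
    gcongr
    exact hN x
  have h3 : ∫⁻ y, ∫⁻ x, ‖H y‖ₑ ^ 2 * κ (x - y) ∂ν ∂ν ≤ N * ∫⁻ x, ‖H x‖ₑ ^ 2 ∂ν := by
    have : ∀ x y, κ (x - y) = κ (y - x) := fun x y => by rw [← hsymm, neg_sub]
    refine le_trans (le_of_eq ?_) h2
    exact lintegral_congr fun y => lintegral_congr fun x => by rw [this]
  have h4 : 2 * Q ≤ 2 * (N * ∫⁻ x, ‖H x‖ₑ ^ 2 ∂ν) := by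
    rw [two_mul (N * _)]; exact h1.trans (add_le_add h2 h3)
  exact (ENNReal.mul_le_mul_iff_right (by norm_num) (by norm_num)).1 h4

end QuadraticForms

section KernelCutoff

variable {E : Type*} [NormedAddCommGroup E] [InnerProductSpace ℝ E] [FiniteDimensional ℝ E]
  [MeasurableSpace E] [BorelSpace E]

/-! ### The kernel near the origin -/

/-- The average over the sphere of an `L¹`-normalized bump at scale `1 / R` is `O(R)`, since a ball
of radius `ρ` carries surface measure `O(ρ ^ (dim E - 1))`. -/
theorem exists_lintegral_sphere_bump_le [Nontrivial E] (C₀ : ℝ) (hC₀ : 0 ≤ C₀) :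
    ∃ C : ℝ, 0 ≤ C ∧ ∀ ψ : E → ℂ, (∀ ξ, (1 + ‖ξ‖) ^ Module.finrank ℝ E * ‖ψ ξ‖ ≤ C₀) →
      ∀ (R : ℝ), 0 < R → ∀ ζ : E,
      ∫⁻ θ : sphere (0 : E) 1, ENNReal.ofReal (R ^ Module.finrank ℝ E) * ‖ψ (R • (ζ - (θ : E)))‖ₑ
        ∂(volume : Measure E).toSphere ≤ ENNReal.ofReal (C * R) := by
  obtain ⟨C₁, hC₁, hcap⟩ := exists_toSphere_ball_le (E := E)
  set d := Module.finrank ℝ E with hd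
  have hd1 : 1 ≤ d := Module.finrank_pos
  refine ⟨C₀ * 2 ^ d * C₁ * 2, by positivity, fun ψ hψ R hR ζ => ?_⟩
  set S : ℕ → Set (sphere (0 : E) 1) := fun m => {θ | dist ζ θ < 2 ^ m / R} with hS
  have hSm : ∀ m, MeasurableSet (S m) := fun m => by
    apply measurableSet_lt <;> fun_prop
  set c : ℕ → ℝ := fun m => R ^ d * (C₀ * 2 ^ d * ((1 / 2) ^ m) ^ d) with hc
  have hc0 : ∀ m, 0 ≤ c m := fun m => by positivity
  have hpt : ∀ θ : sphere (0 : E) 1, ENNReal.ofReal (R ^ d) * ‖ψ (R • (ζ - (θ : E)))‖ₑ ≤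
      ∑' m, (S m).indicator (fun _ => ENNReal.ofReal (c m)) θ := by
    intro θ
    set t := R * dist ζ θ with ht
    have ht0 : 0 ≤ t := by positivity
    have hn : ‖R • (ζ - (θ : E))‖ = t := by
      rw [norm_smul, Real.norm_of_nonneg hR.le, ht, dist_eq_norm]
    obtain ⟨m, hm1, hm2⟩ := exists_nat_pow_near (x := 1 + t) (y := 2) (by linarith) (by norm_num)
    have hmem : θ ∈ S (m + 1) := by
      change dist ζ θ < 2 ^ (m + 1) / R
      rw [lt_div_iff₀ hR]; linarith
    refine le_trans ?_ (ENNReal.le_tsum (m + 1))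
    rw [indicator_of_mem hmem, ← ofReal_norm, ← ENNReal.ofReal_mul (by positivity)]
    apply ENNReal.ofReal_le_ofReal
    simp only [hc]
    gcongr
    have h1 := hψ (R • (ζ - (θ : E)))
    rw [hn] at h1
    have h2 : ((2 : ℝ) ^ m) ^ d ≤ (1 + t) ^ d := by gcongr
    have h3 : (0 : ℝ) < (2 ^ m) ^ d := by positivity
    have h4 : ‖ψ (R • (ζ - (θ : E)))‖ ≤ C₀ / (2 ^ m) ^ d := by
      rw [le_div_iff₀ h3]
      refine le_trans ?_ h1
      rw [mul_comm]
      gcongr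
    refine h4.trans (le_of_eq ?_)
    rw [one_div, inv_pow, inv_pow, pow_succ, mul_pow]
    field_simp
  calc _ ≤ ∫⁻ θ, ∑' m, (S m).indicator (fun _ => ENNReal.ofReal (c m)) θ
        ∂(volume : Measure E).toSphere := lintegral_mono hpt
    _ = ∑' m, ENNReal.ofReal (c m) * (volume : Measure E).toSphere (S m) := by
        rw [lintegral_tsum fun m => (measurable_const.indicator (hSm m)).aemeasurable]
        simp only [lintegral_indicator_const (hSm _)]
    _ ≤ ∑' m : ℕ, ENNReal.ofReal (C₀ * 2 ^ d * C₁ * R * (1 / 2) ^ m) := by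
        refine ENNReal.tsum_le_tsum fun m => ?_
        refine (mul_le_mul_right (hcap ζ (2 ^ m / R) (by positivity)) _).trans ?_
        rw [← ENNReal.ofReal_mul (hc0 m)]
        apply ENNReal.ofReal_le_ofReal
        apply le_of_eq
        have hpow : ∀ x : ℝ, x ^ d = x ^ (d - 1) * x := fun x => by
          rw [← pow_succ, Nat.sub_add_cancel hd1]
        simp only [hc]
        rw [hpow R, hpow ((1 / 2) ^ m), div_pow, div_pow, one_pow, div_pow, one_pow]
        field_simp
    _ = _ := by
        rw [← ENNReal.ofReal_tsum_of_nonneg (fun m => by positivity)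
          (summable_geometric_two.mul_left _), tsum_mul_left, tsum_geometric_two]
        congr 1
        ring

theorem lintegral_measTransform_sq_le {W : E → ℝ≥0∞} (hW : Measurable W) {Λ : ℝ≥0}
    (hΛ : ∀ x, W x ≤ Λ) [IsFiniteMeasure (volume.withDensity W)] {H : E → ℂ} (hH : Measurable H)
    {B : ℝ} (hB : ∀ x, ‖H x‖ ≤ B) :
    ∫⁻ ζ, ‖measTransform (volume.withDensity W) H ζ‖ₑ ^ 2 ≤
      Λ * ∫⁻ x, ‖H x‖ₑ ^ 2 ∂(volume.withDensity W) := by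
  have hWt : ∀ x, W x < ⊤ := fun x => (hΛ x).trans_lt ENNReal.coe_lt_top
  set h : E → ℂ := fun x => (W x).toReal • H x with hh
  have hhm : Measurable h := by fun_prop
  have h1 : Integrable h :=
    (integrable_withDensity_iff_integrable_smul' hW (Eventually.of_forall hWt)).1
      (integrable_of_bounded hH hB)
  have h2 : MemLp h 2 := by
    rw [memLp_two_iff_integrable_sq_norm hhm.aestronglyMeasurable]
    have := h1.norm.mul_bdd (c := Λ * B) (g := fun x => ‖h x‖) hhm.norm.aestronglyMeasurable
      (Eventually.of_forall fun x => ?_)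
    · refine this.congr (Eventually.of_forall fun x => ?_)
      simp only [sq]
    · rw [norm_norm, hh, norm_smul, Real.norm_of_nonneg ENNReal.toReal_nonneg]
      exact mul_le_mul (ENNReal.toReal_le_coe_of_le_coe (hΛ x)) (hB x) (norm_nonneg _) Λ.2
  have hT : ∀ ζ, measTransform (volume.withDensity W) H ζ = 𝓕 h (-ζ) := by
    intro ζ
    rw [measTransform, integral_withDensity_eq_integral_toReal_smul hW (Eventually.of_forall hWt),
      Real.fourier_eq]
    refine integral_congr_ae (Eventually.of_forall fun x => ?_)
    simp only [hh, inner_neg_right, neg_neg, Circle.smul_def, smul_eq_mul, Complex.real_smul]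
    ring
  simp only [hT]
  rw [lintegral_neg_eq_self (fun ζ => ‖𝓕 h ζ‖ₑ ^ 2) (μ := volume),
    lintegral_enorm_fourier_sq h1 h2, lintegral_withDensity_eq_lintegral_mul _ hW (by fun_prop),
    ← lintegral_const_mul _ (by fun_prop)]
  refine lintegral_mono fun x => ?_
  have h3 : ‖h x‖ₑ = W x * ‖H x‖ₑ := by
    rw [hh, enorm_smul, Real.enorm_of_nonneg ENNReal.toReal_nonneg,
      ENNReal.ofReal_toReal (hWt x).ne]
  simp only [h3, Pi.mul_apply]
  rw [mul_pow, sq (W x), mul_assoc]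
  exact mul_le_mul' (hΛ x) le_rfl

theorem lintegral_comp_smul_add {G : E → ℝ≥0∞} (hG : Measurable G) {R : ℝ} (hR : 0 < R) (a : E) :
    ∫⁻ ξ, G (a + R⁻¹ • ξ) = ENNReal.ofReal (R ^ Module.finrank ℝ E) * ∫⁻ ζ, G ζ := by
  have h1 : ∫⁻ ζ, G (a + ζ) = ∫⁻ ζ, G ζ := lintegral_add_left_eq_self G a
  have h2 := Measure.map_addHaar_smul (volume : Measure E) (r := R⁻¹) (by positivity)
  calc ∫⁻ ξ, G (a + R⁻¹ • ξ) = ∫⁻ ζ, G (a + ζ) ∂(Measure.map (R⁻¹ • ·) (volume : Measure E)) := by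
        rw [lintegral_map (by fun_prop) (by fun_prop)]
    _ = _ := by
        rw [h2, lintegral_smul_measure, h1, smul_eq_mul]
        congr 2
        rw [inv_pow, inv_inv, abs_of_pos (by positivity)]

/-- Cutting off the kernel at the scale `R` gives a Fourier multiplier of size `O(R)`. -/
theorem exists_quadBound_cutoff [Nontrivial E] (φ : SchwartzMap E ℂ) :
    ∃ C : ℝ, 0 ≤ C ∧ ∀ (R : ℝ), 0 < R → ∀ (W : E → ℝ≥0∞), Measurable W → ∀ (Λ : ℝ≥0),
      (∀ x, W x ≤ Λ) → IsFiniteMeasure (volume.withDensity W) →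
      QuadBound (volume.withDensity W) (fun z => sphereKernel z * φ (R⁻¹ • z))
        (ENNReal.ofReal (C * R) * Λ) := by
  set ψ : SchwartzMap E ℂ := 𝓕 φ with hψ
  set d := Module.finrank ℝ E with hd
  obtain ⟨C₀, hC₀⟩ : ∃ C₀ : ℝ, ∀ ξ, (1 + ‖ξ‖) ^ d * ‖ψ ξ‖ ≤ C₀ := by
    have h := SchwartzMap.one_add_le_sup_seminorm_apply (𝕜 := ℝ) (m := (d, 0)) (k := d) (n := 0)
      le_rfl le_rfl ψ
    simp only [norm_iteratedFDeriv_zero] at h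
    exact ⟨_, h⟩
  have hC₀0 : 0 ≤ C₀ := le_trans (by positivity) (hC₀ 0)
  obtain ⟨C, hC, hbump⟩ := exists_lintegral_sphere_bump_le (E := E) C₀ hC₀0
  refine ⟨C, hC, fun R hR W hW Λ hΛ hfin H hH ⟨B, hB⟩ => ?_⟩
  set σ := (volume : Measure E).toSphere with hσ
  set ν := volume.withDensity W with hν
  set T := measTransform ν H with hT
  have hTm : Measurable T := measurable_measTransform hH
  have hψm : Measurable ψ := ψ.continuous.measurable
  have hφ : ∀ z, φ (R⁻¹ • z) = ∫ ξ, ψ ξ * (𝐞 (inner ℝ z (R⁻¹ • ξ)) : ℂ) := by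
    intro z
    have h1 : φ = 𝓕⁻ ψ := by rw [hψ, FourierTransform.fourierInv_fourier_eq]
    have h2 : φ (R⁻¹ • z) = 𝓕⁻ (ψ : E → ℂ) (R⁻¹ • z) := by
      rw [← SchwartzMap.fourierInv_coe, ← h1]
    rw [h2, Real.fourierInv_eq]
    refine integral_congr_ae (Eventually.of_forall fun ξ => ?_)
    simp only [Circle.smul_def, smul_eq_mul, inner_smul_right]
    rw [mul_comm, real_inner_comm]
  have hK : ∀ z, sphereKernel z * φ (R⁻¹ • z) =
      ∫ p : sphere (0 : E) 1 × E, ψ p.2 * (𝐞 (inner ℝ z ((p.1 : E) + R⁻¹ • p.2)) : ℂ)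
        ∂(σ.prod volume) := by
    intro z
    rw [hφ, sphereKernel, ← integral_prod_mul (fun θ : sphere (0 : E) 1 =>
      (𝐞 (inner ℝ z (θ : E)) : ℂ)) (fun ξ => ψ ξ * (𝐞 (inner ℝ z (R⁻¹ • ξ)) : ℂ))]
    refine integral_congr_ae (Eventually.of_forall fun p => ?_)
    simp only [inner_add_right, fourierChar_add_coe]
    ring
  have ha : Integrable (fun p : sphere (0 : E) 1 × E => ψ p.2) (σ.prod volume) := by
    have := (integrable_const (μ := σ) (1 : ℂ)).mul_prod (ψ.integrable (μ := volume))
    simpa using this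
  have hquad := integral_quad_eq ha (Φ := fun p : sphere (0 : E) 1 × E => (p.1 : E) + R⁻¹ • p.2)
    (by fun_prop) (ν := ν) hH hB
  simp only [hK]
  rw [hquad]
  calc ‖∫ p : sphere (0 : E) 1 × E, ψ p.2 * (T ((p.1 : E) + R⁻¹ • p.2) *
          conj (T ((p.1 : E) + R⁻¹ • p.2))) ∂(σ.prod volume)‖ₑ
      ≤ ∫⁻ p : sphere (0 : E) 1 × E, ‖ψ p.2‖ₑ * ‖T ((p.1 : E) + R⁻¹ • p.2)‖ₑ ^ 2
          ∂(σ.prod volume) := by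
        refine (enorm_integral_le_lintegral_enorm _).trans (le_of_eq ?_)
        refine lintegral_congr fun p => ?_
        rw [enorm_mul, enorm_mul, sq]
        congr 2
        rw [← ofReal_norm, ← ofReal_norm, RCLike.norm_conj]
    _ = ∫⁻ θ : sphere (0 : E) 1, (∫⁻ ξ, ‖ψ ξ‖ₑ * ‖T ((θ : E) + R⁻¹ • ξ)‖ₑ ^ 2) ∂σ := by
        rw [lintegral_prod _ (by fun_prop)]
    _ = ∫⁻ θ : sphere (0 : E) 1, (ENNReal.ofReal (R ^ d) *
          ∫⁻ ζ, ‖ψ (R • (ζ - (θ : E)))‖ₑ * ‖T ζ‖ₑ ^ 2) ∂σ := by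
        refine lintegral_congr fun θ => ?_
        rw [← lintegral_comp_smul_add (G := fun ζ => ‖ψ (R • (ζ - (θ : E)))‖ₑ * ‖T ζ‖ₑ ^ 2)
          (by fun_prop) hR]
        refine lintegral_congr fun ξ => ?_
        rw [add_sub_cancel_left, smul_smul, mul_inv_cancel₀ hR.ne', one_smul]
    _ = ∫⁻ ζ, ∫⁻ θ : sphere (0 : E) 1, ENNReal.ofReal (R ^ d) *
          ‖ψ (R • (ζ - (θ : E)))‖ₑ * ‖T ζ‖ₑ ^ 2 ∂σ := by
        rw [lintegral_lintegral_swap (by fun_prop)]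
        refine lintegral_congr fun θ => ?_
        rw [← lintegral_const_mul _ (by fun_prop)]
        simp only [mul_assoc]
    _ ≤ ∫⁻ ζ, ENNReal.ofReal (C * R) * ‖T ζ‖ₑ ^ 2 := by
        refine lintegral_mono fun ζ => ?_
        dsimp only
        rw [lintegral_mul_const _ (by fun_prop)]
        gcongr
        exact hbump ψ hC₀ R hR ζ
    _ = ENNReal.ofReal (C * R) * ∫⁻ ζ, ‖T ζ‖ₑ ^ 2 := lintegral_const_mul _ (by fun_prop)
    _ ≤ ENNReal.ofReal (C * R) * (Λ * ∫⁻ x, ‖H x‖ₑ ^ 2 ∂ν) := by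
        gcongr
        exact lintegral_measTransform_sq_le hW hΛ hH hB
    _ = _ := by rw [mul_assoc]

end KernelCutoff

section Extension

variable {E : Type*} [NormedAddCommGroup E] [InnerProductSpace ℝ E] [FiniteDimensional ℝ E]
  [MeasurableSpace E] [BorelSpace E]

/-! ### The weighted extension estimate -/

/-- The Morrey condition `ν (B(x, ρ)) ≤ M ρ ^ δ` for all balls. -/
def MorreyBound (ν : Measure E) (δ : ℝ) (M : ℝ≥0∞) : Prop :=
  ∀ (x : E) (ρ : ℝ), 0 < ρ → ν (ball x ρ) ≤ M * ENNReal.ofReal (ρ ^ δ)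

/-- The function `‖z‖ ^ (-κ)`, cut off to `‖z‖ ≥ R`. -/
def powerTail {E : Type*} [NormedAddCommGroup E] (κ R : ℝ) (z : E) : ℝ≥0∞ :=
  if R ≤ ‖z‖ then ENNReal.ofReal (‖z‖ ^ (-κ)) else 0

theorem measurable_powerTail (κ R : ℝ) : Measurable (powerTail κ R : E → ℝ≥0∞) :=
  Measurable.ite (measurableSet_le measurable_const measurable_norm) (by fun_prop)
    measurable_const

theorem powerTail_neg {E : Type*} [NormedAddCommGroup E] (κ R : ℝ) (z : E) : powerTail κ R (-z) = powerTail κ R z := by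
  simp [powerTail]

theorem exists_lintegral_powerTail_le {δ κ : ℝ} (hκ : δ < κ) (hδ : 0 ≤ δ) :
    ∃ C : ℝ, 0 ≤ C ∧ ∀ (ν : Measure E) (M : ℝ≥0∞), MorreyBound ν δ M → ∀ R : ℝ, 0 < R →
      ∀ x : E, ∫⁻ y, powerTail κ R (x - y) ∂ν ≤ M * ENNReal.ofReal (C * R ^ (δ - κ)) := by
  set q : ℝ := 2 ^ (δ - κ) with hq
  have hq0 : 0 < q := by positivity
  have hq1 : q < 1 := Real.rpow_lt_one_of_one_lt_of_neg one_lt_two (by linarith)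
  refine ⟨2 ^ δ * (1 - q)⁻¹, mul_nonneg (by positivity) (inv_nonneg.2 (by linarith)),
    fun ν M hM R hR x => ?_⟩
  set c : ℕ → ℝ := fun m => (2 ^ m * R) ^ (-κ) with hc
  have hpt : ∀ y : E, powerTail κ R (x - y) ≤
      ∑' m : ℕ, (ball x (2 ^ (m + 1) * R)).indicator (fun _ => ENNReal.ofReal (c m)) y := by
    intro y
    by_cases h : R ≤ ‖x - y‖
    · obtain ⟨m, hm1, hm2⟩ := exists_nat_pow_near (x := ‖x - y‖ / R) (y := 2)
        ((one_le_div hR).2 h) one_lt_two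
      rw [le_div_iff₀ hR] at hm1
      rw [div_lt_iff₀ hR] at hm2
      refine le_trans ?_ (ENNReal.le_tsum m)
      rw [powerTail, if_pos h, indicator_of_mem (by rwa [mem_ball', dist_eq_norm])]
      exact ENNReal.ofReal_le_ofReal
        (Real.rpow_le_rpow_of_nonpos (by positivity) hm1 (by linarith))
    · rw [powerTail, if_neg h]; exact zero_le
  calc _ ≤ ∫⁻ y, ∑' m : ℕ, (ball x (2 ^ (m + 1) * R)).indicator
        (fun _ => ENNReal.ofReal (c m)) y ∂ν := lintegral_mono hpt
    _ = ∑' m : ℕ, ENNReal.ofReal (c m) * ν (ball x (2 ^ (m + 1) * R)) := by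
        rw [lintegral_tsum fun m => (measurable_const.indicator measurableSet_ball).aemeasurable]
        simp only [lintegral_indicator_const measurableSet_ball]
    _ ≤ ∑' m : ℕ, M * ENNReal.ofReal (2 ^ δ * R ^ (δ - κ) * q ^ m) := by
        refine ENNReal.tsum_le_tsum fun m => ?_
        refine (mul_le_mul_right (hM x _ (by positivity)) _).trans (le_of_eq ?_)
        rw [mul_left_comm, ← ENNReal.ofReal_mul (by positivity)]
        congr 2
        have h2 : ((2 : ℝ) ^ (m + 1) * R) = 2 * (2 ^ m * R) := by rw [pow_succ]; ring
        have h3 : (0 : ℝ) < 2 ^ m * R := by positivity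
        rw [hc, h2, Real.mul_rpow (by norm_num) h3.le, mul_left_comm, ← Real.rpow_add h3, hq,
          neg_add_eq_sub, Real.mul_rpow (by positivity) hR.le, ← Real.rpow_natCast (2 : ℝ) m,
          ← Real.rpow_natCast _ m, ← Real.rpow_mul (by norm_num), ← Real.rpow_mul (by norm_num),
          mul_comm (m : ℝ)]
        ring
    _ = _ := by
        rw [ENNReal.tsum_mul_left, ← ENNReal.ofReal_tsum_of_nonneg (fun m => by positivity)
          ((summable_geometric_of_lt_one hq0.le hq1).mul_left _), tsum_mul_left,
          tsum_geometric_of_lt_one hq0.le hq1]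
        congr 2
        ring

theorem measurable_sphereKernel : Measurable (sphereKernel : E → ℂ) := by
  have h := measurable_sphereExt (E := E) (g := fun _ => 1) measurable_const
  have e : sphereExt (fun _ => 1) = (sphereKernel : E → ℂ) := by
    funext x; simp [sphereExt, sphereKernel]
  rwa [e] at h

/-- The extension estimate for a weight satisfying a Morrey condition, from the decay of the
kernel. -/
theorem exists_sphereExt_le_of_morrey {δ : ℝ} (hδ : 0 ≤ δ)
    (hκ : δ < ((Module.finrank ℝ E - 1 : ℕ) : ℝ) / 2) :
    ∃ C : ℝ, 0 ≤ C ∧ ∀ (ν : Measure E) [IsFiniteMeasure ν] (M : ℝ≥0∞), MorreyBound ν δ M →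
      ∀ (g : sphere (0 : E) 1 → ℂ), Measurable g → (∃ B, ∀ θ, ‖g θ‖ ≤ B) →
      ∫⁻ x, ‖sphereExt g x‖ₑ ^ 2 ∂ν ≤
        M * ENNReal.ofReal C * ∫⁻ θ, ‖g θ‖ₑ ^ 2 ∂(volume : Measure E).toSphere := by
  obtain ⟨CT, hCT, hT⟩ := exists_lintegral_powerTail_le (E := E) hκ hδ
  obtain ⟨CK, hCK, hK⟩ := exists_norm_sphereKernel_le E
  set κ := ((Module.finrank ℝ E - 1 : ℕ) : ℝ) / 2 with hκd
  set A := (volume : Measure E).toSphere.real univ with hA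
  have hA0 : 0 ≤ A := measureReal_nonneg
  refine ⟨A + CK * CT, by positivity, fun ν _ M hM g hg ⟨B, hB⟩ => ?_⟩
  refine lintegral_sphereExt_sq_le (quadBound_of_schur (κ := fun z =>
    (ball (0 : E) 1).indicator (fun _ => ENNReal.ofReal A) z +
      ENNReal.ofReal CK * powerTail κ 1 z) ?_ ?_ ?_ ?_) hg hB
  · exact (measurable_const.indicator measurableSet_ball).add
      ((measurable_powerTail κ 1).const_mul _)
  · intro z
    rw [powerTail_neg]
    congr 1
    simp [indicator]
  · intro z
    rw [← ofReal_norm]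
    rcases lt_or_ge ‖z‖ 1 with h | h
    · rw [indicator_of_mem (by simpa using h)]
      exact le_add_right (ENNReal.ofReal_le_ofReal (norm_sphereKernel_le z))
    · rw [powerTail, if_pos h, ← ENNReal.ofReal_mul hCK]
      exact le_add_left (ENNReal.ofReal_le_ofReal (hK z h))
  · intro x
    have hball : ∀ y, (ball (0 : E) 1).indicator (fun _ => ENNReal.ofReal A) (x - y) =
        (ball x 1).indicator (fun _ => ENNReal.ofReal A) y := fun y => by
      simp [indicator, dist_eq_norm, norm_sub_rev]
    have hpm : Measurable fun y => powerTail κ 1 (x - y) :=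
      (measurable_powerTail κ 1).comp (measurable_const.sub measurable_id)
    rw [lintegral_add_right _ (hpm.const_mul _), lintegral_const_mul _ hpm]
    simp only [hball]
    rw [lintegral_indicator_const measurableSet_ball, ENNReal.ofReal_add hA0 (by positivity),
      mul_add, ENNReal.ofReal_mul hCK]
    refine add_le_add ?_ ?_
    · rw [mul_comm]
      gcongr
      simpa using hM x 1 one_pos
    · rw [mul_left_comm]
      gcongr
      simpa using hT ν M hM 1 one_pos x

/-- The extension estimate for a bounded weight satisfying a Morrey condition. The kernel is
split at the scale `R`; the near part is a bounded Fourier multiplier, to the far part Schur's test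
applies. -/
theorem exists_sphereExt_le_of_bounded [Nontrivial E] {δ : ℝ} (hδ : 0 ≤ δ)
    (hκ : δ < ((Module.finrank ℝ E - 1 : ℕ) : ℝ) / 2) :
    ∃ C : ℝ, 0 ≤ C ∧ ∀ (W : E → ℝ≥0∞), Measurable W → ∀ (Λ : ℝ≥0), (∀ x, W x ≤ Λ) →
      IsFiniteMeasure (volume.withDensity W) → ∀ M : ℝ≥0∞,
      MorreyBound (volume.withDensity W) δ M → ∀ R : ℝ, 1 ≤ R →
      ∀ (g : sphere (0 : E) 1 → ℂ), Measurable g → (∃ B, ∀ θ, ‖g θ‖ ≤ B) →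
      ∫⁻ x, ‖sphereExt g x‖ₑ ^ 2 ∂(volume.withDensity W) ≤
        (ENNReal.ofReal (C * R) * Λ +
          M * ENNReal.ofReal (C * R ^ (δ - ((Module.finrank ℝ E - 1 : ℕ) : ℝ) / 2))) *
        ∫⁻ θ, ‖g θ‖ₑ ^ 2 ∂(volume : Measure E).toSphere := by
  obtain ⟨CT, hCT, hT⟩ := exists_lintegral_powerTail_le (E := E) hκ hδ
  obtain ⟨CK, hCK, hK⟩ := exists_norm_sphereKernel_le E
  set κ := ((Module.finrank ℝ E - 1 : ℕ) : ℝ) / 2 with hκd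
  set b : ContDiffBump (0 : E) := ⟨1, 2, one_pos, one_lt_two⟩ with hb
  have hbc : HasCompactSupport fun x => (b x : ℂ) :=
    b.hasCompactSupport.comp_left (g := fun x : ℝ => (x : ℂ)) rfl
  have hbs : ContDiff ℝ ∞ fun x => (b x : ℂ) := Complex.ofRealCLM.contDiff.comp b.contDiff
  set φ : SchwartzMap E ℂ := hbc.toSchwartzMap hbs with hφ
  have hφb : ∀ x, φ x = (b x : ℂ) := fun x => rfl
  obtain ⟨CL, hCL, hL⟩ := exists_quadBound_cutoff φ
  set A := (volume : Measure E).toSphere.real univ with hA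
  have hA0 : 0 ≤ A := measureReal_nonneg
  refine ⟨CL + CK * CT, by positivity, fun W hW Λ hΛ hfin M hM R hR g hg ⟨B, hB⟩ => ?_⟩
  have hR0 : 0 < R := one_pos.trans_le hR
  have hb1 : ∀ z, ‖(1 : ℂ) - φ z‖ ≤ 1 := fun z => by
    rw [hφb, ← Complex.ofReal_one, ← Complex.ofReal_sub, Complex.norm_real, Real.norm_eq_abs,
      abs_le]
    constructor <;> linarith [b.nonneg' z, b.le_one (x := z)]
  have hb2 : ∀ z, ‖φ z‖ ≤ 1 := fun z => by
    rw [hφb, Complex.norm_real, Real.norm_of_nonneg (b.nonneg' z)]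
    exact b.le_one
  set k₁ : E → ℂ := fun z => sphereKernel z * φ (R⁻¹ • z) with hk₁
  set k₂ : E → ℂ := fun z => sphereKernel z * (1 - φ (R⁻¹ • z)) with hk₂
  have hφm : Measurable φ := φ.continuous.measurable
  have hKm : Measurable (sphereKernel : E → ℂ) := measurable_sphereKernel
  have hq₂ : QuadBound (volume.withDensity W) k₂
      (M * ENNReal.ofReal (CK * CT * R ^ (δ - κ))) := by
    refine quadBound_of_schur (κ := fun z => ENNReal.ofReal CK * powerTail κ R z)
      ((measurable_powerTail κ R).const_mul _) (fun z => by rw [powerTail_neg]) (fun z => ?_)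
      (fun x => ?_)
    · rw [← ofReal_norm, powerTail]
      split_ifs with h
      · rw [← ENNReal.ofReal_mul hCK]
        apply ENNReal.ofReal_le_ofReal
        rw [hk₂, norm_mul]
        exact (mul_le_of_le_one_right (norm_nonneg _) (hb1 _)).trans (hK z (hR.trans h))
      · have : φ (R⁻¹ • z) = 1 := by
          rw [hφb, b.one_of_mem_closedBall, Complex.ofReal_one]
          rw [mem_closedBall, dist_zero_right, norm_smul, norm_inv, Real.norm_of_nonneg hR0.le]
          change R⁻¹ * ‖z‖ ≤ 1
          rw [inv_mul_le_iff₀ hR0]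
          linarith [not_le.1 h]
        simp [hk₂, this]
    · have hpm : Measurable fun y => powerTail κ R (x - y) :=
        (measurable_powerTail κ R).comp (measurable_const.sub measurable_id)
      rw [lintegral_const_mul _ hpm, mul_assoc CK,
        ENNReal.ofReal_mul hCK, mul_left_comm]
      gcongr
      exact hT _ M hM R hR0 x
  have hq := (hL R hR0 W hW Λ hΛ hfin).add hq₂ (by fun_prop) (by fun_prop) (B := A)
    (fun z => by
      rw [norm_mul]
      exact (mul_le_of_le_one_right (norm_nonneg _) (hb2 _)).trans (norm_sphereKernel_le z))
    (fun z => by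
      rw [hk₂, norm_mul]
      exact (mul_le_of_le_one_right (norm_nonneg _) (hb1 _)).trans (norm_sphereKernel_le z))
  have hk : (fun z => sphereKernel z * φ (R⁻¹ • z) + k₂ z) = sphereKernel := by
    funext z; simp only [hk₂]; ring
  rw [hk] at hq
  refine (lintegral_sphereExt_sq_le hq hg hB).trans ?_
  gcongr
  · nlinarith [mul_nonneg hCK hCT]
  · linarith

theorem lintegral_le_of_forall_ball {F : E → ℝ≥0∞} {c : ℝ≥0∞}
    (h : ∀ m : ℕ, ∫⁻ x in ball 0 (m : ℝ), F x ≤ c) : ∫⁻ x, F x ≤ c := by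
  rw [← setLIntegral_univ, ← iUnion_ball_nat (0 : E), setLIntegral_iUnion_of_directed]
  · exact iSup_le h
  · exact Monotone.directed_le fun m k hmk => ball_subset_ball (by exact_mod_cast hmk)

theorem lintegral_truncate {W : E → ℝ≥0∞} (hW : Measurable W) {F : E → ℝ≥0∞}
    (hF : Measurable F) {S : Set E} (hS : MeasurableSet S) :
    ∫⁻ x, F x ∂(volume.withDensity (S.indicator W)) = ∫⁻ x in S, F x * W x := by
  rw [lintegral_withDensity_eq_lintegral_mul _ (hW.indicator hS) hF, ← lintegral_indicator hS]
  refine lintegral_congr fun x => ?_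
  by_cases h : x ∈ S <;> simp [h, mul_comm]

/-- Truncations of a weight dominated by a Morrey weight are finite measures and satisfy the same
Morrey condition. -/
theorem morreyBound_truncate {W v : E → ℝ≥0∞} {δ : ℝ} {M : ℝ≥0∞} (hM : M ≠ ⊤)
    (hWv : ∀ x, W x ≤ v x)
    (hv : ∀ (x : E) (ρ : ℝ), 0 < ρ → ∫⁻ y in ball x ρ, v y ≤ M * ENNReal.ofReal (ρ ^ δ)) (m : ℕ) :
    IsFiniteMeasure (volume.withDensity ((ball (0 : E) (m : ℝ)).indicator W)) ∧
      MorreyBound (volume.withDensity ((ball (0 : E) (m : ℝ)).indicator W)) δ M := by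
  constructor
  · refine isFiniteMeasure_withDensity ?_
    rw [lintegral_indicator measurableSet_ball]
    refine ne_of_lt (lt_of_le_of_lt ((lintegral_mono hWv).trans
      (lintegral_mono_set (ball_subset_ball (by linarith : (m : ℝ) ≤ m + 1)))) ?_)
    exact (hv 0 (m + 1) (by positivity)).trans_lt
      (ENNReal.mul_lt_top hM.lt_top ENNReal.ofReal_lt_top)
  · intro x ρ hρ
    rw [withDensity_apply _ measurableSet_ball]
    exact (lintegral_mono fun y => (indicator_le_self _ _ y).trans (hWv y)).trans (hv x ρ hρ)

/-- The extension estimate for weights in a Morrey class. Where the weight exceeds `1` the decay of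
the kernel suffices; each dyadic level set below `1` is treated with a cutoff scale adapted to it,
and the bounds decay geometrically. -/
theorem exists_weighted_sphereExt_le [Nontrivial E] {δ β : ℝ} (hδ : 0 ≤ δ) (hβ : 1 ≤ β)
    (hκ : β - 1 < ((Module.finrank ℝ E - 1 : ℕ) : ℝ) / 2 - δ) :
    ∃ C : ℝ≥0, ∀ W : E → ℝ≥0∞, Measurable W →
      (∀ (x : E) (ρ : ℝ), 0 < ρ → ∫⁻ y in ball x ρ, W y ^ β ≤ ENNReal.ofReal (ρ ^ δ)) →
      ∀ (g : sphere (0 : E) 1 → ℂ), Measurable g → (∃ B, ∀ θ, ‖g θ‖ ≤ B) →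
      ∫⁻ x, ‖sphereExt g x‖ₑ ^ 2 * W x ≤
        C * ∫⁻ θ, ‖g θ‖ₑ ^ 2 ∂(volume : Measure E).toSphere := by
  obtain ⟨C₁, hC₁, hhi⟩ := exists_sphereExt_le_of_morrey (E := E) hδ (by linarith)
  obtain ⟨C₂, hC₂, hlo⟩ := exists_sphereExt_le_of_bounded (E := E) hδ (by linarith)
  set κ := ((Module.finrank ℝ E - 1 : ℕ) : ℝ) / 2 with hκd
  set ε := κ - δ with hε
  have hε0 : 0 < ε := by linarith
  -- the cutoff scale for the level `2 ^ (-k)` is `2 ^ (k * τ)`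
  set τ := ((β - 1) / ε + 1) / 2 with hτ
  have hlt : (β - 1) / ε < 1 := (div_lt_one hε0).2 hκ
  have hτ1 : τ < 1 := by linarith
  have hτ0 : 0 ≤ τ := by have := div_nonneg (sub_nonneg.2 hβ) hε0.le; linarith
  have hτε : β - 1 < τ * ε := by
    rw [← div_lt_iff₀ hε0]; linarith
  set q₁ : ℝ := 2 ^ (τ - 1) with hq₁
  set q₂ : ℝ := 2 ^ (β - 1 - τ * ε) with hq₂
  have hq₁0 : 0 < q₁ := by positivity
  have hq₂0 : 0 < q₂ := by positivity
  have hq₁1 : q₁ < 1 := Real.rpow_lt_one_of_one_lt_of_neg one_lt_two (by linarith)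
  have hq₂1 : q₂ < 1 := Real.rpow_lt_one_of_one_lt_of_neg one_lt_two (by linarith)
  have hs : Summable fun k : ℕ => C₂ * q₁ ^ k + C₂ * 2 ^ (β - 1) * q₂ ^ k :=
    ((summable_geometric_of_lt_one hq₁0.le hq₁1).mul_left _).add
      ((summable_geometric_of_lt_one hq₂0.le hq₂1).mul_left _)
  refine ⟨Real.toNNReal C₁ +
    Real.toNNReal (∑' k : ℕ, (C₂ * q₁ ^ k + C₂ * 2 ^ (β - 1) * q₂ ^ k)),
    fun W hW hM g hg hgB => ?_⟩
  set G := ∫⁻ θ, ‖g θ‖ₑ ^ 2 ∂(volume : Measure E).toSphere with hG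
  have hFm : Measurable fun x => ‖sphereExt g x‖ₑ ^ 2 := (measurable_sphereExt hg).enorm.pow_const 2
  set A₀ : Set E := {x | 1 < W x} with hA₀
  set A : ℕ → Set E := fun k => {x | ENNReal.ofReal ((1 / 2) ^ (k + 1)) < W x ∧
    W x ≤ ENNReal.ofReal ((1 / 2) ^ k)} with hA
  have hA₀m : MeasurableSet A₀ := measurableSet_lt measurable_const hW
  have hAm : ∀ k, MeasurableSet (A k) := fun k =>
    (measurableSet_lt measurable_const hW).inter (measurableSet_le hW measurable_const)
  have hcover : ∀ x, W x ≤ A₀.indicator W x + ∑' k, (A k).indicator W x := by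
    intro x
    rcases eq_or_ne (W x) 0 with h0 | h0
    · rw [h0]; exact zero_le
    rcases lt_or_ge 1 (W x) with h1 | h1
    · rw [indicator_of_mem (show x ∈ A₀ from h1)]
      exact le_self_add
    · have htop : W x ≠ ⊤ := ne_top_of_le_ne_top ENNReal.one_ne_top h1
      obtain ⟨k, hk1, hk2⟩ := exists_nat_pow_near_of_lt_one (x := (W x).toReal) (y := 1 / 2)
        (ENNReal.toReal_pos h0 htop) (ENNReal.toReal_le_of_le_ofReal zero_le_one (by simpa))
        (by norm_num) (by norm_num)
      have hmem : x ∈ A k := ⟨(ENNReal.ofReal_lt_iff_lt_toReal (by positivity) htop).2 hk1,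
        (ENNReal.le_ofReal_iff_toReal_le htop (by positivity)).2 hk2⟩
      refine le_trans ?_ (le_trans (ENNReal.le_tsum k) le_add_self)
      rw [indicator_of_mem hmem]
  have hM₀ : ∫⁻ x, ‖sphereExt g x‖ₑ ^ 2 * A₀.indicator W x ≤ ENNReal.ofReal C₁ * G := by
    refine lintegral_le_of_forall_ball fun m => ?_
    have hle : ∀ x, A₀.indicator W x ≤ W x ^ β := by
      intro x
      by_cases h : x ∈ A₀
      · rw [indicator_of_mem h]
        exact ENNReal.le_rpow_self_of_one_le (le_of_lt h) hβ
      · rw [indicator_of_notMem h]; exact zero_le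
    obtain ⟨hfin, hmor⟩ := morreyBound_truncate (M := 1) ENNReal.one_ne_top hle
      (fun x ρ hρ => by rw [one_mul]; exact hM x ρ hρ) m
    rw [← lintegral_truncate (hW.indicator hA₀m) hFm measurableSet_ball]
    have := hhi _ 1 hmor g hg hgB
    rwa [one_mul] at this
  have hMk : ∀ k, ∫⁻ x, ‖sphereExt g x‖ₑ ^ 2 * (A k).indicator W x ≤
      ENNReal.ofReal (C₂ * q₁ ^ k + C₂ * 2 ^ (β - 1) * q₂ ^ k) * G := by
    intro k
    refine lintegral_le_of_forall_ball fun m => ?_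
    set Mk : ℝ := (2 ^ (k + 1)) ^ (β - 1) with hMk
    set Λ : ℝ≥0 := (1 / 2) ^ k with hΛ
    have hle : ∀ x, (A k).indicator W x ≤ ENNReal.ofReal Mk * W x ^ β := by
      intro x
      by_cases h : x ∈ A k
      · rw [indicator_of_mem h]
        have htop : W x ≠ ⊤ := ne_top_of_le_ne_top ENNReal.ofReal_ne_top h.2
        have hw := (ENNReal.ofReal_lt_iff_lt_toReal (by positivity) htop).1 h.1
        have hw0 : 0 < (W x).toReal := lt_trans (by positivity) hw
        rw [← ENNReal.ofReal_toReal htop, ENNReal.ofReal_rpow_of_pos hw0,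
          ← ENNReal.ofReal_mul (by positivity)]
        apply ENNReal.ofReal_le_ofReal
        have h2 : (W x).toReal ^ β = (W x).toReal ^ (β - 1) * (W x).toReal := by
          rw [← Real.rpow_add_one hw0.ne', sub_add_cancel]
        rw [h2, ← mul_assoc, hMk, ← Real.mul_rpow (by positivity) hw0.le]
        refine le_mul_of_one_le_left hw0.le (Real.one_le_rpow ?_ (by linarith))
        have h3 : (1 : ℝ) = 2 ^ (k + 1) * (1 / 2) ^ (k + 1) := by rw [← mul_pow]; norm_num
        calc (1 : ℝ) = 2 ^ (k + 1) * (1 / 2) ^ (k + 1) := h3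
          _ ≤ _ := by gcongr
      · rw [indicator_of_notMem h]; exact zero_le
    obtain ⟨hfin, hmor⟩ := morreyBound_truncate (M := ENNReal.ofReal Mk) ENNReal.ofReal_ne_top hle
      (fun x ρ hρ => by
        rw [lintegral_const_mul _ (by fun_prop)]
        gcongr
        exact hM x ρ hρ) m
    rw [← lintegral_truncate (hW.indicator (hAm k)) hFm measurableSet_ball]
    have hΛle : ∀ x, (ball (0 : E) (m : ℝ)).indicator ((A k).indicator W) x ≤ Λ := by
      intro x
      refine (indicator_le_self _ _ x).trans ?_
      by_cases h : x ∈ A k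
      · rw [indicator_of_mem h]
        refine h.2.trans (le_of_eq ?_)
        rw [hΛ, ENNReal.ofReal, Real.toNNReal_pow (by norm_num)]
        congr 2
        ext
        simp
      · rw [indicator_of_notMem h]; exact zero_le
    have hR1 : (1 : ℝ) ≤ 2 ^ (k * τ) :=
      Real.one_le_rpow one_le_two (by positivity)
    refine (hlo _ ((hW.indicator (hAm k)).indicator measurableSet_ball) Λ hΛle hfin _ hmor
      (2 ^ (k * τ)) hR1 g hg hgB).trans ?_
    gcongr
    have hΛr : (Λ : ℝ≥0∞) = ENNReal.ofReal ((2 : ℝ) ^ (-(k : ℝ))) := by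
      rw [hΛ, ENNReal.ofReal]
      congr 1
      ext
      rw [Real.coe_toNNReal _ (by positivity), Real.rpow_neg (by norm_num), Real.rpow_natCast]
      simp
    have h2 : (0 : ℝ) < 2 := by norm_num
    rw [hΛr, ← ENNReal.ofReal_mul (by positivity), ← ENNReal.ofReal_mul (by positivity),
      ← ENNReal.ofReal_add (by positivity) (by positivity)]
    apply ENNReal.ofReal_le_ofReal
    apply le_of_eq
    rw [hMk, hq₁, hq₂, mul_assoc C₂, ← Real.rpow_add h2, ← Real.rpow_natCast (2 : ℝ) (k + 1),
      ← Real.rpow_natCast (2 ^ (τ - 1)), ← Real.rpow_natCast (2 ^ (β - 1 - τ * ε)),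
      ← Real.rpow_mul h2.le, ← Real.rpow_mul h2.le, ← Real.rpow_mul h2.le, ← Real.rpow_mul h2.le,
      mul_left_comm, ← Real.rpow_add h2, mul_assoc C₂, ← Real.rpow_add h2]
    push_cast
    congr 3
    · ring
    · rw [hε]; ring
  calc ∫⁻ x, ‖sphereExt g x‖ₑ ^ 2 * W x
      ≤ ∫⁻ x, (‖sphereExt g x‖ₑ ^ 2 * A₀.indicator W x +
          ∑' k, ‖sphereExt g x‖ₑ ^ 2 * (A k).indicator W x) := by
        refine lintegral_mono fun x => ?_
        rw [ENNReal.tsum_mul_left, ← mul_add]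
        exact mul_le_mul_right (hcover x) _
    _ = (∫⁻ x, ‖sphereExt g x‖ₑ ^ 2 * A₀.indicator W x) +
          ∑' k, ∫⁻ x, ‖sphereExt g x‖ₑ ^ 2 * (A k).indicator W x := by
        have hm : Measurable fun x => ‖sphereExt g x‖ₑ ^ 2 * A₀.indicator W x :=
          hFm.mul (hW.indicator hA₀m)
        have hmk : ∀ k, Measurable fun x => ‖sphereExt g x‖ₑ ^ 2 * (A k).indicator W x :=
          fun k => hFm.mul (hW.indicator (hAm k))
        rw [lintegral_add_left hm, lintegral_tsum fun k => (hmk k).aemeasurable]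
    _ ≤ ENNReal.ofReal C₁ * G +
          ∑' k : ℕ, ENNReal.ofReal (C₂ * q₁ ^ k + C₂ * 2 ^ (β - 1) * q₂ ^ k) * G :=
        add_le_add hM₀ (ENNReal.tsum_le_tsum hMk)
    _ = _ := by
        rw [ENNReal.tsum_mul_right, ← ENNReal.ofReal_tsum_of_nonneg (fun k => by positivity) hs,
          ← add_mul, ENNReal.coe_add]
        rfl

end Extension

section Scaling

variable {E : Type*} [NormedAddCommGroup E] [InnerProductSpace ℝ E] [FiniteDimensional ℝ E]
  [MeasurableSpace E] [BorelSpace E]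

/-- The weighted extension estimate for the sphere of radius `r`. -/
theorem exists_weighted_sphereExt_smul_le [Nontrivial E] {δ β : ℝ} (hδ : 0 ≤ δ) (hβ : 1 ≤ β)
    (hκ : β - 1 < ((Module.finrank ℝ E - 1 : ℕ) : ℝ) / 2 - δ) :
    ∃ C : ℝ≥0, ∀ (M : ℝ), 0 < M → ∀ W : E → ℝ≥0∞, Measurable W →
      (∀ (x : E) (ρ : ℝ), 0 < ρ → ∫⁻ y in ball x ρ, W y ^ β ≤ ENNReal.ofReal (M * ρ ^ δ)) →
      ∀ (g : sphere (0 : E) 1 → ℂ), Measurable g → (∃ B, ∀ θ, ‖g θ‖ ≤ B) → ∀ r : ℝ, 0 < r →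
      ∫⁻ x, ‖sphereExt g (r • x)‖ₑ ^ 2 * W x ≤
        C * ENNReal.ofReal (M ^ (1 / β) *
          r ^ (((Module.finrank ℝ E : ℝ) - δ) / β - Module.finrank ℝ E)) *
        ∫⁻ θ, ‖g θ‖ₑ ^ 2 ∂(volume : Measure E).toSphere := by
  obtain ⟨C, hC⟩ := exists_weighted_sphereExt_le (E := E) hδ hβ hκ
  refine ⟨C, fun M hM W hW hMor g hg hgB r hr => ?_⟩
  set d := Module.finrank ℝ E with hd
  have hβ0 : 0 < β := by linarith
  set L : ℝ := (M * r ^ ((d : ℝ) - δ)) ^ (1 / β) with hL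
  have hMr : 0 < M * r ^ ((d : ℝ) - δ) := by positivity
  have hL0 : 0 < L := by positivity
  have hLβ : L ^ β = M * r ^ ((d : ℝ) - δ) := by
    rw [hL, ← Real.rpow_mul hMr.le, one_div_mul_cancel hβ0.ne', Real.rpow_one]
  set W' : E → ℝ≥0∞ := fun y => ENNReal.ofReal L⁻¹ * W (r⁻¹ • y) with hW'
  have hW'm : Measurable W' := by fun_prop
  have hscale : ∀ G : E → ℝ≥0∞, Measurable G →
      ∫⁻ y, G (r⁻¹ • y) = ENNReal.ofReal (r ^ d) * ∫⁻ x, G x := fun G hG => by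
    simpa using lintegral_comp_smul_add hG hr 0
  have hMor' : ∀ (x : E) (ρ : ℝ), 0 < ρ → ∫⁻ y in ball x ρ, W' y ^ β ≤ ENNReal.ofReal (ρ ^ δ) := by
    intro x ρ hρ
    have hWβ : Measurable fun y => W y ^ β := by fun_prop
    have hpt : ∀ y, (ball x ρ).indicator (fun y => W' y ^ β) y = ENNReal.ofReal (L⁻¹ ^ β) *
        (ball (r⁻¹ • x) (r⁻¹ * ρ)).indicator (fun y => W y ^ β) (r⁻¹ • y) := by
      intro y
      have hiff : r⁻¹ • y ∈ ball (r⁻¹ • x) (r⁻¹ * ρ) ↔ y ∈ ball x ρ := by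
        rw [mem_ball, mem_ball, dist_smul₀, norm_inv, Real.norm_of_nonneg hr.le,
          mul_lt_mul_iff_right₀ (inv_pos.2 hr)]
      by_cases h : y ∈ ball x ρ
      · rw [indicator_of_mem h, indicator_of_mem (hiff.2 h), hW',
          ENNReal.mul_rpow_of_nonneg _ _ hβ0.le, ENNReal.ofReal_rpow_of_pos (by positivity)]
      · rw [indicator_of_notMem h, indicator_of_notMem (fun h' => h (hiff.1 h')), mul_zero]
    rw [← lintegral_indicator measurableSet_ball]
    simp only [hpt]
    have hind : Measurable ((ball (r⁻¹ • x) (r⁻¹ * ρ)).indicator fun y => W y ^ β) :=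
      hWβ.indicator measurableSet_ball
    rw [lintegral_const_mul _ (by fun_prop), hscale _ hind, lintegral_indicator measurableSet_ball]
    refine (mul_le_mul_right (mul_le_mul_right (hMor _ _ (by positivity)) _) _).trans ?_
    rw [← ENNReal.ofReal_mul (by positivity), ← ENNReal.ofReal_mul (by positivity)]
    apply ENNReal.ofReal_le_ofReal
    apply le_of_eq
    rw [Real.inv_rpow hL0.le, hLβ, Real.mul_rpow (by positivity) hρ.le, Real.inv_rpow hr.le,
      Real.rpow_sub hr, Real.rpow_natCast]
    field_simp
  have hmain := hC W' hW'm hMor' g hg hgB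
  have hGm : Measurable fun x => ‖sphereExt g (r • x)‖ₑ ^ 2 * W x :=
    (((measurable_sphereExt hg).comp (measurable_const_smul r)).enorm.pow_const 2).mul hW
  have h1 := hscale _ hGm
  have h2 : ∫⁻ x, ‖sphereExt g x‖ₑ ^ 2 * W' x = ENNReal.ofReal L⁻¹ *
      ∫⁻ y, ‖sphereExt g (r • r⁻¹ • y)‖ₑ ^ 2 * W (r⁻¹ • y) := by
    have hGm' : Measurable fun y => ‖sphereExt g (r • r⁻¹ • y)‖ₑ ^ 2 * W (r⁻¹ • y) :=
      hGm.comp (measurable_const_smul r⁻¹)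
    rw [← lintegral_const_mul _ hGm']
    refine lintegral_congr fun y => ?_
    rw [smul_smul, mul_inv_cancel₀ hr.ne', one_smul, hW']
    ring
  rw [h2, h1, ← mul_assoc, ← ENNReal.ofReal_mul (by positivity)] at hmain
  have hone : ENNReal.ofReal (M ^ (1 / β) * r ^ (((d : ℝ) - δ) / β - d)) *
      ENNReal.ofReal (L⁻¹ * r ^ d) = 1 := by
    rw [← ENNReal.ofReal_mul (by positivity), ← ENNReal.ofReal_one]
    congr 1
    rw [hL, Real.mul_rpow hM.le (by positivity), ← Real.rpow_mul hr.le, Real.rpow_sub hr,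
      Real.rpow_natCast, mul_one_div]
    field_simp
  calc ∫⁻ x, ‖sphereExt g (r • x)‖ₑ ^ 2 * W x
      = ENNReal.ofReal (M ^ (1 / β) * r ^ (((d : ℝ) - δ) / β - d)) *
          (ENNReal.ofReal (L⁻¹ * r ^ d) * ∫⁻ x, ‖sphereExt g (r • x)‖ₑ ^ 2 * W x) := by
        rw [← mul_assoc, hone, one_mul]
    _ ≤ ENNReal.ofReal (M ^ (1 / β) * r ^ (((d : ℝ) - δ) / β - d)) *
          (C * ∫⁻ θ, ‖g θ‖ₑ ^ 2 ∂(volume : Measure E).toSphere) := by gcongr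
    _ = _ := by ring

end Scaling

/-! ### Plancherel's theorem in time -/

/-- Plancherel's theorem in the variable dual to `φ(r)`, where `φ` is a diffeomorphism of the half
line with derivative `φ'`. -/
theorem lintegral_oscillatory_sq_le {φ φ' ψ : ℝ → ℝ} (hψm : Measurable ψ) (hφ'm : Measurable φ')
    (hφ : ∀ r, 0 < r → HasDerivAt φ (φ' r) r) (hφ' : ∀ r, 0 < r → 0 < φ' r)
    (hpos : ∀ r, 0 < r → 0 < φ r) (hψpos : ∀ r, 0 < r → 0 < ψ r)
    (hψφ : ∀ r, 0 < r → ψ (φ r) = r) (hφψ : ∀ r, 0 < r → φ (ψ r) = r)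
    {b : ℝ → ℂ} (hb : Measurable b) (hbi : IntegrableOn b (Ioi 0)) :
    ∫⁻ t : ℝ, ‖∫ r in Ioi (0 : ℝ), (𝐞 (-(t * φ r)) : ℂ) * b r‖ₑ ^ 2 ≤
      ∫⁻ r in Ioi (0 : ℝ), ENNReal.ofReal (φ' r)⁻¹ * ‖b r‖ₑ ^ 2 := by
  have himg : φ '' Ioi 0 = Ioi 0 := by
    ext y
    constructor
    · rintro ⟨r, hr, rfl⟩; exact hpos r hr
    · intro hy; exact ⟨ψ y, hψpos y hy, hφψ y hy⟩
  have hinj : InjOn φ (Ioi 0) := fun x hx y hy h => by rw [← hψφ x hx, ← hψφ y hy, h]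
  have hder : ∀ r ∈ Ioi (0 : ℝ), HasDerivWithinAt φ (φ' r) (Ioi 0) r :=
    fun r hr => (hφ r hr).hasDerivWithinAt
  set a : ℝ → ℂ := (Ioi (0 : ℝ)).indicator fun ρ => ((φ' (ψ ρ))⁻¹ : ℝ) * b (ψ ρ) with ha
  have ham : Measurable a := Measurable.indicator (by fun_prop) measurableSet_Ioi
  have haφ : ∀ r, 0 < r → a (φ r) = ((φ' r)⁻¹ : ℝ) * b r := fun r hr => by
    rw [ha, indicator_of_mem (show φ r ∈ Ioi 0 from hpos r hr), hψφ r hr]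
  have hjac : ∀ r, 0 < r → |φ' r| • a (φ r) = b r := fun r hr => by
    have h0 : ((φ' r : ℝ) : ℂ) ≠ 0 := Complex.ofReal_ne_zero.2 (hφ' r hr).ne'
    rw [haφ r hr, abs_of_pos (hφ' r hr), Complex.real_smul, Complex.ofReal_inv, ← mul_assoc,
      mul_inv_cancel₀ h0, one_mul]
  have hsupp : ∀ ρ, ρ ∉ Ioi (0 : ℝ) → a ρ = 0 := fun ρ hρ => indicator_of_notMem hρ _
  have hai : Integrable a := by
    rw [← integrableOn_iff_integrable_of_support_subset (s := Ioi 0)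
      (by simp [ha]), ← himg,
      integrableOn_image_iff_integrableOn_abs_deriv_smul measurableSet_Ioi hder hinj]
    exact hbi.congr_fun (fun r hr => (hjac r hr).symm) measurableSet_Ioi
  have hasq : ∫⁻ ρ, ‖a ρ‖ₑ ^ 2 = ∫⁻ r in Ioi (0 : ℝ), ENNReal.ofReal (φ' r)⁻¹ * ‖b r‖ₑ ^ 2 := by
    have h1 : ∫⁻ ρ, ‖a ρ‖ₑ ^ 2 = ∫⁻ ρ in Ioi 0, ‖a ρ‖ₑ ^ 2 := by
      rw [← lintegral_indicator measurableSet_Ioi]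
      refine lintegral_congr fun ρ => ?_
      by_cases h : ρ ∈ Ioi (0 : ℝ)
      · rw [indicator_of_mem h]
      · rw [indicator_of_notMem h, hsupp ρ h]; simp
    rw [h1]
    nth_rewrite 1 [← himg]
    rw [lintegral_image_eq_lintegral_abs_deriv_mul measurableSet_Ioi hder hinj]
    refine setLIntegral_congr_fun measurableSet_Ioi fun r hr => ?_
    have h0 : 0 < φ' r := hφ' r hr
    rw [haφ r hr, abs_of_pos h0, enorm_mul, mul_pow, ← ofReal_norm (((φ' r)⁻¹ : ℝ) : ℂ),
      Complex.norm_real, Real.norm_of_nonneg (by positivity), ← ENNReal.ofReal_pow (by positivity),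
      ← mul_assoc, ← ENNReal.ofReal_mul h0.le]
    congr 2
    field_simp
  rcases eq_or_ne (∫⁻ r in Ioi (0 : ℝ), ENNReal.ofReal (φ' r)⁻¹ * ‖b r‖ₑ ^ 2) ⊤ with htop | htop
  · rw [htop]; exact le_top
  have ha2 : MemLp a 2 := by
    refine ⟨ham.aestronglyMeasurable, ?_⟩
    have := eLpNorm_nnreal_pow_eq_lintegral (f := a) (μ := volume) (p := 2) (by norm_num)
    simp only [NNReal.coe_ofNat, ENNReal.rpow_ofNat, ENNReal.coe_ofNat] at this
    rw [hasq] at this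
    by_contra hcon
    rw [not_lt, top_le_iff] at hcon
    rw [hcon] at this
    exact htop (this.symm.trans (by simp))
  have hF : ∀ t, 𝓕 a t = ∫ r in Ioi (0 : ℝ), (𝐞 (-(t * φ r)) : ℂ) * b r := by
    intro t
    rw [Real.fourier_real_eq, ← setIntegral_eq_integral_of_forall_compl_eq_zero (s := Ioi 0)
      (fun ρ hρ => by rw [hsupp ρ hρ, smul_zero])]
    nth_rewrite 1 [← himg]
    rw [integral_image_eq_integral_abs_deriv_smul measurableSet_Ioi hder hinj]
    refine setIntegral_congr_fun measurableSet_Ioi fun r hr => ?_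
    rw [smul_comm, hjac r hr, Circle.smul_def, smul_eq_mul, mul_comm t]
  rw [← hasq, ← lintegral_enorm_fourier_sq hai ha2]
  simp only [hF]
  exact le_rfl

/-- Plancherel's theorem in time for the dispersion relation `r ↦ (2πr) ^ γ`. -/
theorem lintegral_time_sq_le {γ : ℝ} (hγ : 0 < γ) {b : ℝ → ℂ} (hb : Measurable b)
    (hbi : IntegrableOn b (Ioi 0)) :
    ∫⁻ t : ℝ, ‖∫ r in Ioi (0 : ℝ),
        Complex.exp (-(Complex.I * (t : ℂ) * (((2 * Real.pi * r) ^ γ : ℝ) : ℂ))) * b r‖ₑ ^ 2 ≤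
      ∫⁻ r in Ioi (0 : ℝ), ENNReal.ofReal (γ * (2 * Real.pi * r) ^ (γ - 1))⁻¹ * ‖b r‖ₑ ^ 2 := by
  have hpi : 0 < 2 * Real.pi := Real.two_pi_pos
  have h := lintegral_oscillatory_sq_le (φ := fun r => (2 * Real.pi * r) ^ γ / (2 * Real.pi))
    (φ' := fun r => γ * (2 * Real.pi * r) ^ (γ - 1))
    (ψ := fun ρ => (2 * Real.pi * ρ) ^ (1 / γ) / (2 * Real.pi)) (by fun_prop) (by fun_prop)
    (fun r hr => ?_) (fun r hr => by positivity) (fun r hr => by positivity)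
    (fun r hr => by positivity) (fun r hr => ?_) (fun r hr => ?_) hb hbi
  · refine le_trans (le_of_eq ?_) h
    refine lintegral_congr fun t => ?_
    congr 3
    funext r
    rw [Real.fourierChar_apply]
    congr 2
    push_cast
    have : (Real.pi : ℂ) ≠ 0 := Complex.ofReal_ne_zero.2 Real.pi_ne_zero
    field_simp
  · have h0 : 2 * Real.pi * r ≠ 0 := by positivity
    have h1 := (((hasDerivAt_id r).const_mul (2 * Real.pi)).rpow_const (p := γ)
      (Or.inl h0)).div_const (2 * Real.pi)
    refine h1.congr_deriv ?_
    simp only [id]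
    field_simp
  · rw [mul_div_cancel₀ _ hpi.ne', ← Real.rpow_mul (by positivity), mul_one_div_cancel hγ.ne',
      Real.rpow_one, mul_div_cancel_left₀ _ hpi.ne']
  · rw [mul_div_cancel₀ _ hpi.ne', ← Real.rpow_mul (by positivity), one_div_mul_cancel hγ.ne',
      Real.rpow_one, mul_div_cancel_left₀ _ hpi.ne']

/-! ### The weighted estimate for data with frequencies in an annulus -/

section Annular

variable {n : ℕ}

/-- A bounded measurable function supported in an annulus `a ≤ ‖η‖ ≤ b` with `a > 0`. -/
structure IsAnnular (F : EuclideanSpace ℝ (Fin n) → ℂ) : Prop where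
  measurable : Measurable F
  bounded : ∃ B, ∀ η, ‖F η‖ ≤ B
  annulus : ∃ a b : ℝ, 0 < a ∧ ∀ η, F η ≠ 0 → a ≤ ‖η‖ ∧ ‖η‖ ≤ b

/-- The function `|∇|^s e^{-it(-Δ)^{γ/2}} f (x)`, where `F` is the Fourier transform of `f`, as an
absolutely convergent integral. -/
def freqEvol (γ s : ℝ) (F : EuclideanSpace ℝ (Fin n) → ℂ) (t : ℝ)
    (x : EuclideanSpace ℝ (Fin n)) : ℂ :=
  ∫ η, fracSymbol γ s t η * F η * (𝐞 (inner ℝ x η) : ℂ)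

theorem IsAnnular.sub {F G : EuclideanSpace ℝ (Fin n) → ℂ} (hF : IsAnnular F)
    (hG : IsAnnular G) : IsAnnular (F - G) := by
  obtain ⟨B, hB⟩ := hF.bounded
  obtain ⟨B', hB'⟩ := hG.bounded
  obtain ⟨a, b, ha, hab⟩ := hF.annulus
  obtain ⟨a', b', ha', hab'⟩ := hG.annulus
  refine ⟨hF.measurable.sub hG.measurable, ⟨B + B', fun η =>
    (norm_sub_le _ _).trans (add_le_add (hB η) (hB' η))⟩, min a a', max b b', lt_min ha ha',
    fun η hη => ?_⟩
  by_cases h : F η = 0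
  · have h' : G η ≠ 0 := fun h' => hη (by simp [h, h'])
    exact ⟨(min_le_right _ _).trans (hab' η h').1, (hab' η h').2.trans (le_max_right _ _)⟩
  · exact ⟨(min_le_left _ _).trans (hab η h).1, (hab η h).2.trans (le_max_left _ _)⟩

theorem norm_fracSymbol (γ s t : ℝ) (η : EuclideanSpace ℝ (Fin n)) :
    ‖fracSymbol γ s t η‖ = (2 * Real.pi * ‖η‖) ^ s := by
  have h : -(Complex.I * (t : ℂ) * (((2 * Real.pi * ‖η‖) ^ γ : ℝ) : ℂ)) =
      ((-(t * (2 * Real.pi * ‖η‖) ^ γ) : ℝ) : ℂ) * Complex.I := by push_cast; ring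
  rw [fracSymbol, norm_mul, Complex.norm_real, h, Complex.norm_exp_ofReal_mul_I, mul_one,
    Real.norm_of_nonneg (by positivity)]

theorem measurable_fracSymbol (γ s : ℝ) :
    Measurable fun p : ℝ × EuclideanSpace ℝ (Fin n) => fracSymbol γ s p.1 p.2 := by
  unfold fracSymbol
  fun_prop

/-- On an interval away from `0`, a power is bounded, whatever the sign of the exponent. -/
theorem rpow_le_add_of_mem_Icc {a b x : ℝ} (ha : 0 < a) (hax : a ≤ x) (hxb : x ≤ b) (s : ℝ) :
    x ^ s ≤ a ^ s + b ^ s := by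
  have hx : 0 < x := ha.trans_le hax
  have hb : 0 < b := hx.trans_le hxb
  rcases le_total 0 s with hs | hs
  · exact (Real.rpow_le_rpow hx.le hxb hs).trans (le_add_of_nonneg_left (by positivity))
  · exact (Real.rpow_le_rpow_of_nonpos ha hax hs).trans (le_add_of_nonneg_right (by positivity))

theorem IsAnnular.integrable {F : EuclideanSpace ℝ (Fin n) → ℂ} (hF : IsAnnular F) (γ s t : ℝ) :
    Integrable fun η => fracSymbol γ s t η * F η := by
  obtain ⟨B, hB⟩ := hF.bounded
  obtain ⟨a, b, ha, hab⟩ := hF.annulus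
  set S := (2 * Real.pi * a) ^ s + (2 * Real.pi * b) ^ s with hS
  have hg : Integrable ((closedBall (0 : EuclideanSpace ℝ (Fin n)) b).indicator
      fun _ => S * B) := by
    rw [integrable_indicator_iff measurableSet_closedBall]
    exact integrableOn_const measure_closedBall_lt_top.ne
  refine hg.mono' ?_ (Eventually.of_forall fun η => ?_)
  · exact (((measurable_fracSymbol γ s).comp (by fun_prop : Measurable fun η => (t, η))).mul
      hF.measurable).aestronglyMeasurable
  · by_cases h : F η = 0
    · rw [h, mul_zero, norm_zero]
      refine indicator_nonneg (fun η' hη' => ?_) η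
      have hb : 0 ≤ b := (norm_nonneg η').trans (by simpa using hη')
      have hpi := Real.pi_pos
      have : 0 ≤ B := (norm_nonneg _).trans (hB η)
      positivity
    · have hη := hab η h
      rw [indicator_of_mem (by simpa using hη.2), norm_mul, norm_fracSymbol]
      have h2 : 2 * Real.pi * ‖η‖ ≤ 2 * Real.pi * b := by gcongr; exact hη.2
      have h1 : 2 * Real.pi * a ≤ 2 * Real.pi * ‖η‖ := by gcongr; exact hη.1
      have h3 := rpow_le_add_of_mem_Icc (by positivity) h1 h2 s
      have h0 : 0 ≤ (2 * Real.pi * ‖η‖) ^ s := by positivity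
      exact mul_le_mul h3 (hB η) (norm_nonneg _) (h0.trans h3)

theorem IsAnnular.integrable_mul_char {F : EuclideanSpace ℝ (Fin n) → ℂ} (hF : IsAnnular F)
    (γ s t : ℝ) (x : EuclideanSpace ℝ (Fin n)) :
    Integrable fun η => fracSymbol γ s t η * F η * (𝐞 (inner ℝ x η) : ℂ) :=
  (hF.integrable γ s t).mul_bdd (c := 1)
    (measurable_fourierChar_comp (by fun_prop)).aestronglyMeasurable
    (Eventually.of_forall fun η => (Circle.norm_coe _).le)

theorem freqEvol_sub {F G : EuclideanSpace ℝ (Fin n) → ℂ} (hF : IsAnnular F) (hG : IsAnnular G)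
    (γ s t : ℝ) (x : EuclideanSpace ℝ (Fin n)) :
    freqEvol γ s (F - G) t x = freqEvol γ s F t x - freqEvol γ s G t x := by
  rw [freqEvol, freqEvol, freqEvol, ← integral_sub (hF.integrable_mul_char γ s t x)
    (hG.integrable_mul_char γ s t x)]
  refine integral_congr_ae (Eventually.of_forall fun η => ?_)
  simp only [Pi.sub_apply]
  ring

theorem measurable_freqEvol {F : EuclideanSpace ℝ (Fin n) → ℂ} (hF : Measurable F) (γ s : ℝ) :
    Measurable fun p : ℝ × EuclideanSpace ℝ (Fin n) => freqEvol γ s F p.1 p.2 := by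
  have : StronglyMeasurable fun q : (ℝ × EuclideanSpace ℝ (Fin n)) × EuclideanSpace ℝ (Fin n) =>
      fracSymbol γ s q.1.1 q.2 * F q.2 * (𝐞 (inner ℝ q.1.2 q.2) : ℂ) := by
    refine Measurable.stronglyMeasurable (Measurable.mul (Measurable.mul ?_ ?_) ?_)
    · have h := (measurable_fracSymbol γ s).comp (by fun_prop : Measurable fun q :
        (ℝ × EuclideanSpace ℝ (Fin n)) × EuclideanSpace ℝ (Fin n) => (q.1.1, q.2))
      simpa only [Function.comp_def] using h
    · exact hF.comp measurable_snd
    · exact measurable_fourierChar_comp (by fun_prop)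
  exact (this.integral_prod_right (ν := volume)).measurable

/-- The density of `freqEvol` in the radial frequency variable `r`. -/
def radialDensity (s : ℝ) (F : EuclideanSpace ℝ (Fin n) → ℂ) (x : EuclideanSpace ℝ (Fin n))
    (r : ℝ) : ℂ :=
  ((r ^ (n - 1) * (2 * Real.pi * r) ^ s : ℝ) : ℂ) *
    sphereExt (fun θ => F (r • (θ : EuclideanSpace ℝ (Fin n)))) (r • x)

theorem measurable_radialDensity {F : EuclideanSpace ℝ (Fin n) → ℂ} (hF : Measurable F) (s : ℝ) :
    Measurable fun p : EuclideanSpace ℝ (Fin n) × ℝ => radialDensity s F p.1 p.2 := by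
  have h1 := measurable_sphereExt_uncurry (X := ℝ)
    (g := fun (r : ℝ) (θ : sphere (0 : EuclideanSpace ℝ (Fin n)) 1) =>
      F (r • (θ : EuclideanSpace ℝ (Fin n)))) (hF.comp (by fun_prop))
  have h2 := h1.comp (by fun_prop : Measurable fun p : EuclideanSpace ℝ (Fin n) × ℝ =>
    (p.2, p.2 • p.1))
  unfold radialDensity
  exact Measurable.mul (by fun_prop) h2

theorem IsAnnular.integrableOn_radialDensity {F : EuclideanSpace ℝ (Fin n) → ℂ}
    (hF : IsAnnular F) (s : ℝ) (x : EuclideanSpace ℝ (Fin n)) :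
    IntegrableOn (radialDensity s F x) (Ioi 0) := by
  obtain ⟨B, hB⟩ := hF.bounded
  obtain ⟨a, b, ha, hab⟩ := hF.annulus
  set S := (2 * Real.pi * a) ^ s + (2 * Real.pi * b) ^ s with hS
  set A := (volume : Measure (EuclideanSpace ℝ (Fin n))).toSphere.real univ with hA
  have hm : Measurable (radialDensity s F x) :=
    (measurable_radialDensity hF.measurable s).comp (by fun_prop : Measurable fun r : ℝ => (x, r))
  have hg : Integrable ((Icc a b).indicator fun _ => b ^ (n - 1) * S * (B * A)) := by
    rw [integrable_indicator_iff measurableSet_Icc]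
    exact integrableOn_const (by simp)
  refine (hg.integrableOn (s := Ioi 0)).mono' hm.aestronglyMeasurable ?_
  filter_upwards [ae_restrict_mem measurableSet_Ioi] with r hr
  have hr0 : (0 : ℝ) < r := hr
  by_cases h : r ∈ Icc a b
  · have hb : 0 < b := hr0.trans_le h.2
    rw [indicator_of_mem h, radialDensity, norm_mul, Complex.norm_real,
      Real.norm_of_nonneg (by positivity)]
    have h2 : 2 * Real.pi * r ≤ 2 * Real.pi * b := by gcongr; exact h.2
    have h1 : 2 * Real.pi * a ≤ 2 * Real.pi * r := by gcongr; exact h.1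
    have h3 := rpow_le_add_of_mem_Icc (by positivity) h1 h2 s
    have h4 := norm_sphereExt_le (fun θ : sphere (0 : EuclideanSpace ℝ (Fin n)) 1 =>
      hB (r • (θ : EuclideanSpace ℝ (Fin n)))) (r • x)
    have hS0 : 0 ≤ S := by positivity
    refine mul_le_mul (mul_le_mul ?_ h3 (by positivity) (by positivity)) h4 (norm_nonneg _)
      (by positivity)
    exact pow_le_pow_left₀ hr0.le h.2 _
  · rw [indicator_of_notMem h]
    have h0 : ∀ θ : sphere (0 : EuclideanSpace ℝ (Fin n)) 1,
        F (r • (θ : EuclideanSpace ℝ (Fin n))) = 0 := by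
      intro θ
      by_contra hne
      have := hab _ hne
      rw [norm_smul, Real.norm_of_nonneg hr0.le, norm_eq_of_mem_sphere, mul_one] at this
      exact h this
    simp [radialDensity, sphereExt, h0]

theorem freqEvol_eq_integral_radialDensity [Nontrivial (EuclideanSpace ℝ (Fin n))]
    {F : EuclideanSpace ℝ (Fin n) → ℂ} (hF : IsAnnular F) (γ s t : ℝ)
    (x : EuclideanSpace ℝ (Fin n)) :
    freqEvol γ s F t x = ∫ r in Ioi (0 : ℝ),
      Complex.exp (-(Complex.I * (t : ℂ) * (((2 * Real.pi * r) ^ γ : ℝ) : ℂ))) *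
        radialDensity s F x r := by
  rw [freqEvol, integral_polar (hF.integrable_mul_char γ s t x)]
  refine setIntegral_congr_fun measurableSet_Ioi fun r hr => ?_
  have hr0 : (0 : ℝ) < r := hr
  have h1 : ∀ θ : sphere (0 : EuclideanSpace ℝ (Fin n)) 1,
      fracSymbol γ s t (r • (θ : EuclideanSpace ℝ (Fin n))) *
        F (r • (θ : EuclideanSpace ℝ (Fin n))) *
        (𝐞 (inner ℝ x (r • (θ : EuclideanSpace ℝ (Fin n)))) : ℂ) =
      (((2 * Real.pi * r) ^ s : ℝ) : ℂ) *
        Complex.exp (-(Complex.I * (t : ℂ) * (((2 * Real.pi * r) ^ γ : ℝ) : ℂ))) *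
        (F (r • (θ : EuclideanSpace ℝ (Fin n))) *
        (𝐞 (inner ℝ (r • x) (θ : EuclideanSpace ℝ (Fin n))) : ℂ)) := by
    intro θ
    rw [fracSymbol, norm_smul, Real.norm_of_nonneg hr0.le, norm_eq_of_mem_sphere, mul_one,
      inner_smul_right, real_inner_smul_left]
    ring
  simp only [h1, integral_const_mul, finrank_euclideanSpace_fin, radialDensity, sphereExt]
  push_cast
  ring

/-- The weighted estimate for data with frequencies in an annulus: by Plancherel's theorem in time
it reduces to the extension estimate on each sphere. -/
theorem exists_weighted_freqEvol_le [Nontrivial (EuclideanSpace ℝ (Fin n))] {δ β γ s : ℝ}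
    (hγ : 0 < γ) (hδ : 0 ≤ δ) (hβ : 1 ≤ β)
    (hκ : β - 1 < ((n - 1 : ℕ) : ℝ) / 2 - δ) (hs : 2 * s = γ - ((n : ℝ) - δ) / β) :
    ∃ C : ℝ≥0, ∀ (M : ℝ), 0 < M → ∀ w : EuclideanSpace ℝ (Fin n) → ℝ≥0∞, Measurable w →
      (∀ (x : EuclideanSpace ℝ (Fin n)) (ρ : ℝ), 0 < ρ →
        ∫⁻ y in ball x ρ, w y ^ β ≤ ENNReal.ofReal (M * ρ ^ δ)) →
      ∀ F : EuclideanSpace ℝ (Fin n) → ℂ, IsAnnular F →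
      ∫⁻ t : ℝ, ∫⁻ x, ‖freqEvol γ s F t x‖ₑ ^ 2 * w x ≤
        C * ENNReal.ofReal (M ^ (1 / β)) * ∫⁻ η, ‖F η‖ₑ ^ 2 := by
  obtain ⟨C, hC⟩ := exists_weighted_sphereExt_smul_le (E := EuclideanSpace ℝ (Fin n)) hδ hβ
    (by rwa [finrank_euclideanSpace_fin])
  simp only [finrank_euclideanSpace_fin] at hC
  have hn : 1 ≤ n := by
    have := Module.finrank_pos (R := ℝ) (M := EuclideanSpace ℝ (Fin n))
    rwa [finrank_euclideanSpace_fin] at this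
  have hpi : 0 < 2 * Real.pi := Real.two_pi_pos
  set D : ℝ := (2 * Real.pi) ^ (2 * s - γ + 1) / γ with hD
  have hD0 : 0 < D := by positivity
  refine ⟨C * Real.toNNReal D, fun M hM w hw hMor F hF => ?_⟩
  obtain ⟨B, hB⟩ := hF.bounded
  set c : ℝ → ℝ := fun r => (γ * (2 * Real.pi * r) ^ (γ - 1))⁻¹ *
    (r ^ (n - 1) * (2 * Real.pi * r) ^ s) ^ 2 with hc
  have hFm := hF.measurable
  have hext : Measurable fun p : EuclideanSpace ℝ (Fin n) × ℝ =>
      sphereExt (fun θ => F (p.2 • (θ : EuclideanSpace ℝ (Fin n)))) (p.2 • p.1) := by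
    have h1 := measurable_sphereExt_uncurry (X := ℝ)
      (g := fun (r : ℝ) (θ : sphere (0 : EuclideanSpace ℝ (Fin n)) 1) =>
        F (r • (θ : EuclideanSpace ℝ (Fin n)))) (hF.measurable.comp (by fun_prop))
    exact h1.comp (by fun_prop : Measurable fun p : EuclideanSpace ℝ (Fin n) × ℝ =>
      (p.2, p.2 • p.1))
  have hpow : ∀ r, 0 < r → c r * (M ^ (1 / β) * r ^ (((n : ℝ) - δ) / β - n)) =
      D * M ^ (1 / β) * r ^ (n - 1) := by
    intro r hr
    have e1 : ((n : ℝ) - δ) / β - n = γ - 2 * s - n := by rw [hs]; ring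
    have e2 : r ^ (n - 1) = r ^ ((n : ℝ) - 1) := by
      rw [← Real.rpow_natCast]; push_cast [hn]; rfl
    have hA : (2 * Real.pi * r) ^ (-(γ - 1)) * (2 * Real.pi * r) ^ (s * (2 : ℕ)) =
        (2 * Real.pi) ^ (2 * s - γ + 1) * r ^ (2 * s - γ + 1) := by
      rw [← Real.rpow_add (by positivity), ← Real.mul_rpow hpi.le hr.le]
      congr 1
      push_cast
      ring
    have hB : r ^ (n - 1) * r ^ (γ - 2 * s - n) = r ^ (γ - 2 * s - 1) := by
      rw [e2, ← Real.rpow_add hr]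
      congr 1
      ring
    simp only [hc, hD]
    rw [e1, mul_pow, ← Real.rpow_natCast (_ ^ s), ← Real.rpow_mul (by positivity), mul_inv,
      ← Real.rpow_neg (by positivity)]
    calc γ⁻¹ * (2 * Real.pi * r) ^ (-(γ - 1)) *
          ((r ^ (n - 1)) ^ 2 * (2 * Real.pi * r) ^ (s * (2 : ℕ))) *
          (M ^ (1 / β) * r ^ (γ - 2 * s - n))
        = γ⁻¹ * M ^ (1 / β) * r ^ (n - 1) * (((2 * Real.pi * r) ^ (-(γ - 1)) *
          (2 * Real.pi * r) ^ (s * (2 : ℕ))) * (r ^ (n - 1) * r ^ (γ - 2 * s - n))) := by ring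
      _ = γ⁻¹ * M ^ (1 / β) * r ^ (n - 1) * ((2 * Real.pi) ^ (2 * s - γ + 1) *
          (r ^ (2 * s - γ + 1) * r ^ (γ - 2 * s - 1))) := by rw [hA, hB]; ring
      _ = _ := by
          rw [← Real.rpow_add hr]
          have : 2 * s - γ + 1 + (γ - 2 * s - 1) = 0 := by ring
          rw [this, Real.rpow_zero]
          ring
  calc ∫⁻ t : ℝ, ∫⁻ x, ‖freqEvol γ s F t x‖ₑ ^ 2 * w x
      = ∫⁻ x, ∫⁻ t : ℝ, ‖freqEvol γ s F t x‖ₑ ^ 2 * w x := by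
        refine lintegral_lintegral_swap (Measurable.aemeasurable ?_)
        exact ((measurable_freqEvol hFm γ s).enorm.pow_const 2).mul (hw.comp measurable_snd)
    _ = ∫⁻ x, (∫⁻ t : ℝ, ‖freqEvol γ s F t x‖ₑ ^ 2) * w x := by
        refine lintegral_congr fun x => lintegral_mul_const _ ?_
        exact ((measurable_freqEvol hFm γ s).comp
          (by fun_prop : Measurable fun t : ℝ => (t, x))).enorm.pow_const 2
    _ ≤ ∫⁻ x, (∫⁻ r in Ioi (0 : ℝ), ENNReal.ofReal (γ * (2 * Real.pi * r) ^ (γ - 1))⁻¹ *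
          ‖radialDensity s F x r‖ₑ ^ 2) * w x := by
        refine lintegral_mono fun x => ?_
        refine mul_le_mul_left ?_ _
        simp only [freqEvol_eq_integral_radialDensity hF]
        exact lintegral_time_sq_le hγ ((measurable_radialDensity hFm s).comp
          (by fun_prop : Measurable fun r : ℝ => (x, r))) (hF.integrableOn_radialDensity s x)
    _ = ∫⁻ x, ∫⁻ r in Ioi (0 : ℝ), ENNReal.ofReal (c r) *
          (‖sphereExt (fun θ => F (r • (θ : EuclideanSpace ℝ (Fin n)))) (r • x)‖ₑ ^ 2 * w x) := by
        refine lintegral_congr fun x => ?_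
        have hmx : Measurable fun r => ENNReal.ofReal (γ * (2 * Real.pi * r) ^ (γ - 1))⁻¹ *
            ‖radialDensity s F x r‖ₑ ^ 2 :=
          Measurable.mul (by fun_prop) (((measurable_radialDensity hFm s).comp
            (by fun_prop : Measurable fun r : ℝ => (x, r))).enorm.pow_const 2)
        rw [← lintegral_mul_const _ hmx]
        refine setLIntegral_congr_fun measurableSet_Ioi fun r hr => ?_
        have hr0 : (0 : ℝ) < r := hr
        simp only [hc]
        rw [radialDensity, enorm_mul, mul_pow, ← ofReal_norm (((_ : ℝ) : ℂ)), Complex.norm_real,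
          Real.norm_of_nonneg (by positivity), ← ENNReal.ofReal_pow (by positivity),
          ENNReal.ofReal_mul (by positivity)]
        ring
    _ = ∫⁻ r in Ioi (0 : ℝ), ∫⁻ x, ENNReal.ofReal (c r) *
          (‖sphereExt (fun θ => F (r • (θ : EuclideanSpace ℝ (Fin n)))) (r • x)‖ₑ ^ 2 * w x) := by
        refine lintegral_lintegral_swap (Measurable.aemeasurable ?_)
        refine Measurable.mul ?_ ((hext.enorm.pow_const 2).mul (hw.comp measurable_fst))
        simp only [hc]; fun_prop
    _ ≤ ∫⁻ r in Ioi (0 : ℝ), (C * ENNReal.ofReal (D * M ^ (1 / β))) *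
          (ENNReal.ofReal (r ^ (n - 1)) * ∫⁻ θ : sphere (0 : EuclideanSpace ℝ (Fin n)) 1,
          ‖F (r • (θ : EuclideanSpace ℝ (Fin n)))‖ₑ ^ 2
          ∂(volume : Measure (EuclideanSpace ℝ (Fin n))).toSphere) := by
        refine setLIntegral_mono' measurableSet_Ioi fun r hr => ?_
        have hr0 : (0 : ℝ) < r := hr
        have hmr : Measurable fun x => ‖sphereExt (fun θ => F (r •
            (θ : EuclideanSpace ℝ (Fin n)))) (r • x)‖ₑ ^ 2 * w x :=
          ((hext.comp (by fun_prop : Measurable fun x => (x, r))).enorm.pow_const 2).mul hw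
        rw [lintegral_const_mul _ hmr]
        refine (mul_le_mul_right (hC M hM w hw hMor
          (fun θ => F (r • (θ : EuclideanSpace ℝ (Fin n)))) (hFm.comp (by fun_prop))
          ⟨B, fun θ => hB _⟩ r hr0) _).trans (le_of_eq ?_)
        have hc0 : 0 ≤ c r := by positivity
        have h5 := congrArg ENNReal.ofReal (hpow r hr0)
        rw [ENNReal.ofReal_mul hc0, ENNReal.ofReal_mul (p := D * M ^ (1 / β)) (by positivity)] at h5
        rw [← mul_assoc, mul_left_comm _ (C : ℝ≥0∞), h5]
        ring
    _ = (C * ENNReal.ofReal (D * M ^ (1 / β))) * ∫⁻ η, ‖F η‖ₑ ^ 2 := by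
        rw [lintegral_polar (hFm.enorm.pow_const 2), finrank_euclideanSpace_fin,
          lintegral_const_mul']
        exact ENNReal.mul_ne_top ENNReal.coe_ne_top ENNReal.ofReal_ne_top
    _ = _ := by
        rw [ENNReal.ofReal_mul hD0.le, ENNReal.coe_mul, ENNReal.ofReal]
        ring

end Annular

/-! ### From the Kerman-Sawyer norm to a Morrey condition -/

section KermanSawyer

variable {n : ℕ}

theorem dist_le_of_mem_dyadicCube {k : ℤ} {m : Fin n → ℤ} {x y : EuclideanSpace ℝ (Fin n)}
    (hx : x ∈ dyadicCube k m) (hy : y ∈ dyadicCube k m) : dist x y ≤ n * 2 ^ k := by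
  have h2k : (0 : ℝ) < 2 ^ k := by positivity
  have hi : ∀ i, dist (x i) (y i) ^ 2 ≤ (2 ^ k) ^ 2 := by
    intro i
    have h1 := hx i
    have h2 := hy i
    rw [mul_add, mul_one] at h1 h2
    refine pow_le_pow_left₀ dist_nonneg ?_ 2
    rw [Real.dist_eq, abs_le]
    constructor <;> linarith [h1.1, h1.2, h2.1, h2.2]
  rw [EuclideanSpace.dist_eq]
  refine Real.sqrt_le_iff.2 ⟨by positivity, (Finset.sum_le_sum fun i _ => hi i).trans ?_⟩
  rw [Finset.sum_const, Finset.card_univ, Fintype.card_fin, nsmul_eq_mul, mul_pow]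
  gcongr
  rcases Nat.eq_zero_or_pos n with h | h
  · simp [h]
  · exact le_self_pow₀ (by exact_mod_cast h) two_ne_zero

/-- Restricting the kernel to a single cube, the Kerman-Sawyer norm controls the mass of the
cube. -/
theorem lintegral_dyadicCube_le [NeZero n] {α : ℝ} (hα : α ≤ n)
    {v : EuclideanSpace ℝ (Fin n) → ℝ≥0∞} (hv : LocallyIntegrable v volume) (k : ℤ)
    (m : Fin n → ℤ) :
    ∫⁻ x in dyadicCube k m, v x ≤
      ksNorm α v * ENNReal.ofReal ((n * 2 ^ k) ^ ((n : ℝ) - α)) := by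
  set V := ∫⁻ x in dyadicCube k m, v x with hV
  have hn : (0 : ℝ) < n := by exact_mod_cast Nat.pos_of_ne_zero (NeZero.ne n)
  set D : ℝ := n * 2 ^ k with hD
  have hD0 : 0 < D := by positivity
  rcases eq_or_ne V 0 with h0 | h0
  · rw [h0]; exact zero_le
  have hne : (dyadicCube k m).Nonempty := by
    rw [nonempty_iff_ne_empty]
    intro h
    rw [hV, h] at h0
    simp at h0
  obtain ⟨x₀, hx₀⟩ := hne
  have hVtop : V ≠ ⊤ := by
    have h1 := (hv.integrableOn_isCompact (isCompact_closedBall x₀ D)).2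
    rw [HasFiniteIntegral] at h1
    refine ne_of_lt (lt_of_le_of_lt (lintegral_mono_set fun x hx => ?_) h1)
    exact dist_le_of_mem_dyadicCube hx hx₀
  set c : ℝ≥0∞ := (ENNReal.ofReal D ^ ((n : ℝ) - α))⁻¹ with hc
  have hDp : ENNReal.ofReal D ^ ((n : ℝ) - α) = ENNReal.ofReal (D ^ ((n : ℝ) - α)) :=
    ENNReal.ofReal_rpow_of_pos hD0
  have hDne : ENNReal.ofReal (D ^ ((n : ℝ) - α)) ≠ 0 :=
    (ENNReal.ofReal_pos.2 (by positivity)).ne'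
  have hlow : V * V * c ≤ ∫⁻ x in dyadicCube k m, ∫⁻ y in dyadicCube k m,
      v x * v y / edist x y ^ ((n : ℝ) - α) := by
    calc V * V * c = (c * V) * ∫⁻ x in dyadicCube k m, v x := by rw [← hV]; ring
      _ ≤ ∫⁻ x in dyadicCube k m, (c * V) * v x := lintegral_const_mul_le _ _
      _ ≤ ∫⁻ x in dyadicCube k m, ∫⁻ y in dyadicCube k m, (c * v x) * v y := by
          refine lintegral_mono fun x => ?_
          calc c * V * v x = (c * v x) * ∫⁻ y in dyadicCube k m, v y := by rw [← hV]; ring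
            _ ≤ _ := lintegral_const_mul_le _ _
      _ ≤ _ := by
          have hms : MeasurableSet (dyadicCube k m) := by
            have : dyadicCube k m = ⋂ i, {x : EuclideanSpace ℝ (Fin n) |
                (2 : ℝ) ^ k * (m i : ℝ) ≤ x i ∧ x i < (2 : ℝ) ^ k * ((m i : ℝ) + 1)} := by
              ext x; simp [dyadicCube]
            rw [this]
            refine MeasurableSet.iInter fun i => ?_
            have hmi : Measurable fun x : EuclideanSpace ℝ (Fin n) => x i := by fun_prop
            exact (measurableSet_le measurable_const hmi).inter
              (measurableSet_lt hmi measurable_const)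
          refine setLIntegral_mono' hms fun x hx => setLIntegral_mono' hms fun y hy => ?_
          rw [div_eq_mul_inv, mul_assoc, mul_comm c]
          gcongr
          rw [hc]
          gcongr
          rw [edist_dist]
          exact ENNReal.ofReal_le_ofReal (dist_le_of_mem_dyadicCube hx hy)
  have hks : V⁻¹ * (V * V * c) ≤ ksNorm α v := by
    refine le_trans ?_ (le_iSup₂ (f := fun (k : ℤ) (m : Fin n → ℤ) =>
      (∫⁻ x in dyadicCube k m, v x)⁻¹ * ∫⁻ x in dyadicCube k m, ∫⁻ y in dyadicCube k m,
        v x * v y / edist x y ^ ((n : ℝ) - α)) k m)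
    gcongr
  have hVc : V⁻¹ * (V * V * c) = V * c := by
    rw [mul_assoc V V c, ← mul_assoc, ENNReal.inv_mul_cancel h0 hVtop, one_mul]
  rw [hVc] at hks
  calc V = V * c * ENNReal.ofReal (D ^ ((n : ℝ) - α)) := by
        rw [hc, hDp, mul_assoc, ENNReal.inv_mul_cancel hDne ENNReal.ofReal_ne_top, mul_one]
    _ ≤ _ := by gcongr

/-- A weight with finite Kerman-Sawyer norm satisfies a Morrey condition on balls. -/
theorem exists_lintegral_ball_le_ksNorm [NeZero n] {α : ℝ} (hα : α ≤ n) :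
    ∃ K : ℝ, 0 < K ∧ ∀ v : EuclideanSpace ℝ (Fin n) → ℝ≥0∞, LocallyIntegrable v volume →
      ∀ (x : EuclideanSpace ℝ (Fin n)) (ρ : ℝ), 0 < ρ →
      ∫⁻ y in ball x ρ, v y ≤ ksNorm α v * ENNReal.ofReal (K * ρ ^ ((n : ℝ) - α)) := by
  have hn : (0 : ℝ) < n := by exact_mod_cast Nat.pos_of_ne_zero (NeZero.ne n)
  refine ⟨2 ^ n * (n * 4) ^ ((n : ℝ) - α), by positivity, fun v hv x ρ hρ => ?_⟩
  obtain ⟨j, hj1, hj2⟩ := exists_mem_Ico_zpow (x := 2 * ρ) (y := (2 : ℝ)) (by positivity)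
    one_lt_two
  set k : ℤ := j + 1 with hk
  have hk0 : (0 : ℝ) < 2 ^ k := by positivity
  have hk4 : (2 : ℝ) ^ k ≤ 4 * ρ := by
    rw [hk, zpow_add_one₀ (by norm_num)]; linarith
  set m₀ : Fin n → ℤ := fun i => ⌊(x i - ρ) / 2 ^ k⌋ with hm₀
  set T : Finset (Fin n → ℤ) := Fintype.piFinset fun i => Finset.Icc (m₀ i) (m₀ i + 1) with hT
  have hcard : T.card = 2 ^ n := by
    rw [hT, Fintype.card_piFinset]
    have h2 : ∀ i, (Finset.Icc (m₀ i) (m₀ i + 1)).card = 2 := fun i => by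
      rw [Int.card_Icc]; omega
    simp only [h2, Finset.prod_const, Finset.card_univ, Fintype.card_fin]
  have hcover : ball x ρ ⊆ ⋃ m : T, dyadicCube k (m : Fin n → ℤ) := by
    intro y hy
    have hyi : ∀ i, |y i - x i| < ρ := by
      intro i
      have h1 : dist (y i) (x i) ≤ dist y x := by
        rw [EuclideanSpace.dist_eq]
        exact Real.le_sqrt_of_sq_le (Finset.single_le_sum (f := fun i => dist (y i) (x i) ^ 2)
          (fun i _ => sq_nonneg _) (Finset.mem_univ i))
      rw [Real.dist_eq] at h1
      exact h1.trans_lt hy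
    refine mem_iUnion.2 ⟨⟨fun i => ⌊y i / 2 ^ k⌋, ?_⟩, ?_⟩
    · rw [hT, Fintype.mem_piFinset]
      intro i
      have h1 := abs_lt.1 (hyi i)
      rw [Finset.mem_Icc]
      constructor
      · exact Int.floor_le_floor (div_le_div_of_nonneg_right (by linarith) hk0.le)
      · rw [← Int.lt_add_one_iff, Int.floor_lt]
        have h2 : (x i - ρ) / 2 ^ k < m₀ i + 1 := Int.lt_floor_add_one _
        push_cast
        rw [div_lt_iff₀ hk0] at h2 ⊢
        nlinarith
    · intro i
      have h1 := Int.floor_le (y i / 2 ^ k)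
      have h2 := Int.lt_floor_add_one (y i / 2 ^ k)
      rw [le_div_iff₀ hk0] at h1
      rw [div_lt_iff₀ hk0] at h2
      constructor <;> dsimp only <;> linarith
  calc ∫⁻ y in ball x ρ, v y ≤ ∫⁻ y in ⋃ m : T, dyadicCube k (m : Fin n → ℤ), v y :=
        lintegral_mono_set hcover
    _ ≤ ∑' m : T, ∫⁻ y in dyadicCube k (m : Fin n → ℤ), v y := lintegral_iUnion_le _ _
    _ ≤ ∑' m : T, ksNorm α v * ENNReal.ofReal ((n * 2 ^ k) ^ ((n : ℝ) - α)) :=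
        ENNReal.tsum_le_tsum fun m => lintegral_dyadicCube_le hα hv k m
    _ = 2 ^ n * (ksNorm α v * ENNReal.ofReal ((n * 2 ^ k) ^ ((n : ℝ) - α))) := by
        rw [tsum_fintype, Finset.sum_const, Finset.card_univ, Fintype.card_coe, hcard,
          nsmul_eq_mul]
        push_cast; rfl
    _ ≤ 2 ^ n * (ksNorm α v * ENNReal.ofReal ((n * (4 * ρ)) ^ ((n : ℝ) - α))) := by
        have h0 : 0 ≤ (n : ℝ) - α := by linarith
        gcongr
    _ = _ := by
        rw [mul_left_comm, ← mul_assoc (n : ℝ), Real.mul_rpow (by positivity) hρ.le,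
          mul_assoc ((2 : ℝ) ^ n), ENNReal.ofReal_mul (p := (2 : ℝ) ^ n) (by positivity),
          ENNReal.ofReal_pow (by norm_num)]
        simp

end KermanSawyer

/-! ### Pairing with test functions -/

section Pairing

variable {n : ℕ}

/-- If `p > -1`, the function `r ^ p (1 + r) ^ (-N)` is integrable on the half line for large
`N`. -/
theorem lintegral_rpow_mul_inv_pow_lt_top {p : ℝ} (hp : -1 < p) {N : ℕ} (hN : p + 1 < N) :
    ∫⁻ r in Ioi (0 : ℝ), ENNReal.ofReal (r ^ p * ((1 + r) ^ N)⁻¹) < ⊤ := by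
  have h1 : IntegrableOn (fun r : ℝ => r ^ p) (Ioc 0 1) :=
    (intervalIntegrable_iff_integrableOn_Ioc_of_le zero_le_one).1
      (intervalIntegral.intervalIntegrable_rpow' hp)
  have h2 : IntegrableOn (fun r : ℝ => r ^ (p - N)) (Ioi 1) :=
    integrableOn_Ioi_rpow_of_lt (by linarith) one_pos
  rw [← Ioc_union_Ioi_eq_Ioi (zero_le_one (α := ℝ))]
  refine (lintegral_union_le _ _ _).trans_lt (ENNReal.add_lt_top.2 ⟨?_, ?_⟩)
  · refine lt_of_le_of_lt (setLIntegral_mono' measurableSet_Ioc fun r hr => ?_)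
      h1.lintegral_lt_top
    apply ENNReal.ofReal_le_ofReal
    refine mul_le_of_le_one_right (Real.rpow_nonneg hr.1.le _) (inv_le_one_of_one_le₀ ?_)
    exact one_le_pow₀ (by linarith [hr.1])
  · refine lt_of_le_of_lt (setLIntegral_mono' measurableSet_Ioi fun r hr => ?_)
      h2.lintegral_lt_top
    apply ENNReal.ofReal_le_ofReal
    have hr0 : (0 : ℝ) < r := one_pos.trans hr
    rw [Real.rpow_sub hr0, Real.rpow_natCast, div_eq_mul_inv]
    gcongr
    linarith

/-- The symbol times a rapidly decreasing function is square integrable. -/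
theorem lintegral_fracSymbol_mul_sq_lt_top [Nontrivial (EuclideanSpace ℝ (Fin n))] {γ s t : ℝ}
    (hs : -(n : ℝ) < 2 * s) (Ψ : SchwartzMap (EuclideanSpace ℝ (Fin n)) ℂ) :
    ∫⁻ η, ‖fracSymbol γ s t η * Ψ η‖ₑ ^ 2 < ⊤ := by
  have hn : 1 ≤ n := by
    have := Module.finrank_pos (R := ℝ) (M := EuclideanSpace ℝ (Fin n))
    rwa [finrank_euclideanSpace_fin] at this
  have hpi : 0 < 2 * Real.pi := Real.two_pi_pos
  set p : ℝ := (n : ℝ) - 1 + 2 * s with hp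
  obtain ⟨N, hN⟩ := exists_nat_gt (p + 1)
  obtain ⟨A, hA⟩ : ∃ A : ℝ, ∀ η, (1 + ‖η‖) ^ N * ‖Ψ η‖ ≤ A := by
    have h := SchwartzMap.one_add_le_sup_seminorm_apply (𝕜 := ℝ) (m := (N, 0)) (k := N) (n := 0)
      le_rfl le_rfl Ψ
    simp only [norm_iteratedFDeriv_zero] at h
    exact ⟨_, h⟩
  have hA0 : 0 ≤ A := le_trans (by positivity) (hA 0)
  have hpt : ∀ η, ‖fracSymbol γ s t η * Ψ η‖ₑ ^ 2 ≤
      ENNReal.ofReal ((2 * Real.pi * ‖η‖) ^ (2 * s) * (A ^ 2 * ((1 + ‖η‖) ^ N)⁻¹)) := by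
    intro η
    have h0 : 0 < (1 + ‖η‖) ^ N := by positivity
    have h1 : ‖Ψ η‖ ≤ A * ((1 + ‖η‖) ^ N)⁻¹ := by
      rw [← div_eq_mul_inv, le_div_iff₀ h0, mul_comm]; exact hA η
    rw [← ofReal_norm, ← ENNReal.ofReal_pow (norm_nonneg _), norm_mul, norm_fracSymbol, mul_pow]
    apply ENNReal.ofReal_le_ofReal
    have h2 : ((2 * Real.pi * ‖η‖) ^ s) ^ 2 = (2 * Real.pi * ‖η‖) ^ (2 * s) := by
      rw [← Real.rpow_natCast, ← Real.rpow_mul (by positivity)]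
      congr 1; push_cast; ring
    rw [h2]
    gcongr
    have h3 : ((1 + ‖η‖) ^ N)⁻¹ ≤ 1 :=
      inv_le_one_of_one_le₀ (one_le_pow₀ (by linarith [norm_nonneg η]))
    calc ‖Ψ η‖ ^ 2 ≤ (A * ((1 + ‖η‖) ^ N)⁻¹) ^ 2 := by gcongr
      _ = A ^ 2 * (((1 + ‖η‖) ^ N)⁻¹ * ((1 + ‖η‖) ^ N)⁻¹) := by ring
      _ ≤ A ^ 2 * (((1 + ‖η‖) ^ N)⁻¹ * 1) := by gcongr
      _ = _ := by rw [mul_one]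
  refine (lintegral_mono hpt).trans_lt ?_
  rw [lintegral_polar (by fun_prop), finrank_euclideanSpace_fin]
  set σ := (volume : Measure (EuclideanSpace ℝ (Fin n))).toSphere with hσ
  have hI := lintegral_rpow_mul_inv_pow_lt_top (p := p) (by rw [hp]; linarith) hN
  have heq : ∀ r ∈ Ioi (0 : ℝ), ENNReal.ofReal (r ^ (n - 1)) * ∫⁻ θ : sphere
      (0 : EuclideanSpace ℝ (Fin n)) 1, ENNReal.ofReal ((2 * Real.pi *
        ‖r • (θ : EuclideanSpace ℝ (Fin n))‖) ^ (2 * s) * (A ^ 2 *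
          ((1 + ‖r • (θ : EuclideanSpace ℝ (Fin n))‖) ^ N)⁻¹)) ∂σ =
      (ENNReal.ofReal ((2 * Real.pi) ^ (2 * s) * A ^ 2) * σ univ) *
        ENNReal.ofReal (r ^ p * ((1 + r) ^ N)⁻¹) := by
    intro r hr
    have hr0 : (0 : ℝ) < r := hr
    have hnorm : ∀ θ : sphere (0 : EuclideanSpace ℝ (Fin n)) 1,
        ‖r • (θ : EuclideanSpace ℝ (Fin n))‖ = r := fun θ => by
      rw [norm_smul, Real.norm_of_nonneg hr0.le, norm_eq_of_mem_sphere, mul_one]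
    simp only [hnorm]
    rw [lintegral_const, ← mul_assoc, ← ENNReal.ofReal_mul (by positivity),
      mul_right_comm (ENNReal.ofReal ((2 * Real.pi) ^ (2 * s) * A ^ 2)) (σ univ),
      ← ENNReal.ofReal_mul (by positivity)]
    congr 2
    have e2 : r ^ (n - 1) = r ^ ((n : ℝ) - 1) := by
      rw [← Real.rpow_natCast]; push_cast [hn]; rfl
    rw [Real.mul_rpow hpi.le hr0.le, e2, hp, Real.rpow_add hr0]
    ring
  rw [setLIntegral_congr_fun measurableSet_Ioi heq, lintegral_const_mul']
  · exact ENNReal.mul_lt_top (ENNReal.mul_lt_top ENNReal.ofReal_lt_top (measure_lt_top _ _)) hI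
  · exact ENNReal.mul_ne_top ENNReal.ofReal_ne_top (measure_ne_top _ _)

/-- The pairing of `freqEvol` with a test function. -/
theorem IsAnnular.integral_freqEvol_mul {F : EuclideanSpace ℝ (Fin n) → ℂ} (hF : IsAnnular F)
    (γ s t : ℝ) {φ : EuclideanSpace ℝ (Fin n) → ℂ} (hφ : Integrable φ) :
    ∫ x, freqEvol γ s F t x * φ x = ∫ η, fracSymbol γ s t η * F η * (𝓕⁻ φ) η := by
  have hint : Integrable (Function.uncurry fun (x η : EuclideanSpace ℝ (Fin n)) =>
      φ x * (fracSymbol γ s t η * F η * (𝐞 (inner ℝ x η) : ℂ))) (volume.prod volume) := by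
    have h1 := (hφ.mul_prod (hF.integrable γ s t)).mul_bdd (c := 1)
      (g := fun q : EuclideanSpace ℝ (Fin n) × EuclideanSpace ℝ (Fin n) =>
        (𝐞 (inner ℝ q.1 q.2) : ℂ))
      (measurable_fourierChar_comp (by fun_prop)).aestronglyMeasurable
      (Eventually.of_forall fun q => (Circle.norm_coe _).le)
    refine h1.congr (Eventually.of_forall fun q => ?_)
    simp only [Function.uncurry, mul_assoc]
  have hswap := integral_integral_swap hint
  simp only [integral_const_mul] at hswap
  calc ∫ x, freqEvol γ s F t x * φ x
      = ∫ x, φ x * ∫ η, fracSymbol γ s t η * F η * (𝐞 (inner ℝ x η) : ℂ) :=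
        integral_congr_ae (Eventually.of_forall fun x => mul_comm _ _)
    _ = ∫ η, ∫ x, φ x * (fracSymbol γ s t η * F η * (𝐞 (inner ℝ x η) : ℂ)) := hswap
    _ = _ := by
        refine integral_congr_ae (Eventually.of_forall fun η => ?_)
        simp only [Real.fourierInv_eq, ← integral_const_mul]
        refine integral_congr_ae (Eventually.of_forall fun x => ?_)
        simp only [Circle.smul_def, smul_eq_mul]
        ring

/-- The Cauchy-Schwarz inequality. -/
theorem lintegral_enorm_mul_le {X : Type*} [MeasurableSpace X] {μ : Measure X} {f g : X → ℂ}
    (hf : AEMeasurable f μ) (hg : AEMeasurable g μ) :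
    ∫⁻ x, ‖f x‖ₑ * ‖g x‖ₑ ∂μ ≤
      (∫⁻ x, ‖f x‖ₑ ^ 2 ∂μ) ^ (1 / 2 : ℝ) * (∫⁻ x, ‖g x‖ₑ ^ 2 ∂μ) ^ (1 / 2 : ℝ) := by
  have h := ENNReal.lintegral_mul_le_Lp_mul_Lq μ Real.HolderConjugate.two_two
    (f := fun x => ‖f x‖ₑ) (g := fun x => ‖g x‖ₑ) hf.enorm hg.enorm
  simpa only [ENNReal.rpow_two, Pi.mul_apply] using h

end Pairing

/-! ### Limits in weighted `L²` spaces -/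

section Limits

variable {X : Type*} [MeasurableSpace X] {μ : Measure X}

/-- A sequence which is Cauchy at a summable rate in a weighted `L²` space with positive finite
weight converges almost everywhere. -/
theorem exists_measurable_ae_tendsto_of_cauchy {U : ℕ → X → ℂ} (hU : ∀ k, Measurable (U k))
    {w : X → ℝ≥0∞} (hw : Measurable w) (hw0 : ∀ x, w x ≠ 0) (hwt : ∀ x, w x ≠ ⊤)
    {b : ℕ → ℝ≥0∞} (hb : ∑' k, b k ≠ ⊤)
    (hc : ∀ N k m, N ≤ k → N ≤ m → ∫⁻ x, ‖U k x - U m x‖ₑ ^ 2 * w x ∂μ < b N ^ 2) :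
    ∃ u : X → ℂ, Measurable u ∧ ∀ᵐ x ∂μ, Tendsto (fun k => U k x) atTop (𝓝 (u x)) := by
  set r : X → ℂ := fun x => ((Real.sqrt (w x).toReal : ℝ) : ℂ) with hr
  have hrm : Measurable r := by fun_prop
  have hr0 : ∀ x, r x ≠ 0 := fun x => by
    have : 0 < (w x).toReal := ENNReal.toReal_pos (hw0 x) (hwt x)
    simp only [hr]
    exact_mod_cast (Real.sqrt_pos.2 this).ne'
  have hr2 : ∀ x, ‖r x‖ₑ ^ 2 = w x := fun x => by
    rw [← ofReal_norm, ← ENNReal.ofReal_pow (norm_nonneg _), hr, Complex.norm_real,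
      Real.norm_of_nonneg (Real.sqrt_nonneg _), Real.sq_sqrt ENNReal.toReal_nonneg,
      ENNReal.ofReal_toReal (hwt x)]
  have hcau : ∀ N k m : ℕ, N ≤ k → N ≤ m →
      eLpNorm ((fun x => U k x * r x) - fun x => U m x * r x) 2 μ < b N := by
    intro N k m hk hm
    by_contra! hle
    refine (hc N k m hk hm).not_ge ((pow_le_pow_left' hle 2).trans_eq ?_)
    have h2 := eLpNorm_nnreal_pow_eq_lintegral (μ := μ) (p := 2)
      (f := (fun x => U k x * r x) - fun x => U m x * r x) (by norm_num)
    have e2 : ((2 : ℝ≥0) : ℝ) = 2 := rfl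
    simp only [e2, ENNReal.rpow_two] at h2
    refine (Eq.trans h2 (lintegral_congr fun x => ?_))
    rw [Pi.sub_apply, ← sub_mul, enorm_mul, mul_pow, hr2]
  have hV : ∀ k, Measurable fun x => U k x * r x := fun k => (hU k).mul hrm
  have hae := Lp.ae_tendsto_of_cauchy_eLpNorm (fun k => (hV k).aestronglyMeasurable)
    one_le_two hb hcau
  obtain ⟨v, hv, hlim⟩ := exists_stronglyMeasurable_limit_of_tendsto_ae
    (fun k => (hV k).aestronglyMeasurable) hae
  refine ⟨fun x => v x / r x, hv.measurable.div hrm, ?_⟩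
  filter_upwards [hlim] with x hx
  refine (hx.div_const (r x)).congr fun k => ?_
  rw [mul_div_cancel_right₀ _ (hr0 x)]

/-- Fatou's lemma for weighted `L²` norms; the weight may be infinite. -/
theorem lintegral_sq_mul_le_of_tendsto {U : ℕ → X → ℂ} (hU : ∀ k, Measurable (U k)) {u : X → ℂ}
    {w : X → ℝ≥0∞} (hw : Measurable w) {c : ℝ≥0∞}
    (hlim : ∀ᵐ x ∂μ, Tendsto (fun k => U k x) atTop (𝓝 (u x)))
    (hc : ∀ᶠ k in atTop, ∫⁻ x, ‖U k x‖ₑ ^ 2 * w x ∂μ ≤ c) :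
    ∫⁻ x, ‖u x‖ₑ ^ 2 * w x ∂μ ≤ c := by
  calc ∫⁻ x, ‖u x‖ₑ ^ 2 * w x ∂μ
      ≤ ∫⁻ x, liminf (fun k => ‖U k x‖ₑ ^ 2 * w x) atTop ∂μ := by
        refine lintegral_mono_ae (hlim.mono fun x hx => ?_)
        rcases eq_or_ne (u x) 0 with h0 | h0
        · simp [h0]
        · refine (Tendsto.liminf_eq ?_).ge
          refine ENNReal.Tendsto.mul_const ((ENNReal.continuous_pow 2).continuousAt.tendsto.comp
            hx.enorm) (Or.inl (by simpa using h0))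
    _ ≤ liminf (fun k => ∫⁻ x, ‖U k x‖ₑ ^ 2 * w x ∂μ) atTop :=
        lintegral_liminf_le fun k => ((hU k).enorm.pow_const 2).mul hw
    _ ≤ c := liminf_le_of_frequently_le' hc.frequently

theorem enorm_sub_sq_le (a b : ℂ) : ‖a - b‖ₑ ^ 2 ≤ 2 * ‖a‖ₑ ^ 2 + 2 * ‖b‖ₑ ^ 2 := by
  have h : ‖a - b‖ ^ 2 ≤ 2 * ‖a‖ ^ 2 + 2 * ‖b‖ ^ 2 := by
    have h1 := norm_sub_le a b
    have h2 : ‖a - b‖ ^ 2 ≤ (‖a‖ + ‖b‖) ^ 2 := by gcongr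
    nlinarith [sq_nonneg (‖a‖ - ‖b‖)]
  simp only [← ofReal_norm]
  have e : (2 : ℝ≥0∞) = ENNReal.ofReal 2 := by simp
  rw [e, ← ENNReal.ofReal_pow (norm_nonneg _), ← ENNReal.ofReal_pow (norm_nonneg _),
    ← ENNReal.ofReal_pow (norm_nonneg _), ← ENNReal.ofReal_mul (by norm_num),
    ← ENNReal.ofReal_mul (by norm_num), ← ENNReal.ofReal_add (by positivity) (by positivity)]
  exact ENNReal.ofReal_le_ofReal h

end Limits

/-! ### Approximation by frequency-localized data -/

section Approximation

variable {n : ℕ}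

/-- Bounded functions supported in annuli are dense in `L²`. -/
theorem exists_isAnnular_approx [Nontrivial (EuclideanSpace ℝ (Fin n))]
    {F : EuclideanSpace ℝ (Fin n) → ℂ} (hF : Measurable F) (hF2 : ∫⁻ η, ‖F η‖ₑ ^ 2 ≠ ⊤)
    {ε : ℝ≥0∞} (hε : 0 < ε) :
    ∃ G, IsAnnular G ∧ (∀ η, ‖G η‖ₑ ≤ ‖F η‖ₑ) ∧ ∫⁻ η, ‖G η - F η‖ₑ ^ 2 < ε := by
  set S : ℕ → Set (EuclideanSpace ℝ (Fin n)) := fun k =>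
    {η | 1 / ((k : ℝ) + 1) ≤ ‖η‖} ∩ ({η | ‖η‖ ≤ k} ∩ {η | ‖F η‖ ≤ k}) with hS
  have hSm : ∀ k, MeasurableSet (S k) := fun k =>
    (measurableSet_le measurable_const measurable_norm).inter
      ((measurableSet_le measurable_norm measurable_const).inter
        (measurableSet_le hF.norm measurable_const))
  set G : ℕ → EuclideanSpace ℝ (Fin n) → ℂ := fun k => (S k).indicator F with hG
  have hle : ∀ k η, ‖G k η‖ₑ ≤ ‖F η‖ₑ := fun k η => enorm_indicator_le_enorm_self _ _
  have hGm : ∀ k, Measurable (G k) := fun k => hF.indicator (hSm k)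
  have hann : ∀ k, IsAnnular (G k) := by
    refine fun k => ⟨hGm k, ⟨k, fun η => ?_⟩, 1 / ((k : ℝ) + 1), k, by positivity, fun η hη => ?_⟩
    · by_cases h : η ∈ S k
      · simp only [hG, indicator_of_mem h]; exact h.2.2
      · simp [hG, indicator_of_notMem h]
    · have h : η ∈ S k := mem_of_indicator_ne_zero hη
      exact ⟨h.1, h.2.1⟩
  have hlim : Tendsto (fun k => ∫⁻ η, ‖G k η - F η‖ₑ ^ 2) atTop (𝓝 (∫⁻ _ : EuclideanSpace ℝ (Fin n), 0)) := by
    refine tendsto_lintegral_of_dominated_convergence (fun η => ‖F η‖ₑ ^ 2)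
      (fun k => ((hGm k).sub hF).enorm.pow_const 2) (fun k => Eventually.of_forall fun η => ?_)
      hF2 ?_
    · by_cases h : η ∈ S k
      · simp [hG, indicator_of_mem h]
      · simp [hG, indicator_of_notMem h]
    · have h0 : ∀ᵐ η : EuclideanSpace ℝ (Fin n), η ≠ 0 := by simp [ae_iff]
      filter_upwards [h0] with η hη
      have hη0 : 0 < ‖η‖ := norm_pos_iff.2 hη
      refine tendsto_const_nhds.congr' ?_
      have h1 : ∀ᶠ k : ℕ in atTop, 1 / ((k : ℝ) + 1) < ‖η‖ :=
        tendsto_one_div_add_atTop_nhds_zero_nat.eventually_lt_const hη0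
      have h2 : ∀ᶠ k : ℕ in atTop, ‖η‖ ≤ k := tendsto_natCast_atTop_atTop.eventually_ge_atTop _
      have h3 : ∀ᶠ k : ℕ in atTop, ‖F η‖ ≤ k := tendsto_natCast_atTop_atTop.eventually_ge_atTop _
      filter_upwards [h1, h2, h3] with k k1 k2 k3
      have : η ∈ S k := ⟨k1.le, k2, k3⟩
      simp [hG, indicator_of_mem this]
  rw [lintegral_zero] at hlim
  obtain ⟨k, hk⟩ := (hlim.eventually_lt_const hε).exists
  exact ⟨G k, hann k, hle k, hk⟩

/-- An integrable positive weight, used to construct the propagation for every `f`. -/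
def decayWeight (x : EuclideanSpace ℝ (Fin n)) : ℝ≥0∞ :=
  ENNReal.ofReal ((1 + ‖x‖) ^ (-((n : ℝ) + 1)))

theorem measurable_decayWeight : Measurable (decayWeight (n := n)) := by
  unfold decayWeight
  fun_prop

theorem decayWeight_ne_zero (x : EuclideanSpace ℝ (Fin n)) : decayWeight x ≠ 0 :=
  (ENNReal.ofReal_pos.2 (by positivity)).ne'

theorem decayWeight_le_one (x : EuclideanSpace ℝ (Fin n)) : decayWeight x ≤ 1 := by
  rw [decayWeight, ENNReal.ofReal_le_one]
  exact Real.rpow_le_one_of_one_le_of_nonpos (by linarith [norm_nonneg x]) (by linarith)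

/-- The weight `decayWeight` satisfies every Morrey condition in the relevant range: small balls are
controlled by its boundedness, large ones by its integrability. -/
theorem exists_morrey_decayWeight {δ β : ℝ} (hδ : 0 ≤ δ) (hδn : δ ≤ n) (hβ : 1 ≤ β) :
    ∃ M : ℝ, 0 < M ∧ ∀ (x : EuclideanSpace ℝ (Fin n)) (ρ : ℝ), 0 < ρ →
      ∫⁻ y in ball x ρ, decayWeight y ^ β ≤ ENNReal.ofReal (M * ρ ^ δ) := by
  have hI : ∫⁻ y : EuclideanSpace ℝ (Fin n), decayWeight y < ⊤ := by
    refine (integrable_one_add_norm (μ := volume) (E := EuclideanSpace ℝ (Fin n))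
      (r := (n : ℝ) + 1) ?_).lintegral_lt_top
    rw [finrank_euclideanSpace_fin]; linarith
  set I := (∫⁻ y : EuclideanSpace ℝ (Fin n), decayWeight y).toReal with hIdef
  set V := (volume (ball (0 : EuclideanSpace ℝ (Fin n)) 1)).toReal with hV
  have hI0 : 0 ≤ I := ENNReal.toReal_nonneg
  have hV0 : 0 ≤ V := ENNReal.toReal_nonneg
  refine ⟨I + V + 1, by positivity, fun x ρ hρ => ?_⟩
  have hρδ : 0 < ρ ^ δ := by positivity
  rcases le_total ρ 1 with h | h
  · calc ∫⁻ y in ball x ρ, decayWeight y ^ β ≤ ∫⁻ y in ball x ρ, 1 :=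
          lintegral_mono fun y => ENNReal.rpow_le_one (decayWeight_le_one y) (by linarith)
      _ = ENNReal.ofReal (ρ ^ n * V) := by
          rw [setLIntegral_one, Measure.addHaar_ball_of_pos _ _ hρ, finrank_euclideanSpace_fin,
            ENNReal.ofReal_mul (by positivity), hV, ENNReal.ofReal_toReal measure_ball_lt_top.ne]
      _ ≤ _ := by
          apply ENNReal.ofReal_le_ofReal
          have h1 : ρ ^ n ≤ ρ ^ δ := by
            rw [← Real.rpow_natCast]
            exact Real.rpow_le_rpow_of_exponent_ge hρ h hδn
          nlinarith
  · calc ∫⁻ y in ball x ρ, decayWeight y ^ β ≤ ∫⁻ y in ball x ρ, decayWeight y :=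
          lintegral_mono fun y => ENNReal.rpow_le_self_of_le_one (decayWeight_le_one y) hβ
      _ ≤ ∫⁻ y, decayWeight y := setLIntegral_le_lintegral _ _
      _ = ENNReal.ofReal I := (ENNReal.ofReal_toReal hI.ne).symm
      _ ≤ _ := by
          apply ENNReal.ofReal_le_ofReal
          have h1 : 1 ≤ ρ ^ δ := Real.one_le_rpow h hδ
          nlinarith

/-- On compact sets, `decayWeight` is bounded below. -/
theorem exists_setLIntegral_le_decayWeight {K : Set (EuclideanSpace ℝ (Fin n))}
    (hK : IsCompact K) : ∃ c : ℝ≥0∞, c ≠ ⊤ ∧ ∀ g : EuclideanSpace ℝ (Fin n) → ℂ,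
      ∫⁻ x in K, ‖g x‖ₑ ^ 2 ≤ c * ∫⁻ x, ‖g x‖ₑ ^ 2 * decayWeight x := by
  obtain ⟨R, hR⟩ := hK.isBounded.exists_norm_le
  set c : ℝ≥0∞ := ENNReal.ofReal ((1 + |R|) ^ ((n : ℝ) + 1)) with hc
  refine ⟨c, ENNReal.ofReal_ne_top, fun g => ?_⟩
  rw [← lintegral_const_mul' _ _ ENNReal.ofReal_ne_top]
  refine le_trans (setLIntegral_mono' hK.measurableSet fun x hx => ?_)
    (setLIntegral_le_lintegral _ _)
  have h1 : 1 ≤ c * decayWeight x := by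
    rw [hc, decayWeight, ← ENNReal.ofReal_mul (by positivity), ENNReal.one_le_ofReal,
      Real.rpow_neg (by positivity), ← div_eq_mul_inv, one_le_div (by positivity)]
    gcongr
    exact (hR x hx).trans (le_abs_self R)
  calc ‖g x‖ₑ ^ 2 = ‖g x‖ₑ ^ 2 * 1 := (mul_one _).symm
    _ ≤ ‖g x‖ₑ ^ 2 * (c * decayWeight x) := by gcongr
    _ = _ := by ring

end Approximation

/-! ### The propagation of a general function -/

section Propagation

variable {n : ℕ}

/-- A measurable function which is square integrable against `decayWeight` is locally
integrable. -/
theorem locallyIntegrable_of_lintegral_decayWeight {g : EuclideanSpace ℝ (Fin n) → ℂ}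
    (hg : Measurable g) (h : ∫⁻ x, ‖g x‖ₑ ^ 2 * decayWeight x ≠ ⊤) :
    LocallyIntegrable g volume := by
  rw [locallyIntegrable_iff]
  intro K hK
  refine ⟨hg.aestronglyMeasurable, ?_⟩
  obtain ⟨c, hc, hcK⟩ := exists_setLIntegral_le_decayWeight hK
  have hle : ∀ x, ‖g x‖ₑ ≤ 1 + ‖g x‖ₑ ^ 2 := fun x => by
    rcases le_total ‖g x‖ₑ 1 with h1 | h1
    · exact h1.trans le_self_add
    · exact (le_self_pow₀ h1 two_ne_zero).trans le_add_self
  calc ∫⁻ x in K, ‖g x‖ₑ ≤ ∫⁻ x in K, (1 + ‖g x‖ₑ ^ 2) := lintegral_mono hle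
    _ = volume K + ∫⁻ x in K, ‖g x‖ₑ ^ 2 := by
        rw [lintegral_add_left measurable_const, setLIntegral_one]
    _ < ⊤ := ENNReal.add_lt_top.2 ⟨hK.measure_lt_top,
        (hcK g).trans_lt (ENNReal.mul_lt_top hc.lt_top h.lt_top)⟩

theorem lintegral_fracSymbol_mul_fourierInv_lt_top [Nontrivial (EuclideanSpace ℝ (Fin n))]
    {γ s t : ℝ} (hs : -(n : ℝ) < 2 * s) {φ : EuclideanSpace ℝ (Fin n) → ℂ}
    (hφ : ContDiff ℝ ∞ φ) (hφc : HasCompactSupport φ) :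
    ∫⁻ η, ‖fracSymbol γ s t η * (𝓕⁻ φ) η‖ₑ ^ 2 < ⊤ := by
  have h := lintegral_fracSymbol_mul_sq_lt_top (γ := γ) (t := t) hs
    (𝓕⁻ (hφc.toSchwartzMap hφ))
  rw [SchwartzMap.fourierInv_coe] at h
  exact h

theorem measurable_fracSymbol_mul_fourierInv {γ s t : ℝ} {φ : EuclideanSpace ℝ (Fin n) → ℂ}
    (hφ : ContDiff ℝ ∞ φ) (hφc : HasCompactSupport φ) :
    Measurable fun η => fracSymbol γ s t η * (𝓕⁻ φ) η := by
  have h := (𝓕⁻ (hφc.toSchwartzMap hφ)).continuous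
  rw [SchwartzMap.fourierInv_coe] at h
  exact ((measurable_fracSymbol γ s).comp (by fun_prop : Measurable fun η => (t, η))).mul
    h.measurable

theorem integrable_fracSymbol_mul_fourierInv [Nontrivial (EuclideanSpace ℝ (Fin n))]
    {γ s t : ℝ} (hs : -(n : ℝ) < 2 * s) {F φ : EuclideanSpace ℝ (Fin n) → ℂ} (hF : Measurable F)
    (hF2 : ∫⁻ η, ‖F η‖ₑ ^ 2 ≠ ⊤) (hφ : ContDiff ℝ ∞ φ) (hφc : HasCompactSupport φ) :
    Integrable fun η => fracSymbol γ s t η * F η * (𝓕⁻ φ) η := by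
  have hm := measurable_fracSymbol_mul_fourierInv (γ := γ) (s := s) (t := t) hφ hφc
  have he : (fun η => fracSymbol γ s t η * F η * (𝓕⁻ φ) η) =
      fun η => F η * (fracSymbol γ s t η * (𝓕⁻ φ) η) := by
    ext η; ring
  rw [he]
  refine ⟨(hF.mul hm).aestronglyMeasurable, ?_⟩
  rw [HasFiniteIntegral]
  simp only [enorm_mul (F _)]
  refine (lintegral_enorm_mul_le hF.aemeasurable hm.aemeasurable).trans_lt ?_
  exact ENNReal.mul_lt_top (ENNReal.rpow_lt_top_of_nonneg (by norm_num) hF2)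
    (ENNReal.rpow_lt_top_of_nonneg (by norm_num)
      (lintegral_fracSymbol_mul_fourierInv_lt_top hs hφ hφc).ne)

/-- The right-hand side of the pairing depends continuously on the frequency datum in `L²`. -/
theorem tendsto_integral_fracSymbol_mul_fourierInv [Nontrivial (EuclideanSpace ℝ (Fin n))]
    {γ s t : ℝ} (hs : -(n : ℝ) < 2 * s) {F φ : EuclideanSpace ℝ (Fin n) → ℂ} (hF : Measurable F)
    (hF2 : ∫⁻ η, ‖F η‖ₑ ^ 2 ≠ ⊤) {G : ℕ → EuclideanSpace ℝ (Fin n) → ℂ}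
    (hG : ∀ k, Measurable (G k)) (hG2 : ∀ k, ∫⁻ η, ‖G k η‖ₑ ^ 2 ≠ ⊤)
    (hlim : Tendsto (fun k => ∫⁻ η, ‖G k η - F η‖ₑ ^ 2) atTop (𝓝 0))
    (hφ : ContDiff ℝ ∞ φ) (hφc : HasCompactSupport φ) :
    Tendsto (fun k => ∫ η, fracSymbol γ s t η * G k η * (𝓕⁻ φ) η) atTop
      (𝓝 (∫ η, fracSymbol γ s t η * F η * (𝓕⁻ φ) η)) := by
  have hm := measurable_fracSymbol_mul_fourierInv (γ := γ) (s := s) (t := t) hφ hφc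
  refine tendsto_integral_of_L1 _
    (integrable_fracSymbol_mul_fourierInv hs hF hF2 hφ hφc).aestronglyMeasurable
    (Eventually.of_forall fun k => integrable_fracSymbol_mul_fourierInv hs (hG k) (hG2 k) hφ hφc) ?_
  set A := (∫⁻ η, ‖fracSymbol γ s t η * (𝓕⁻ φ) η‖ₑ ^ 2) ^ (1 / 2 : ℝ) with hA
  have hAt : A ≠ ⊤ := ENNReal.rpow_ne_top_of_nonneg (by norm_num)
    (lintegral_fracSymbol_mul_fourierInv_lt_top hs hφ hφc).ne
  have h0 : Tendsto (fun k => (∫⁻ η, ‖G k η - F η‖ₑ ^ 2) ^ (1 / 2 : ℝ) * A) atTop (𝓝 0) := by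
    have h1 := ENNReal.Tendsto.mul_const (hlim.ennrpow_const (1 / 2 : ℝ)) (Or.inr hAt)
    rwa [ENNReal.zero_rpow_of_pos (by norm_num), zero_mul] at h1
  refine tendsto_of_tendsto_of_tendsto_of_le_of_le tendsto_const_nhds h0 (fun _ => zero_le)
    fun k => ?_
  have hcs := lintegral_enorm_mul_le (μ := volume) ((hG k).sub hF).aemeasurable hm.aemeasurable
  simp only [Pi.sub_apply] at hcs
  refine le_trans (le_of_eq (lintegral_congr fun η => ?_)) hcs
  rw [← enorm_mul, mul_right_comm _ (G k η), mul_right_comm _ (F η), ← mul_sub, mul_comm]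

/-- The left-hand side of the pairing depends continuously on the function in weighted `L²`. -/
theorem tendsto_integral_mul_of_lintegral_decayWeight {g : EuclideanSpace ℝ (Fin n) → ℂ}
    {h : ℕ → EuclideanSpace ℝ (Fin n) → ℂ} (hg : Measurable g) (hh : ∀ k, Measurable (h k))
    (hgl : LocallyIntegrable g volume) (hhl : ∀ k, LocallyIntegrable (h k) volume)
    (hlim : Tendsto (fun k => ∫⁻ x, ‖h k x - g x‖ₑ ^ 2 * decayWeight x) atTop (𝓝 0))
    {φ : EuclideanSpace ℝ (Fin n) → ℂ} (hφ : Continuous φ) (hφc : HasCompactSupport φ) :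
    Tendsto (fun k => ∫ x, h k x * φ x) atTop (𝓝 (∫ x, g x * φ x)) := by
  have hint : ∀ v : EuclideanSpace ℝ (Fin n) → ℂ, LocallyIntegrable v volume →
      Integrable fun x => v x * φ x := fun v hv => by
    simpa only [smul_eq_mul, mul_comm] using
      hv.integrable_smul_left_of_hasCompactSupport hφ hφc
  refine tendsto_integral_of_L1 _ (hint g hgl).aestronglyMeasurable
    (Eventually.of_forall fun k => hint _ (hhl k)) ?_
  obtain ⟨c, hc, hcK⟩ := exists_setLIntegral_le_decayWeight hφc.isCompact
  set A := (∫⁻ x in tsupport φ, ‖φ x‖ₑ ^ 2) ^ (1 / 2 : ℝ) with hA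
  have hAt : A ≠ ⊤ := by
    obtain ⟨B, hB⟩ := hφ.bounded_above_of_compact_support hφc
    refine ENNReal.rpow_ne_top_of_nonneg (by norm_num) (ne_of_lt ?_)
    calc ∫⁻ x in tsupport φ, ‖φ x‖ₑ ^ 2 ≤ ∫⁻ x in tsupport φ, ENNReal.ofReal B ^ 2 := by
          refine lintegral_mono fun x => pow_le_pow_left' ?_ 2
          rw [← ofReal_norm]
          exact ENNReal.ofReal_le_ofReal (hB x)
      _ < ⊤ := by
          rw [setLIntegral_const]
          exact ENNReal.mul_lt_top (ENNReal.pow_lt_top ENNReal.ofReal_lt_top)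
            hφc.isCompact.measure_lt_top
  have h0 : Tendsto (fun k => (c * ∫⁻ x, ‖h k x - g x‖ₑ ^ 2 * decayWeight x) ^ (1 / 2 : ℝ) * A)
      atTop (𝓝 0) := by
    have h1 := ENNReal.Tendsto.const_mul hlim (Or.inr hc)
    rw [mul_zero] at h1
    have h2 := ENNReal.Tendsto.mul_const (h1.ennrpow_const (1 / 2 : ℝ)) (Or.inr hAt)
    rwa [ENNReal.zero_rpow_of_pos (by norm_num), zero_mul] at h2
  refine tendsto_of_tendsto_of_tendsto_of_le_of_le tendsto_const_nhds h0 (fun _ => zero_le)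
    fun k => ?_
  calc ∫⁻ x, ‖h k x * φ x - g x * φ x‖ₑ = ∫⁻ x in tsupport φ, ‖h k x * φ x - g x * φ x‖ₑ := by
        refine (setLIntegral_eq_of_support_subset fun x hx => ?_).symm
        by_contra hxs
        refine hx ?_
        simp [image_eq_zero_of_notMem_tsupport hxs]
    _ = ∫⁻ x in tsupport φ, ‖h k x - g x‖ₑ * ‖φ x‖ₑ := by
        refine lintegral_congr fun x => ?_
        rw [← sub_mul, enorm_mul]
    _ ≤ (∫⁻ x in tsupport φ, ‖h k x - g x‖ₑ ^ 2) ^ (1 / 2 : ℝ) * A :=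
        lintegral_enorm_mul_le ((hh k).sub hg).aemeasurable hφ.measurable.aemeasurable
    _ ≤ _ := by
        gcongr
        exact hcK fun x => h k x - g x

/-- The function `|∇|^s e^{-it(-Δ)^{γ/2}} f` is the almost everywhere limit of its analogues for
data with bounded, annularly supported Fourier transforms. -/
theorem exists_isFracPropagation [Nontrivial (EuclideanSpace ℝ (Fin n))] {δ β γ s : ℝ}
    (hγ : 0 < γ) (hδ : 0 ≤ δ) (hδn : δ ≤ n) (hβ : 1 ≤ β)
    (hκ : β - 1 < ((n - 1 : ℕ) : ℝ) / 2 - δ) (hs : 2 * s = γ - ((n : ℝ) - δ) / β)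
    (hsn : -(n : ℝ) < 2 * s) (f : Lp ℂ 2 (volume : Measure (EuclideanSpace ℝ (Fin n)))) :
    ∃ u : ℝ → EuclideanSpace ℝ (Fin n) → ℂ, IsFracPropagation γ s f u ∧
      Measurable (Function.uncurry u) ∧
      ∃ G : ℕ → EuclideanSpace ℝ (Fin n) → ℂ, (∀ k, IsAnnular (G k)) ∧
        (∀ k, ∫⁻ η, ‖G k η‖ₑ ^ 2 ≤ ‖f‖ₑ ^ 2) ∧
        ∀ᵐ p : ℝ × EuclideanSpace ℝ (Fin n) ∂(volume.prod volume),
          Tendsto (fun k => freqEvol γ s (G k) p.1 p.2) atTop (𝓝 (u p.1 p.2)) := by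
  set F : EuclideanSpace ℝ (Fin n) → ℂ := fun η => (𝓕 f) η with hFdef
  have hF : Measurable F := (Lp.stronglyMeasurable (𝓕 f : Lp ℂ 2 _)).measurable
  have hFn : ∫⁻ η, ‖F η‖ₑ ^ 2 = ‖f‖ₑ ^ 2 := by
    have h2 := eLpNorm_nnreal_pow_eq_lintegral (μ := volume) (p := 2) (f := F) (by norm_num)
    have e2 : ((2 : ℝ≥0) : ℝ) = 2 := rfl
    simp only [e2, ENNReal.rpow_two] at h2
    rw [← h2]
    congr 1
    change eLpNorm (𝓕 f : Lp ℂ 2 (volume : Measure (EuclideanSpace ℝ (Fin n)))) 2 volume = _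
    rw [← Lp.enorm_def, ← ofReal_norm, ← ofReal_norm, Lp.norm_fourier_eq]
  have hF2 : ∫⁻ η, ‖F η‖ₑ ^ 2 ≠ ⊤ := by
    rw [hFn]; exact ENNReal.pow_ne_top enorm_ne_top
  -- The weighted estimate for the fixed weight `decayWeight`.
  obtain ⟨M, hM, hMor⟩ := exists_morrey_decayWeight (n := n) hδ hδn hβ
  obtain ⟨C, hC⟩ := exists_weighted_freqEvol_le (n := n) hγ hδ hβ hκ hs
  set A : ℝ≥0 := C * (M ^ (1 / β)).toNNReal with hA
  have hest : ∀ H, IsAnnular H → ∫⁻ p : ℝ × EuclideanSpace ℝ (Fin n),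
      ‖freqEvol γ s H p.1 p.2‖ₑ ^ 2 * decayWeight p.2 ∂(volume.prod volume) ≤
        A * ∫⁻ η, ‖H η‖ₑ ^ 2 := by
    intro H hH
    have hm : Measurable fun p : ℝ × EuclideanSpace ℝ (Fin n) =>
        ‖freqEvol γ s H p.1 p.2‖ₑ ^ 2 * decayWeight p.2 :=
      ((measurable_freqEvol hH.measurable γ s).enorm.pow_const 2).mul
        (measurable_decayWeight.comp measurable_snd)
    rw [lintegral_prod _ hm.aemeasurable]
    refine (hC M hM _ measurable_decayWeight hMor H hH).trans_eq ?_
    rw [hA, ENNReal.coe_mul, ENNReal.ofReal]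
  -- Approximation of `F` at a geometric rate.
  have hε : ∀ k : ℕ, (0 : ℝ≥0∞) < (((1 / 4 : ℝ≥0) ^ k : ℝ≥0) : ℝ≥0∞) := fun k => by
    rw [ENNReal.coe_pos]; positivity
  choose G hG hGF hGε using fun k => exists_isAnnular_approx hF hF2 (hε k)
  have hGle : ∀ k, ∫⁻ η, ‖G k η‖ₑ ^ 2 ≤ ∫⁻ η, ‖F η‖ₑ ^ 2 := fun k =>
    lintegral_mono fun η => pow_le_pow_left' (hGF k η) 2
  have hG2 : ∀ k, ∫⁻ η, ‖G k η‖ₑ ^ 2 ≠ ⊤ := fun k => ne_top_of_le_ne_top hF2 (hGle k)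
  have hGlim : Tendsto (fun k => ∫⁻ η, ‖G k η - F η‖ₑ ^ 2) atTop (𝓝 0) := by
    refine tendsto_of_tendsto_of_tendsto_of_le_of_le tendsto_const_nhds ?_ (fun _ => zero_le)
      fun k => (hGε k).le
    rw [← ENNReal.coe_zero, ENNReal.tendsto_coe]
    exact tendsto_pow_atTop_nhds_zero_of_lt_one zero_le (by norm_num)
  set U : ℕ → ℝ × EuclideanSpace ℝ (Fin n) → ℂ := fun k p => freqEvol γ s (G k) p.1 p.2 with hU
  have hUm : ∀ k, Measurable (U k) := fun k => measurable_freqEvol (hG k).measurable γ s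
  set b : ℕ → ℝ≥0 := fun k => (2 * A + 1) * (1 / 2) ^ k with hb
  have hdw : Measurable fun p : ℝ × EuclideanSpace ℝ (Fin n) => decayWeight p.2 :=
    measurable_decayWeight.comp measurable_snd
  have hcau : ∀ N k m, N ≤ k → N ≤ m → ∫⁻ p, ‖U k p - U m p‖ₑ ^ 2 * decayWeight p.2
      ∂(volume.prod volume) < (b N : ℝ≥0∞) ^ 2 := by
    intro N k m hk hm
    have quarter_le : (1 / 4 : ℝ≥0) ≤ 1 := by
      rw [← NNReal.coe_le_coe]; norm_num
    have h1 : ∀ j, N ≤ j → ∫⁻ η, ‖G j η - F η‖ₑ ^ 2 ≤ (((1 / 4 : ℝ≥0) ^ N : ℝ≥0) : ℝ≥0∞) := by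
      intro j hj
      refine (hGε j).le.trans (ENNReal.coe_le_coe.2 ?_)
      exact pow_le_pow_of_le_one zero_le quarter_le hj
    calc ∫⁻ p, ‖U k p - U m p‖ₑ ^ 2 * decayWeight p.2 ∂(volume.prod volume)
        = ∫⁻ p : ℝ × EuclideanSpace ℝ (Fin n),
            ‖freqEvol γ s (G k - G m) p.1 p.2‖ₑ ^ 2 * decayWeight p.2 ∂(volume.prod volume) := by
          simp only [freqEvol_sub (hG k) (hG m)]; rfl
      _ ≤ A * ∫⁻ η, ‖(G k - G m) η‖ₑ ^ 2 := hest _ ((hG k).sub (hG m))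
      _ ≤ A * ∫⁻ η, (2 * ‖G k η - F η‖ₑ ^ 2 + 2 * ‖G m η - F η‖ₑ ^ 2) := by
          gcongr with η
          have := enorm_sub_sq_le (G k η - F η) (G m η - F η)
          rwa [sub_sub_sub_cancel_right] at this
      _ = A * (2 * (∫⁻ η, ‖G k η - F η‖ₑ ^ 2) + 2 * (∫⁻ η, ‖G m η - F η‖ₑ ^ 2)) := by
          have hm : Measurable fun η => 2 * ‖G k η - F η‖ₑ ^ 2 :=
            (((hG k).measurable.sub hF).enorm.pow_const 2).const_mul 2
          rw [lintegral_add_left hm,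
            lintegral_const_mul' _ _ (by simp), lintegral_const_mul' _ _ (by simp)]
      _ ≤ A * (2 * (((1 / 4 : ℝ≥0) ^ N : ℝ≥0) : ℝ≥0∞) + 2 * (((1 / 4 : ℝ≥0) ^ N : ℝ≥0) : ℝ≥0∞)) := by
          gcongr
          · exact h1 k hk
          · exact h1 m hm
      _ < (b N : ℝ≥0∞) ^ 2 := by
          have e2 : (2 : ℝ≥0∞) = ((2 : ℝ≥0) : ℝ≥0∞) := rfl
          rw [e2]
          norm_cast
          rw [hb, ← NNReal.coe_lt_coe]
          push_cast
          have h4 : ((1 / 2 : ℝ) ^ N) ^ 2 = (1 / 4) ^ N := by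
            rw [← pow_mul, mul_comm, pow_mul]; norm_num
          rw [mul_pow, h4]
          have h5 : (0 : ℝ) < (1 / 4) ^ N := by positivity
          nlinarith [sq_nonneg (A : ℝ), A.coe_nonneg, mul_nonneg (sq_nonneg (A : ℝ)) h5.le]
  have hbsum : ∑' k, (b k : ℝ≥0∞) ≠ ⊤ := by
    rw [ENNReal.tsum_coe_ne_top_iff_summable, ← NNReal.summable_coe]
    simp only [hb, NNReal.coe_mul]
    refine Summable.mul_left _ ?_
    push_cast
    exact summable_geometric_two
  have hb2sum : ∑' k, (b k : ℝ≥0∞) ^ 2 ≠ ⊤ := by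
    have : ∀ k, (b k : ℝ≥0∞) ^ 2 = (((2 * A + 1) ^ 2 * (1 / 4) ^ k : ℝ≥0) : ℝ≥0∞) := fun k => by
      rw [← ENNReal.coe_pow, hb]
      congr 1
      rw [mul_pow, ← pow_mul (1 / 2 : ℝ≥0), mul_comm k, pow_mul (1 / 2 : ℝ≥0)]
      norm_num
    simp only [this]
    rw [ENNReal.tsum_coe_ne_top_iff_summable, ← NNReal.summable_coe]
    simp only [NNReal.coe_mul]
    refine Summable.mul_left _ ?_
    push_cast
    exact summable_geometric_of_lt_one (by norm_num) (by norm_num)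
  obtain ⟨v, hvm, hv⟩ := exists_measurable_ae_tendsto_of_cauchy hUm hdw
    (fun p => decayWeight_ne_zero p.2) (fun p => ENNReal.ofReal_ne_top) hbsum hcau
  have hsec : ∀ t : ℝ, Measurable fun x => v (t, x) := fun t => hvm.comp (by fun_prop)
  have hUsec : ∀ k (t : ℝ), Measurable fun x => U k (t, x) := fun k t =>
    (hUm k).comp (by fun_prop)
  have hvU : ∀ k, ∫⁻ p, ‖U k p - v p‖ₑ ^ 2 * decayWeight p.2 ∂(volume.prod volume) ≤
      (b k : ℝ≥0∞) ^ 2 := by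
    intro k
    refine lintegral_sq_mul_le_of_tendsto (U := fun m p => U k p - U m p)
      (fun m => (hUm k).sub (hUm m)) hdw (hv.mono fun p hp => tendsto_const_nhds.sub hp) ?_
    filter_upwards [eventually_ge_atTop k] with m hm
    exact (hcau k k m le_rfl hm).le
  have hvint : ∫⁻ p, ‖v p‖ₑ ^ 2 * decayWeight p.2 ∂(volume.prod volume) ≤
      A * ∫⁻ η, ‖F η‖ₑ ^ 2 := by
    refine lintegral_sq_mul_le_of_tendsto hUm hdw hv (Eventually.of_forall fun k => ?_)
    exact (hest _ (hG k)).trans (mul_le_mul' le_rfl (hGle k))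
  have hAF : (A : ℝ≥0∞) * ∫⁻ η, ‖F η‖ₑ ^ 2 ≠ ⊤ := ENNReal.mul_ne_top ENNReal.coe_ne_top hF2
  have hmeas2 : ∀ V : ℝ × EuclideanSpace ℝ (Fin n) → ℂ, Measurable V →
      Measurable fun p => ‖V p‖ₑ ^ 2 * decayWeight p.2 := fun V hV =>
    (hV.enorm.pow_const 2).mul hdw
  have hsecfin : ∀ V : ℝ × EuclideanSpace ℝ (Fin n) → ℂ, Measurable V →
      ∫⁻ p, ‖V p‖ₑ ^ 2 * decayWeight p.2 ∂(volume.prod volume) ≠ ⊤ →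
      ∀ᵐ t : ℝ, LocallyIntegrable (fun x => V (t, x)) volume := by
    intro V hV hfin
    rw [lintegral_prod _ (hmeas2 V hV).aemeasurable] at hfin
    filter_upwards [ae_lt_top (hmeas2 V hV).lintegral_prod_right' hfin] with t ht
    exact locallyIntegrable_of_lintegral_decayWeight (hV.comp (by fun_prop)) ht.ne
  have hloc := hsecfin v hvm (ne_top_of_le_ne_top hAF hvint)
  have hUloc : ∀ᵐ t : ℝ, ∀ k, LocallyIntegrable (fun x => U k (t, x)) volume :=
    ae_all_iff.2 fun k => hsecfin _ (hUm k) (ne_top_of_le_ne_top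
      (ENNReal.mul_ne_top ENNReal.coe_ne_top (hG2 k)) (hest _ (hG k)))
  -- For almost every `t` the convergence holds in weighted `L²` of space.
  have hslice : ∀ᵐ t : ℝ, Tendsto (fun k => ∫⁻ x, ‖U k (t, x) - v (t, x)‖ₑ ^ 2 * decayWeight x)
      atTop (𝓝 0) := by
    have hm : ∀ k, Measurable fun t : ℝ =>
        ∫⁻ x, ‖U k (t, x) - v (t, x)‖ₑ ^ 2 * decayWeight x := fun k =>
      (hmeas2 (fun p => U k p - v p) ((hUm k).sub hvm)).lintegral_prod_right'
    have hfin : ∫⁻ t : ℝ, ∑' k, ∫⁻ x, ‖U k (t, x) - v (t, x)‖ₑ ^ 2 * decayWeight x ≠ ⊤ := by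
      rw [lintegral_tsum fun k => (hm k).aemeasurable]
      refine ne_top_of_le_ne_top hb2sum (ENNReal.tsum_le_tsum fun k => ?_)
      refine le_trans (le_of_eq ?_) (hvU k)
      rw [lintegral_prod _ (hmeas2 (fun p => U k p - v p) ((hUm k).sub hvm)).aemeasurable]
    filter_upwards [ae_lt_top (Measurable.tsum hm) hfin] with t ht
    exact ENNReal.tendsto_atTop_zero_of_tsum_ne_top ht.ne
  refine ⟨fun t x => v (t, x), ⟨hvm.aestronglyMeasurable, hloc, fun t φ hφ hφc =>
    integrable_fracSymbol_mul_fourierInv hsn hF hF2 hφ hφc, ?_⟩, hvm, G, hG,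
    fun k => (hGle k).trans_eq hFn, hv⟩
  filter_upwards [hloc, hUloc, hslice] with t h1 h2 h3 φ hφ hφc
  have hL := tendsto_integral_mul_of_lintegral_decayWeight (hsec t) (fun k => hUsec k t) h1 h2 h3
    hφ.continuous hφc
  have hR := tendsto_integral_fracSymbol_mul_fourierInv (γ := γ) (t := t) hsn hF hF2
    (fun k => (hG k).measurable) hG2 hGlim hφ hφc
  refine tendsto_nhds_unique (hL.congr fun k => ?_) hR
  exact (hG k).integral_freqEvol_mul γ s t (hφ.continuous.integrable_of_hasCompactSupport hφc)

end Propagation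

end

/-! ### Passing to the limit in the weighted estimate -/

section WeightedEstimate

open Set Metric Filter Topology

variable {n : ℕ}

/-- The weighted estimate passes to almost everywhere limits of frequency-localized
propagations. -/
theorem lintegral_sq_mul_le_of_tendsto_freqEvol {γ s : ℝ}
    {G : ℕ → EuclideanSpace ℝ (Fin n) → ℂ} (hG : ∀ k, Measurable (G k))
    {u : ℝ → EuclideanSpace ℝ (Fin n) → ℂ} (hu : Measurable (Function.uncurry u))
    (hlim : ∀ᵐ p : ℝ × EuclideanSpace ℝ (Fin n) ∂(volume.prod volume),
      Tendsto (fun k => freqEvol γ s (G k) p.1 p.2) atTop (𝓝 (u p.1 p.2)))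
    {w : EuclideanSpace ℝ (Fin n) → ℝ≥0∞} (hw : Measurable w) {c : ℝ≥0∞}
    (hc : ∀ k, ∫⁻ t : ℝ, ∫⁻ x, ‖freqEvol γ s (G k) t x‖ₑ ^ 2 * w x ≤ c) :
    ∫⁻ t : ℝ, ∫⁻ x, ‖u t x‖ₑ ^ 2 * w x ≤ c := by
  have hwm : Measurable fun p : ℝ × EuclideanSpace ℝ (Fin n) => w p.2 := hw.comp measurable_snd
  have hm : ∀ V : ℝ × EuclideanSpace ℝ (Fin n) → ℂ, Measurable V →
      ∫⁻ p, ‖V p‖ₑ ^ 2 * w p.2 ∂(volume.prod volume) =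
        ∫⁻ t : ℝ, ∫⁻ x, ‖V (t, x)‖ₑ ^ 2 * w x := fun V hV => by
    have h : Measurable fun p => ‖V p‖ₑ ^ 2 * w p.2 := (hV.enorm.pow_const 2).mul hwm
    rw [lintegral_prod _ h.aemeasurable]
  have h := lintegral_sq_mul_le_of_tendsto (u := Function.uncurry u) (c := c)
    (fun k => measurable_freqEvol (hG k) γ s) hwm hlim (Eventually.of_forall fun k => ?_)
  · rwa [hm _ hu] at h
  · rw [hm _ (measurable_freqEvol (hG k) γ s)]
    exact hc k

end WeightedEstimate

theorem theorem2 (n : ℕ) (hn : 2 ≤ n) (γ β α s : ℝ) (hγ : 1 < γ)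
    (hβ₁ : 1 ≤ β) (hβ₂ : β < ((n : ℝ) + 1) / 2)
    (hα₁ : β + ((n : ℝ) - 1) / 2 < α) (hα₂ : α < (n : ℝ))
    (hs : s = 1 - (1 / 2) * (α / β + 2 - γ)) :
    ∃ C : ℝ≥0, ∀ f : Lp ℂ 2 (volume : Measure (EuclideanSpace ℝ (Fin n))),
      ∃ u : ℝ → EuclideanSpace ℝ (Fin n) → ℂ, IsFracPropagation γ s f u ∧
        ∀ w : EuclideanSpace ℝ (Fin n) → ℝ≥0∞,
          AEMeasurable w volume →
          LocallyIntegrable (fun x => w x ^ β) volume →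
            weightedNorm w u ≤
              (C : ℝ≥0∞) * ksNorm α (fun x => w x ^ β) ^ (1 / (2 * β)) * ‖f‖ₑ := by
  have hn0 : NeZero n := ⟨by omega⟩
  have hnt : Nontrivial (EuclideanSpace ℝ (Fin n)) :=
    Module.nontrivial_of_finrank_pos (R := ℝ) (by rw [finrank_euclideanSpace_fin]; omega)
  have hn2 : (2 : ℝ) ≤ n := by exact_mod_cast hn
  have hβ0 : 0 < β := by linarith
  have hα0 : 0 ≤ α := by linarith
  have hκ : β - 1 < ((n - 1 : ℕ) : ℝ) / 2 - ((n : ℝ) - α) := by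
    rw [Nat.cast_sub (by omega)]; push_cast; linarith
  have hs2 : 2 * s = γ - ((n : ℝ) - ((n : ℝ) - α)) / β := by rw [hs]; ring
  have hsn : -(n : ℝ) < 2 * s := by
    have : α / β ≤ α := div_le_self hα0 hβ₁
    rw [hs2, sub_sub_cancel]; linarith
  obtain ⟨C, hC⟩ := exists_weighted_freqEvol_le (n := n) (by linarith : 0 < γ)
    (by linarith : 0 ≤ (n : ℝ) - α) hβ₁ hκ hs2
  obtain ⟨K, hK0, hK⟩ := exists_lintegral_ball_le_ksNorm (n := n) hα₂.le
  -- Adding `1` makes the constant nonzero, as needed when the Kerman-Sawyer norm is infinite.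
  set D : ℝ≥0 := (C * (K ^ (1 / β)).toNNReal) ^ (1 / 2 : ℝ) + 1 with hD
  refine ⟨D, fun f => ?_⟩
  obtain ⟨u, hu, hum, G, hG, hGf, hlim⟩ := exists_isFracPropagation (n := n)
    (by linarith : 0 < γ) (by linarith : 0 ≤ (n : ℝ) - α) (by linarith) hβ₁ hκ hs2 hsn f
  refine ⟨u, hu, fun w hw hwβ => ?_⟩
  set ks := ksNorm α (fun x => w x ^ β) with hks
  set w' := hw.mk w with hw'
  have hw'm : Measurable w' := hw.measurable_mk
  have hww' : ∀ᵐ x, w x = w' x := hw.ae_eq_mk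
  have hnorm : weightedNorm w u = (∫⁻ t : ℝ, ∫⁻ x, ‖u t x‖ₑ ^ 2 * w' x) ^ (1 / 2 : ℝ) := by
    unfold weightedNorm
    congr 1
    refine lintegral_congr fun t => lintegral_congr_ae (hww'.mono fun x hx => ?_)
    simp only [hx]
  have hball : ∀ (x : EuclideanSpace ℝ (Fin n)) (ρ : ℝ), 0 < ρ →
      ∫⁻ y in Metric.ball x ρ, w' y ^ β ≤
        ks * ENNReal.ofReal (K * ρ ^ ((n : ℝ) - α)) := by
    intro x ρ hρ
    refine le_trans (le_of_eq ?_) (hK _ hwβ x ρ hρ)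
    exact lintegral_congr_ae (ae_restrict_of_ae (hww'.mono fun y hy => by simp only [hy]))
  have hβ2 : 0 < 1 / (2 * β) := by positivity
  rw [hnorm]
  rcases eq_or_ne f 0 with hf | hf
  · have hz : ∫⁻ t : ℝ, ∫⁻ x, ‖u t x‖ₑ ^ 2 * w' x ≤ 0 := by
      refine lintegral_sq_mul_le_of_tendsto_freqEvol (fun k => (hG k).measurable) hum hlim hw'm
        fun k => ?_
      have h0 : ∫⁻ η, ‖G k η‖ₑ ^ 2 = 0 := by
        have := hGf k
        simpa [hf] using this
      rw [lintegral_eq_zero_iff ((hG k).measurable.enorm.pow_const 2)] at h0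
      have h1 : ∀ t x, freqEvol γ s (G k) t x = 0 := fun t x => by
        refine integral_eq_zero_of_ae (h0.mono fun η hη => ?_)
        have : G k η = 0 := by simpa using hη
        simp [this]
      simp [h1]
    rw [le_zero_iff.1 hz, ENNReal.zero_rpow_of_pos (by norm_num)]
    exact zero_le
  have hf0 : ‖f‖ₑ ≠ 0 := by simpa using hf
  rcases eq_or_ne ks ⊤ with htop | htop
  · have hD0 : (D : ℝ≥0∞) ≠ 0 := by
      rw [hD]; simp
    rw [htop, ENNReal.top_rpow_of_pos hβ2, ENNReal.mul_top hD0, ENNReal.top_mul hf0]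
    exact le_top
  rcases eq_or_ne ks 0 with h0 | h0
  · have hw0 : ∫⁻ x, w' x ^ β ≤ 0 := by
      refine lintegral_le_of_forall_ball fun m => ?_
      rcases Nat.eq_zero_or_pos m with hm | hm
      · simp [hm]
      · refine (hball 0 m (by exact_mod_cast hm)).trans ?_
        rw [h0, zero_mul]
    have hw0' := (lintegral_eq_zero_iff (hw'm.pow_const β)).1 (le_zero_iff.1 hw0)
    have hz : ∫⁻ t : ℝ, ∫⁻ x, ‖u t x‖ₑ ^ 2 * w' x = 0 := by
      refine (lintegral_congr fun t => ?_).trans lintegral_zero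
      refine (lintegral_congr_ae (hw0'.mono fun x hx => ?_)).trans lintegral_zero
      have : w' x = 0 := by
        rcases ENNReal.rpow_eq_zero_iff.1 hx with h | h
        · exact h.1
        · linarith [h.2]
      simp [this]
    rw [hz, ENNReal.zero_rpow_of_pos (by norm_num)]
    exact zero_le
  have hk0 : 0 < ks.toReal := ENNReal.toReal_pos h0 htop
  have hMor : ∀ (x : EuclideanSpace ℝ (Fin n)) (ρ : ℝ), 0 < ρ →
      ∫⁻ y in Metric.ball x ρ, w' y ^ β ≤
        ENNReal.ofReal (ks.toReal * K * ρ ^ ((n : ℝ) - α)) := by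
    intro x ρ hρ
    refine (hball x ρ hρ).trans_eq ?_
    rw [mul_assoc, ENNReal.ofReal_mul hk0.le, ENNReal.ofReal_toReal htop]
  have hest : ∫⁻ t : ℝ, ∫⁻ x, ‖u t x‖ₑ ^ 2 * w' x ≤
      C * ENNReal.ofReal ((ks.toReal * K) ^ (1 / β)) * ‖f‖ₑ ^ 2 :=
    lintegral_sq_mul_le_of_tendsto_freqEvol (fun k => (hG k).measurable) hum hlim hw'm
      fun k => (hC _ (by positivity) w' hw'm hMor (G k) (hG k)).trans
        (mul_le_mul' le_rfl (hGf k))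
  have hsplit : C * ENNReal.ofReal ((ks.toReal * K) ^ (1 / β)) * ‖f‖ₑ ^ 2 =
      ((C * (K ^ (1 / β)).toNNReal : ℝ≥0) : ℝ≥0∞) * ks ^ (1 / β) * ‖f‖ₑ ^ 2 := by
    rw [Real.mul_rpow hk0.le hK0.le, ENNReal.ofReal_mul (by positivity),
      ← ENNReal.ofReal_rpow_of_pos hk0, ENNReal.ofReal_toReal htop, ENNReal.coe_mul,
      ENNReal.ofReal]
    ring
  have hhalf : (0 : ℝ) ≤ 1 / 2 := by norm_num
  have he1 : 1 / β * (1 / 2) = 1 / (2 * β) := by rw [one_div_mul_one_div, mul_comm β]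
  have he2 : ((2 : ℕ) : ℝ) * (1 / 2) = 1 := by norm_num
  calc (∫⁻ t : ℝ, ∫⁻ x, ‖u t x‖ₑ ^ 2 * w' x) ^ (1 / 2 : ℝ)
      ≤ (((C * (K ^ (1 / β)).toNNReal : ℝ≥0) : ℝ≥0∞) * ks ^ (1 / β) * ‖f‖ₑ ^ 2) ^ (1 / 2 : ℝ) :=
        ENNReal.rpow_le_rpow (hest.trans_eq hsplit) hhalf
    _ = (((C * (K ^ (1 / β)).toNNReal) ^ (1 / 2 : ℝ) : ℝ≥0) : ℝ≥0∞) * ks ^ (1 / (2 * β)) *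
          ‖f‖ₑ := by
        rw [ENNReal.mul_rpow_of_nonneg _ _ hhalf, ENNReal.mul_rpow_of_nonneg _ _ hhalf,
          ← ENNReal.rpow_mul, ← ENNReal.rpow_natCast_mul, ENNReal.coe_rpow_of_nonneg _ hhalf,
          he1, he2, ENNReal.rpow_one]
    _ ≤ _ := by
        gcongr
        rw [hD]
        exact le_self_add
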